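/- Work in constructive Zermelo–Fraenkel set theory $\mathrm{CZF}$, i.e. the theory over intuitionistic first-order logic with equality whose axioms are extensionality, empty set, pairing, union, strong infinity (there is a least inductive set $\omega$), and the schemes of set induction, bounded ($\Delta_0$) separation, strong collection and subset collection. An ordinal is a transitive set of transitive sets; $\mathrm{Ord}$ is the class of all ordinals. For a set $X$ let $\mathrm{Def}(X)$ be the set of all subsets of $X$ that are definable, by a first-order formula with parameters from $X$, in the structure $\langle X;\in\rangle$. For ordinals $\alpha$ define recursively $$L_\alpha=\bigcup_{\beta\in\alpha}\mathrm{Def}(L_\beta),\qquad\text{and put}\qquad L=\bigcup_{\alpha\in\mathrm{Ord}}L_\alpha .$$ Then $\mathrm{CZF}$ proves the following: for every ordinal $\alpha\subseteq\omega$ we have $\alpha\in L$ (that is, $\mathcal P(\omega)\cap\mathrm{Ord}\subseteq L$), and moreover $\alpha=L_\alpha\cap\mathrm{Ord}$. -/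

import Mathlib

namespace ConstructiveSetTheory

/-! ### First-order formulas of set theory and intuitionistic provability

Variables are de Bruijn indices: under a quantifier, `0` is the variable it binds and `x + 1` is
the variable that was called `x` outside.  In the definitions below, formulas such as `isOrd x`
take the (indices of the) variables they speak about as arguments. -/

/-- Formulas of the first-order language with equality and one binary relation `∈`.
All intuitionistic connectives are primitive; `¬ φ` is `φ → ⊥`. -/
inductive Fml : Type
  | bot : Fml
  | eq : ℕ → ℕ → Fml
  | mem : ℕ → ℕ → Fml
  | and : Fml → Fml → Fml
  | or : Fml → Fml → Fml
  | imp : Fml → Fml → Fml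
  | all : Fml → Fml
  | ex : Fml → Fml

infix:50 " ≡ᶠ " => Fml.eq
infix:50 " ∈ᶠ " => Fml.mem
infixr:35 " ∧ᶠ " => Fml.and
infixr:30 " ∨ᶠ " => Fml.or
infixr:25 " →ᶠ " => Fml.imp

/-- `φ ↔ ψ`. -/
def Fml.iff (φ ψ : Fml) : Fml := (φ →ᶠ ψ) ∧ᶠ (ψ →ᶠ φ)

infix:20 " ↔ᶠ " => Fml.iff

/-- The map of variables with `0 ↦ a` and `n + 1 ↦ f n`. -/
def cons (a : ℕ) (f : ℕ → ℕ) : ℕ → ℕ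
  | 0 => a
  | n + 1 => f n

/-- Capture-avoiding simultaneous substitution of variables for the free variables. -/
def Fml.rename : Fml → (ℕ → ℕ) → Fml
  | .bot, _ => .bot
  | .eq x y, f => .eq (f x) (f y)
  | .mem x y, f => .mem (f x) (f y)
  | .and φ ψ, f => .and (φ.rename f) (ψ.rename f)
  | .or φ ψ, f => .or (φ.rename f) (ψ.rename f)
  | .imp φ ψ, f => .imp (φ.rename f) (ψ.rename f)
  | .all φ, f => .all (φ.rename (cons 0 fun n => f n + 1))
  | .ex φ, f => .ex (φ.rename (cons 0 fun n => f n + 1))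

/-- Weakening by a fresh variable `0`. -/
def Fml.shift (φ : Fml) : Fml := φ.rename fun n => n + 1

/-- Replacing the variable `0` bound by an outermost quantifier by the variable `t`. -/
def Fml.inst (φ : Fml) (t : ℕ) : Fml := φ.rename (cons t fun n => n)

/-- Natural deduction for intuitionistic first-order logic with equality, from the axioms `T`
and the open assumptions `Γ`.  Free variables of the axioms are read as universally quantified. -/
inductive Derives (T : Fml → Prop) : List Fml → Fml → Prop
  | ax {Γ : List Fml} {φ : Fml} : T φ → Derives T Γ φ
  | hyp {Γ : List Fml} {φ : Fml} : φ ∈ Γ → Derives T Γ φ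
  | botE {Γ : List Fml} {φ : Fml} : Derives T Γ .bot → Derives T Γ φ
  | andI {Γ : List Fml} {φ ψ : Fml} : Derives T Γ φ → Derives T Γ ψ → Derives T Γ (φ ∧ᶠ ψ)
  | andE₁ {Γ : List Fml} {φ ψ : Fml} : Derives T Γ (φ ∧ᶠ ψ) → Derives T Γ φ
  | andE₂ {Γ : List Fml} {φ ψ : Fml} : Derives T Γ (φ ∧ᶠ ψ) → Derives T Γ ψ
  | orI₁ {Γ : List Fml} {φ ψ : Fml} : Derives T Γ φ → Derives T Γ (φ ∨ᶠ ψ)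
  | orI₂ {Γ : List Fml} {φ ψ : Fml} : Derives T Γ ψ → Derives T Γ (φ ∨ᶠ ψ)
  | orE {Γ : List Fml} {φ ψ χ : Fml} : Derives T Γ (φ ∨ᶠ ψ) → Derives T (φ :: Γ) χ →
      Derives T (ψ :: Γ) χ → Derives T Γ χ
  | impI {Γ : List Fml} {φ ψ : Fml} : Derives T (φ :: Γ) ψ → Derives T Γ (φ →ᶠ ψ)
  | impE {Γ : List Fml} {φ ψ : Fml} : Derives T Γ (φ →ᶠ ψ) → Derives T Γ φ → Derives T Γ ψ
  | allI {Γ : List Fml} {φ : Fml} : Derives T (Γ.map Fml.shift) φ → Derives T Γ (.all φ)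
  | allE {Γ : List Fml} {φ : Fml} (t : ℕ) : Derives T Γ (.all φ) → Derives T Γ (φ.inst t)
  | exI {Γ : List Fml} {φ : Fml} (t : ℕ) : Derives T Γ (φ.inst t) → Derives T Γ (.ex φ)
  | exE {Γ : List Fml} {φ ψ : Fml} : Derives T Γ (.ex φ) → Derives T (φ :: Γ.map Fml.shift) ψ.shift →
      Derives T Γ ψ
  | eqI {Γ : List Fml} (t : ℕ) : Derives T Γ (t ≡ᶠ t)
  | eqE {Γ : List Fml} {φ : Fml} (s t : ℕ) : Derives T Γ (s ≡ᶠ t) → Derives T Γ (φ.inst s) →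
      Derives T Γ (φ.inst t)

/-- `φ` is a theorem of the theory `T` over intuitionistic logic. -/
def Provable (T : Fml → Prop) (φ : Fml) : Prop := Derives T [] φ

/-! ### Basic set-theoretic formulas -/

/-- `∀ z ∈ y, φ`, where `z` is the variable `0` of `φ`. -/
def ball (y : ℕ) (φ : Fml) : Fml := .all (0 ∈ᶠ (y + 1) →ᶠ φ)

/-- `∃ z ∈ y, φ`, where `z` is the variable `0` of `φ`. -/
def bex (y : ℕ) (φ : Fml) : Fml := .ex (0 ∈ᶠ (y + 1) ∧ᶠ φ)

/-- The bounded (`Δ₀`) formulas. -/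
inductive IsBounded : Fml → Prop
  | bot : IsBounded .bot
  | eq (x y) : IsBounded (x ≡ᶠ y)
  | mem (x y) : IsBounded (x ∈ᶠ y)
  | and {φ ψ} : IsBounded φ → IsBounded ψ → IsBounded (φ ∧ᶠ ψ)
  | or {φ ψ} : IsBounded φ → IsBounded ψ → IsBounded (φ ∨ᶠ ψ)
  | imp {φ ψ} : IsBounded φ → IsBounded ψ → IsBounded (φ →ᶠ ψ)
  | ball (y) {φ} : IsBounded φ → IsBounded (ball y φ)
  | bex (y) {φ} : IsBounded φ → IsBounded (bex y φ)

/-- `x ⊆ y`. -/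
def sub (x y : ℕ) : Fml := ball x (0 ∈ᶠ (y + 1))

/-- `x = ∅`. -/
def isEmpty (x : ℕ) : Fml := ball x .bot

/-- `y = x⁺ = x ∪ {x}`. -/
def isSucc (y x : ℕ) : Fml :=
  sub x y ∧ᶠ x ∈ᶠ y ∧ᶠ ball y (0 ∈ᶠ (x + 1) ∨ᶠ 0 ≡ᶠ (x + 1))

/-- `p = {a, b}`. -/
def isPair (p a b : ℕ) : Fml :=
  a ∈ᶠ p ∧ᶠ b ∈ᶠ p ∧ᶠ ball p (0 ≡ᶠ (a + 1) ∨ᶠ 0 ≡ᶠ (b + 1))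

/-- `p = ⟨a, b⟩ = {{a}, {a, b}}`. -/
def isOPair (p a b : ℕ) : Fml :=
  bex p (isPair 0 (a + 1) (a + 1)) ∧ᶠ bex p (isPair 0 (a + 1) (b + 1)) ∧ᶠ
    ball p (isPair 0 (a + 1) (a + 1) ∨ᶠ isPair 0 (a + 1) (b + 1))

/-- `⟨a, b⟩ ∈ r`. -/
def pairMem (a b r : ℕ) : Fml := bex r (isOPair 0 (a + 1) (b + 1))

/-- `x` is transitive. -/
def isTrans (x : ℕ) : Fml := ball x (sub 0 (x + 1))

/-- `x ∈ Ord`: a transitive set of transitive sets. -/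
def isOrd (x : ℕ) : Fml := isTrans x ∧ᶠ ball x (isTrans 0)

/-- `w` is inductive: `∅ ∈ w` and `w` is closed under `x ↦ x⁺`. -/
def isInd (w : ℕ) : Fml := bex w (isEmpty 0) ∧ᶠ ball w (bex (w + 1) (isSucc 0 1))

/-- `w = ω`, the least inductive set. -/
def isOmega (w : ℕ) : Fml := isInd w ∧ᶠ .all (isInd 0 →ᶠ sub (w + 1) 0)

/-- `n ∈ ω`. -/
def isNat (n : ℕ) : Fml := .ex (isOmega 0 ∧ᶠ (n + 1) ∈ᶠ 0)

/-- `f` is a function with domain `d`. -/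
def isFun (f d : ℕ) : Fml :=
  ball f (bex (d + 1) (.ex (isOPair 2 1 0))) ∧ᶠ
    ball d (.ex (pairMem 1 0 (f + 2) ∧ᶠ .all (pairMem 2 0 (f + 3) →ᶠ 0 ≡ᶠ 1)))

/-- `s` is a function from `n` to `X`; for `n ∈ ω`, this says `s ∈ Xⁿ`. -/
def isSeq (s n X : ℕ) : Fml :=
  ball s (bex (n + 1) (bex (X + 2) (isOPair 2 1 0))) ∧ᶠ
    ball n (bex (X + 1) (pairMem 1 0 (s + 2) ∧ᶠ
      ball (X + 2) (pairMem 2 0 (s + 3) →ᶠ 0 ≡ᶠ 1)))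

/-- `t = s ∪ {⟨n, a⟩}`; for `s ∈ Xⁿ`, this is the sequence `s` followed by `a`. -/
def isSnoc (t s n a : ℕ) : Fml :=
  sub s t ∧ᶠ pairMem n a t ∧ᶠ ball t (0 ∈ᶠ (s + 1) ∨ᶠ isOPair 0 (n + 1) (a + 1))

/-! ### The axioms of CZF

In a scheme, the variables of `φ` that are not displayed are parameters. -/

/-- The axioms of constructive Zermelo–Fraenkel set theory. -/
inductive CZF : Fml → Prop
  /-- `∀ a b, (∀ x, x ∈ a ↔ x ∈ b) → a = b`. -/
  | extensionality : CZF (.all (.all (.all (0 ∈ᶠ 2 ↔ᶠ 0 ∈ᶠ 1) →ᶠ 1 ≡ᶠ 0)))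
  /-- `∃ a, a = ∅`. -/
  | emptySet : CZF (.ex (isEmpty 0))
  /-- `∀ a b, ∃ c, ∀ x, x ∈ c ↔ x = a ∨ x = b`. -/
  | pairing : CZF (.all (.all (.ex (.all (0 ∈ᶠ 1 ↔ᶠ 0 ≡ᶠ 3 ∨ᶠ 0 ≡ᶠ 2)))))
  /-- `∀ a, ∃ b, ∀ x, x ∈ b ↔ ∃ y ∈ a, x ∈ y`. -/
  | union : CZF (.all (.ex (.all (0 ∈ᶠ 1 ↔ᶠ bex 2 (1 ∈ᶠ 0)))))
  /-- Strong infinity: there is a least inductive set. -/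
  | infinity : CZF (.ex (isOmega 0))
  /-- Set induction, for every `φ(x)`, with `x` the variable `0` of `φ`:
  `(∀ a, (∀ x ∈ a, φ(x)) → φ(a)) → ∀ a, φ(a)`. -/
  | setInduction (φ : Fml) :
      CZF (.all (ball 0 (φ.rename (cons 0 (· + 2))) →ᶠ φ) →ᶠ .all φ)
  /-- Bounded separation, for every bounded `φ(x)`, with `x` the variable `0` of `φ`:
  `∀ a, ∃ b, ∀ x, x ∈ b ↔ x ∈ a ∧ φ(x)`. -/
  | boundedSeparation (φ : Fml) (hφ : IsBounded φ) :
      CZF (.all (.ex (.all (0 ∈ᶠ 1 ↔ᶠ 0 ∈ᶠ 2 ∧ᶠ φ.rename (cons 0 (· + 3))))))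
  /-- Strong collection, for every `φ(y, x)`, with `y, x` the variables `0, 1` of `φ`:
  `∀ a, (∀ x ∈ a, ∃ y, φ(y, x)) →
    ∃ b, (∀ x ∈ a, ∃ y ∈ b, φ(y, x)) ∧ (∀ y ∈ b, ∃ x ∈ a, φ(y, x))`. -/
  | strongCollection (φ : Fml) :
      CZF (.all (ball 0 (.ex (φ.rename (cons 0 (cons 1 (· + 3))))) →ᶠ
        .ex (ball 1 (bex 1 (φ.rename (cons 0 (cons 1 (· + 4))))) ∧ᶠ
          ball 0 (bex 2 (φ.rename (cons 1 (cons 0 (· + 4))))))))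
  /-- Subset collection, for every `φ(y, x, u)`, with `y, x, u` the variables `0, 1, 2` of `φ`:
  `∀ a b, ∃ c, ∀ u, (∀ x ∈ a, ∃ y ∈ b, φ(y, x, u)) →
    ∃ d ∈ c, (∀ x ∈ a, ∃ y ∈ d, φ(y, x, u)) ∧ (∀ y ∈ d, ∃ x ∈ a, φ(y, x, u))`. -/
  | subsetCollection (φ : Fml) :
      CZF (.all (.all (.ex (.all
        (ball 3 (bex 3 (φ.rename (cons 0 (cons 1 (cons 2 (· + 6)))))) →ᶠ
          bex 1 (ball 4 (bex 1 (φ.rename (cons 0 (cons 1 (cons 3 (· + 7)))))) ∧ᶠ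
            ball 0 (bex 5 (φ.rename (cons 1 (cons 0 (cons 3 (· + 7))))))))))))

/-! ### Definable subsets and the constructible hierarchy

The relations on `X` defined by first-order formulas over `⟨X; ∈⟩` are generated by Tarski's
clauses.  A formula whose free variables are among `v₀, …, vₙ₋₁` defines a subset of `Xⁿ`, the
set of functions from `n` to `X`; a quantifier in it binds `vₙ` in a formula with `n + 1`
variables. -/

/-- `⟨n, {s ∈ Xⁿ | ψ}⟩ ∈ D`, where `ψ` lies below two further variables: `0` is `s`, and `1`
is the set `{s ∈ Xⁿ | ψ}` itself, which is not used in `ψ`. -/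
def hasRel (n X D : ℕ) (ψ : Fml) : Fml :=
  .all (.all (0 ∈ᶠ 1 ↔ᶠ isSeq 0 (n + 2) (X + 2) ∧ᶠ ψ) →ᶠ pairMem (n + 1) 0 (D + 1))

/-- The clauses for `⊥`, `vᵢ = vⱼ`, `vᵢ ∈ vⱼ` (with `i, j ∈ n`): the set `D` contains `⟨n, ∅⟩`,
`⟨n, {s ∈ Xⁿ | s(i) = s(j)}⟩` and `⟨n, {s ∈ Xⁿ | s(i) ∈ s(j)}⟩`. -/
def closedAtomic (n X D : ℕ) : Fml :=
  hasRel n X D .bot ∧ᶠ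
    ball n (ball (n + 1) (
      -- variables: `j = 0`, `i = 1`
      hasRel (n + 2) (X + 2) (D + 2)
        (bex (X + 4) (pairMem 4 0 1 ∧ᶠ pairMem 3 0 1)) ∧ᶠ
      hasRel (n + 2) (X + 2) (D + 2)
        (bex (X + 4) (bex (X + 5) (pairMem 5 1 2 ∧ᶠ pairMem 4 0 2 ∧ᶠ 1 ∈ᶠ 0)))))

/-- The clauses for `∧`, `∨`, `→`: if `⟨n, R⟩, ⟨n, S⟩ ∈ D`, then `D` contains
`⟨n, {s ∈ Xⁿ | s ∈ R ∧ s ∈ S}⟩`, and likewise for the other two connectives. -/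
def closedConnectives (n X D : ℕ) : Fml :=
  .all (.all (
    -- variables: `S = 0`, `R = 1`
    pairMem (n + 2) 1 (D + 2) ∧ᶠ pairMem (n + 2) 0 (D + 2) →ᶠ
      hasRel (n + 2) (X + 2) (D + 2) (0 ∈ᶠ 3 ∧ᶠ 0 ∈ᶠ 2) ∧ᶠ
      hasRel (n + 2) (X + 2) (D + 2) (0 ∈ᶠ 3 ∨ᶠ 0 ∈ᶠ 2) ∧ᶠ
      hasRel (n + 2) (X + 2) (D + 2) (0 ∈ᶠ 3 →ᶠ 0 ∈ᶠ 2)))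

/-- The clauses for `∀` and `∃`: if `⟨n + 1, R⟩ ∈ D`, then `D` contains
`⟨n, {s ∈ Xⁿ | ∀ a ∈ X, s ∪ {⟨n, a⟩} ∈ R}⟩` and `⟨n, {s ∈ Xⁿ | ∃ a ∈ X, s ∪ {⟨n, a⟩} ∈ R}⟩`. -/
def closedQuantifiers (n X D : ℕ) : Fml :=
  .all (.all (
    -- variables: `R = 0`, `n⁺ = 1`
    isSucc 1 (n + 2) ∧ᶠ pairMem 1 0 (D + 2) →ᶠ
      hasRel (n + 2) (X + 2) (D + 2) (ball (X + 4) (bex 3 (isSnoc 0 2 (n + 6) 1))) ∧ᶠ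
      hasRel (n + 2) (X + 2) (D + 2) (bex (X + 4) (bex 3 (isSnoc 0 2 (n + 6) 1)))))

/-- `D` is closed under all of Tarski's clauses over `⟨X; ∈⟩`. -/
def isClosed (X D : ℕ) : Fml :=
  .all (isNat 0 →ᶠ closedAtomic 0 (X + 1) (D + 1) ∧ᶠ closedConnectives 0 (X + 1) (D + 1) ∧ᶠ
    closedQuantifiers 0 (X + 1) (D + 1))

/-- `D` is the set of all `⟨n, R⟩` such that `n ∈ ω` and `R ⊆ Xⁿ` is definable without
parameters by a first-order formula over `⟨X; ∈⟩`: the least set closed under the clauses. -/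
def isDefRels (X D : ℕ) : Fml :=
  isClosed X D ∧ᶠ .all (isClosed (X + 1) 0 →ᶠ sub (D + 1) 0)

/-- `Y` is a subset of `X` that is definable over `⟨X; ∈⟩` by a formula with parameters in `X`:
`Y = {a ∈ X | p ∪ {⟨n, a⟩} ∈ R}` for some `n ∈ ω`, `p ∈ Xⁿ` and definable `R ⊆ Xⁿ⁺¹`. -/
def inDef (X Y : ℕ) : Fml :=
  -- variables: `p = 0`, `R = 1`, `n⁺ = 2`, `n = 3`, `D = 4`
  .ex (.ex (.ex (.ex (.ex (
    isDefRels (X + 5) 4 ∧ᶠ isNat 3 ∧ᶠ isSucc 2 3 ∧ᶠ pairMem 2 1 4 ∧ᶠ isSeq 0 3 (X + 5) ∧ᶠ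
      .all (0 ∈ᶠ (Y + 6) ↔ᶠ 0 ∈ᶠ (X + 6) ∧ᶠ bex 2 (isSnoc 0 2 5 1)))))))

/-- `y = L_α`: there is a function `f`, whose domain is an ordinal `d` with `α ∈ d`, such that
`f(β) = ⋃_{γ ∈ β} Def(f(γ))` for all `β ∈ d`, and `f(α) = y`. -/
def isLevel (α y : ℕ) : Fml :=
  -- variables: `f = 0`, `d = 1`; then `f(β) = 0`, `β = 1`, `f = 2`
  .ex (.ex (isOrd 1 ∧ᶠ isFun 0 1 ∧ᶠ (α + 2) ∈ᶠ 1 ∧ᶠ pairMem (α + 2) (y + 2) 0 ∧ᶠ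
    .all (.all (pairMem 1 0 2 →ᶠ
      .all (0 ∈ᶠ 1 ↔ᶠ bex 2 (.ex (pairMem 1 0 5 ∧ᶠ inDef 0 2)))))))

/-- `x ∈ L = ⋃_{α ∈ Ord} L_α`. -/
def inL (x : ℕ) : Fml := .ex (.ex (isOrd 1 ∧ᶠ isLevel 1 0 ∧ᶠ (x + 2) ∈ᶠ 0))

end ConstructiveSetTheory

open ConstructiveSetTheory

namespace ConstructiveSetTheory

set_option linter.unusedVariables false

/-! ### Renaming of variables -/

/-! Intuitionistically an ordinal `α ⊆ ω` need be neither a natural number nor `ω`, since membership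
in `α` may be undecided. The proof never decides anything about `α`. It works at the finite levels
`L_m` with `m ∈ ω`, where everything is decidable, and passes to `α` through `L_α = ⋃_{m ∈ α}
Def(L_m)`.

Each `L_m` is a finite set with decidable equality whose elements are finite subsets of it
(`isDiscrete`). Over such a structure every first-order formula is decidable: atomic formulas are,
connectives preserve decidability, and quantifiers range over a finite set (`Derives.dec_defRels`).
So definable subsets are finite (`Derives.inDef_fin`). Conversely, a finite subset is definable with
its enumeration as parameters (`inDef_of_fin`). Hence `L_{m+1}` is the set of finite subsets of
`L_m`, which is again discrete (`Derives.discrete_succ`).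

Being an ordinal is a bounded property, so the ordinals of a transitive set form a definable subset
of it (`inDef_ord`). An ordinal in `Def(L_m)` is a decidable transitive subset of `m = L_m ∩ Ord`,
hence an element of `m` or `m` itself (`Derives.mem_succ_of_trans`). This gives `m = L_m ∩ Ord` for
all `m ∈ ω` by induction (`Derives.level_nat`). The same two facts give `α = L_α ∩ Ord`
(`Derives.mem_level_iff`): if `x ∈ α`, then `x = L_x ∩ Ord` lies in `Def(L_x)`; an ordinal in
`Def(L_m)` with `m ∈ α` is in `m` or equal to `m`, hence in `α`. Finally `α = L_α ∩ Ord` is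
definable over `L_α`, so `α ∈ L_{α+1}`.

All of this has to be derived inside the natural deduction calculus. The rules are therefore recast
so that object-level reasoning reads like Lean reasoning: bound variables become Lean variables and
assumptions become Lean hypotheses. The other half of the work is to show in CZF that the objects
exist: recursion on ordinals (`exists_rec`), the least set of relations closed under Tarski's
clauses (`exists_defRels`), and `Def(X)` as a set (`isSet_inDef`). -/

@[simp] theorem cons_zero (a : ℕ) (f : ℕ → ℕ) : cons a f 0 = a := rfl

@[simp] theorem cons_succ (a : ℕ) (f : ℕ → ℕ) (n : ℕ) : cons a f (n + 1) = f n := rfl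

/-- The extension of a renaming to the scope of a quantifier. -/
abbrev lift (f : ℕ → ℕ) : ℕ → ℕ := cons 0 fun n => f n + 1

theorem Fml.rename_ext (φ : Fml) {f g : ℕ → ℕ} (h : ∀ n, f n = g n) :
    φ.rename f = φ.rename g := by
  rw [funext h]

theorem Fml.rename_rename (φ : Fml) (f g : ℕ → ℕ) :
    (φ.rename f).rename g = φ.rename fun n => g (f n) := by
  have key : ∀ f g : ℕ → ℕ, (fun n => lift g (lift f n)) = lift fun n => g (f n) := by
    intro f g
    funext n
    cases n <;> rfl
  induction φ generalizing f g with
  | bot => rfl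
  | eq x y => rfl
  | mem x y => rfl
  | and φ ψ h₁ h₂ => simp only [Fml.rename, h₁, h₂]
  | or φ ψ h₁ h₂ => simp only [Fml.rename, h₁, h₂]
  | imp φ ψ h₁ h₂ => simp only [Fml.rename, h₁, h₂]
  | all φ h => simp only [Fml.rename, h]; exact congrArg (fun k => Fml.all (φ.rename k)) (key f g)
  | ex φ h => simp only [Fml.rename, h]; exact congrArg (fun k => Fml.ex (φ.rename k)) (key f g)

/-- The form in which commuting squares of substitutions are used: only the maps on variables have
to be compared. -/
theorem Fml.rename_comm (φ : Fml) {f g : ℕ → ℕ} (f' g' : ℕ → ℕ) (h : ∀ n, g (f n) = g' (f' n)) :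
    (φ.rename f).rename g = (φ.rename f').rename g' := by
  rw [rename_rename, rename_rename]
  exact rename_ext _ h

/-- All free variables of the formula are less than `varBound`. -/
def Fml.varBound : Fml → ℕ
  | .bot => 0
  | .eq x y => max x y + 1
  | .mem x y => max x y + 1
  | .and φ ψ => max φ.varBound ψ.varBound
  | .or φ ψ => max φ.varBound ψ.varBound
  | .imp φ ψ => max φ.varBound ψ.varBound
  -- The bound variable is not discounted, so this is only an upper bound; that suffices for
  -- choosing fresh variables.
  | .all φ => φ.varBound
  | .ex φ => φ.varBound

theorem Fml.rename_congr (φ : Fml) {f g : ℕ → ℕ} (h : ∀ n < φ.varBound, f n = g n) :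
    φ.rename f = φ.rename g := by
  have key : ∀ (φ : Fml) (f g : ℕ → ℕ), (∀ n < φ.varBound, f n = g n) →
      ∀ n < φ.varBound, lift f n = lift g n := by
    intro φ f g h n hn
    cases n with
    | zero => rfl
    | succ n => simp [h n (by omega)]
  induction φ generalizing f g with
  | bot => rfl
  | eq x y => simp only [varBound] at h; simp only [rename, h x (by omega), h y (by omega)]
  | mem x y => simp only [varBound] at h; simp only [rename, h x (by omega), h y (by omega)]
  | and φ ψ h₁ h₂ =>
    simp only [varBound, lt_max_iff] at h
    simp only [rename, h₁ fun n hn => h n (.inl hn), h₂ fun n hn => h n (.inr hn)]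
  | or φ ψ h₁ h₂ =>
    simp only [varBound, lt_max_iff] at h
    simp only [rename, h₁ fun n hn => h n (.inl hn), h₂ fun n hn => h n (.inr hn)]
  | imp φ ψ h₁ h₂ =>
    simp only [varBound, lt_max_iff] at h
    simp only [rename, h₁ fun n hn => h n (.inl hn), h₂ fun n hn => h n (.inr hn)]
  | all φ ih => exact congrArg Fml.all (ih (key φ f g h))
  | ex φ ih => exact congrArg Fml.ex (ih (key φ f g h))

@[simp] theorem Fml.rename_id (φ : Fml) : φ.rename (fun n => n) = φ := by
  have key : lift (fun n => n) = fun n => n := by funext n; cases n <;> rfl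
  induction φ with
  | bot => rfl
  | eq x y => rfl
  | mem x y => rfl
  | and φ ψ h₁ h₂ => simp only [rename, h₁, h₂]
  | or φ ψ h₁ h₂ => simp only [rename, h₁, h₂]
  | imp φ ψ h₁ h₂ => simp only [rename, h₁, h₂]
  | all φ ih => exact congrArg Fml.all ((congrArg φ.rename key).trans ih)
  | ex φ ih => exact congrArg Fml.ex ((congrArg φ.rename key).trans ih)

theorem Fml.rename_shift (φ : Fml) (f : ℕ → ℕ) :
    φ.shift.rename (lift f) = (φ.rename f).shift := by
  simp only [shift, rename_rename]; rfl

theorem Fml.rename_inst (φ : Fml) (t : ℕ) (f : ℕ → ℕ) :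
    (φ.inst t).rename f = (φ.rename (lift f)).inst (f t) := by
  simp only [inst, rename_rename]
  exact rename_ext _ (by rintro (_ | n) <;> rfl)

theorem IsBounded.rename {φ : Fml} (h : IsBounded φ) (f : ℕ → ℕ) : IsBounded (φ.rename f) := by
  induction h generalizing f with
  | bot => exact .bot
  | eq x y => exact .eq _ _
  | mem x y => exact .mem _ _
  | and _ _ h₁ h₂ => exact .and (h₁ f) (h₂ f)
  | or _ _ h₁ h₂ => exact .or (h₁ f) (h₂ f)
  | imp _ _ h₁ h₂ => exact .imp (h₁ f) (h₂ f)
  | ball y _ h => exact .ball (f y) (h (lift f))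
  | bex y _ h => exact .bex (f y) (h (lift f))

/-- A renamed instance of a scheme is the instance for the renamed formula. This makes derivability
in CZF stable under substitution, on which the treatment of fresh variables rests. -/
theorem CZF.rename {φ : Fml} (h : CZF φ) (f : ℕ → ℕ) : CZF (φ.rename f) := by
  cases h with
  | extensionality => exact .extensionality
  | emptySet => exact .emptySet
  | pairing => exact .pairing
  | union => exact .union
  | infinity => exact .infinity
  | setInduction φ =>
    have h := CZF.setInduction (φ.rename (lift f))
    rw [Fml.rename_comm φ (g := cons 0 (· + 2)) (cons 0 (· + 2)) (lift (lift f)) (by rintro (_ | n) <;> rfl)] at h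
    exact h
  | boundedSeparation φ hφ =>
    have h := CZF.boundedSeparation (φ.rename (lift f)) (hφ.rename _)
    rw [Fml.rename_comm φ (g := cons 0 (· + 3)) (cons 0 (· + 3)) (lift (lift (lift f)))
      (by rintro (_ | n) <;> rfl)] at h
    exact h
  | strongCollection φ =>
    have h := CZF.strongCollection (φ.rename (lift (lift f)))
    rw [Fml.rename_comm φ (g := cons 0 (cons 1 (· + 3))) (cons 0 (cons 1 (· + 3))) (lift (lift (lift f)))
       (by rintro (_ | _ | n) <;> rfl),
      Fml.rename_comm φ (g := cons 0 (cons 1 (· + 4))) (cons 0 (cons 1 (· + 4))) (lift (lift (lift (lift f))))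
       (by rintro (_ | _ | n) <;> rfl),
      Fml.rename_comm φ (g := cons 1 (cons 0 (· + 4))) (cons 1 (cons 0 (· + 4))) (lift (lift (lift (lift f))))
       (by rintro (_ | _ | n) <;> rfl)] at h
    exact h
  | subsetCollection φ =>
    have h := CZF.subsetCollection (φ.rename (lift (lift (lift f))))
    rw [Fml.rename_comm φ (g := cons 0 (cons 1 (cons 2 (· + 6)))) (cons 0 (cons 1 (cons 2 (· + 6))))
        (lift (lift (lift (lift (lift (lift f)))))) (by rintro (_ | _ | _ | n) <;> rfl),
      Fml.rename_comm φ (g := cons 0 (cons 1 (cons 3 (· + 7)))) (cons 0 (cons 1 (cons 3 (· + 7))))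
        (lift (lift (lift (lift (lift (lift (lift f))))))) (by rintro (_ | _ | _ | n) <;> rfl),
      Fml.rename_comm φ (g := cons 1 (cons 0 (cons 3 (· + 7)))) (cons 1 (cons 0 (cons 3 (· + 7))))
        (lift (lift (lift (lift (lift (lift (lift f))))))) (by rintro (_ | _ | _ | n) <;> rfl)] at h
    exact h

/-! ### Structural properties of derivability -/

theorem Derives.weaken {T : Fml → Prop} {Γ Δ : List Fml} {φ : Fml} (h : Derives T Γ φ)
    (hs : Γ ⊆ Δ) : Derives T Δ φ := by
  induction h generalizing Δ with
  | ax h => exact .ax h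
  | hyp h => exact .hyp (hs h)
  | botE _ ih => exact .botE (ih hs)
  | andI _ _ h₁ h₂ => exact .andI (h₁ hs) (h₂ hs)
  | andE₁ _ ih => exact .andE₁ (ih hs)
  | andE₂ _ ih => exact .andE₂ (ih hs)
  | orI₁ _ ih => exact .orI₁ (ih hs)
  | orI₂ _ ih => exact .orI₂ (ih hs)
  | orE _ _ _ h₁ h₂ h₃ =>
    exact .orE (h₁ hs) (h₂ (List.cons_subset_cons _ hs)) (h₃ (List.cons_subset_cons _ hs))
  | impI _ ih => exact .impI (ih (List.cons_subset_cons _ hs))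
  | impE _ _ h₁ h₂ => exact .impE (h₁ hs) (h₂ hs)
  | allI _ ih => exact .allI (ih (List.map_subset _ hs))
  | allE t _ ih => exact .allE t (ih hs)
  | exI t _ ih => exact .exI t (ih hs)
  | exE _ _ h₁ h₂ => exact .exE (h₁ hs) (h₂ (List.cons_subset_cons _ (List.map_subset _ hs)))
  | eqI t => exact .eqI t
  | eqE s t _ _ h₁ h₂ => exact .eqE s t (h₁ hs) (h₂ hs)

theorem Derives.rename {T : Fml → Prop} (hT : ∀ φ f, T φ → T (φ.rename f)) {Γ : List Fml}
    {φ : Fml} (h : Derives T Γ φ) (f : ℕ → ℕ) :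
    Derives T (Γ.map fun ψ => ψ.rename f) (φ.rename f) := by
  have key : ∀ (Γ : List Fml) (f : ℕ → ℕ), (Γ.map Fml.shift).map (fun ψ => ψ.rename (lift f)) =
      (Γ.map fun ψ => ψ.rename f).map Fml.shift := by
    intro Γ f
    simp only [List.map_map]
    exact List.map_congr_left fun ψ _ => ψ.rename_shift f
  induction h generalizing f with
  | ax h => exact .ax (hT _ _ h)
  | hyp h => exact .hyp (List.mem_map_of_mem h)
  | botE _ ih => exact .botE (ih f)
  | andI _ _ h₁ h₂ => exact .andI (h₁ f) (h₂ f)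
  | andE₁ _ ih => exact .andE₁ (ih f)
  | andE₂ _ ih => exact .andE₂ (ih f)
  | orI₁ _ ih => exact .orI₁ (ih f)
  | orI₂ _ ih => exact .orI₂ (ih f)
  | orE _ _ _ h₁ h₂ h₃ => exact .orE (h₁ f) (h₂ f) (h₃ f)
  | impI _ ih => exact .impI (ih f)
  | impE _ _ h₁ h₂ => exact .impE (h₁ f) (h₂ f)
  | allI _ ih => exact .allI (key _ f ▸ ih (lift f))
  | allE t _ ih => rw [Fml.rename_inst]; exact .allE (f t) (ih f)
  | exI t _ ih => exact .exI (f t) (Fml.rename_inst _ _ _ ▸ ih f)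
  | exE _ _ h₁ h₂ =>
    refine .exE (h₁ f) ?_
    have := h₂ (lift f)
    rwa [List.map_cons, key, Fml.rename_shift] at this
  | eqI t => exact .eqI (f t)
  | eqE s t _ _ h₁ h₂ =>
    rw [Fml.rename_inst]
    exact .eqE (f s) (f t) (h₁ f) (Fml.rename_inst _ _ _ ▸ h₂ f)

/-- The renaming that turns the variable `N` into `0` and shifts all others. -/
def bindVar (N : ℕ) (n : ℕ) : ℕ := if n = N then 0 else n + 1

theorem Fml.rename_bindVar {φ : Fml} {N : ℕ} (h : φ.varBound ≤ N) :
    φ.rename (bindVar N) = φ.shift :=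
  rename_congr _ fun n hn => if_neg (by omega)

theorem Fml.inst_rename_bindVar {φ : Fml} {N : ℕ} (h : φ.varBound ≤ N) :
    (φ.inst N).rename (bindVar N) = φ := by
  rw [inst, rename_rename]
  refine (rename_congr _ fun n hn => ?_).trans φ.rename_id
  cases n with
  | zero => exact if_pos rfl
  | succ n => exact if_neg (show n ≠ N by omega)

theorem exists_fresh (Γ : List Fml) : ∃ N, ∀ φ ∈ Γ, φ.varBound ≤ N := by
  induction Γ with
  | nil => exact ⟨0, by simp⟩
  | cons φ Γ ih =>
    obtain ⟨N, hN⟩ := ih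
    exact ⟨max φ.varBound N, by
      intro ψ hψ
      rcases List.mem_cons.1 hψ with rfl | hψ
      · exact le_max_left _ _
      · exact (hN _ hψ).trans (le_max_right _ _)⟩

theorem map_rename_bindVar {Γ : List Fml} {N : ℕ} (h : ∀ φ ∈ Γ, φ.varBound ≤ N) :
    (Γ.map fun ψ => ψ.rename (bindVar N)) = Γ.map Fml.shift :=
  List.map_congr_left fun ψ hψ => Fml.rename_bindVar (h ψ hψ)

/-- Derivability from the axioms of CZF. -/
notation:19 Γ:51 " ⊢ " φ:20 => Derives CZF Γ φ

/-- Lean's quantifier over `t` takes the place of the eigenvariable condition: the premise is used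
only at a variable `N` free in neither `φ` nor `Γ`, and `bindVar N` turns that derivation into the
premise of `allI`. -/
theorem Derives.all_intro {Γ : List Fml} {φ : Fml} (h : ∀ t, Γ ⊢ φ.inst t) : Γ ⊢ .all φ := by
  obtain ⟨N, hN⟩ := exists_fresh (φ :: Γ)
  have := (h N).rename (fun _ f h => h.rename f) (bindVar N)
  rw [Fml.inst_rename_bindVar (hN φ (by simp)),
    map_rename_bindVar fun ψ hψ => hN ψ (by simp [hψ])] at this
  exact .allI this

/-- As in `Derives.all_intro`, the witness is a variable not free in `φ`, `χ` or `Γ`. -/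
theorem Derives.ex_elim {Γ : List Fml} {φ χ : Fml} (h : Γ ⊢ .ex φ)
    (k : ∀ t, φ.inst t :: Γ ⊢ χ) : Γ ⊢ χ := by
  obtain ⟨N, hN⟩ := exists_fresh (φ :: χ :: Γ)
  have := (k N).rename (fun _ f h => h.rename f) (bindVar N)
  rw [List.map_cons, Fml.inst_rename_bindVar (hN φ (by simp)),
    Fml.rename_bindVar (hN χ (by simp)),
    map_rename_bindVar fun ψ hψ => hN ψ (by simp [hψ])] at this
  exact .exE h this

/-! ### Reasoning under growing assumptions

`Step Γ Δ` marks `Δ` as the context that was introduced right after `Γ`, so that instance search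
finds the chain of contexts leading to the current one; a derivation from an earlier context is
brought to the current one by `Derives.up`. -/

/-- `Δ` extends `Γ` and was introduced right after it. -/
class Step (Γ : outParam (List Fml)) (Δ : List Fml) : Prop where
  subset : Γ ⊆ Δ

/-- `Δ` extends `Γ`. -/
class Ext (Γ Δ : List Fml) : Prop where
  subset : Γ ⊆ Δ

instance Ext.refl (Γ : List Fml) : Ext Γ Γ := ⟨fun _ => id⟩

instance Ext.step (Γ Δ Θ : List Fml) [h : Step Δ Θ] [h' : Ext Γ Δ] : Ext Γ Θ :=
  ⟨fun _ hx => h.subset (h'.subset hx)⟩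


theorem Derives.up [h : Ext Γ Δ] (d : Γ ⊢ φ) : Δ ⊢ φ := d.weaken h.subset

theorem step_cons (φ : Fml) (Γ : List Fml) : Step Γ (φ :: Γ) := ⟨List.subset_cons_self _ _⟩

theorem ext_of_step (h : Step Γ Δ) : Ext Γ Δ := ⟨h.subset⟩

variable {Γ Δ : List Fml} {φ ψ χ θ ρ : Fml}

/-! ### Derived rules -/

/-- The assumption becomes a Lean hypothesis. The premise is applied only to `φ :: Γ`; leaving `Δ`
abstract hides the list from later arguments and lets instance search do the weakening. -/
theorem imp_intro (h : ∀ {Δ} [Step Γ Δ], (Δ ⊢ φ) → (Δ ⊢ ψ)) : Γ ⊢ φ →ᶠ ψ :=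
  have := step_cons φ Γ
  .impI (h (.hyp (by simp)))

theorem Derives.mp (h : Γ ⊢ φ →ᶠ ψ) (h' : Γ ⊢ φ) : Γ ⊢ ψ := .impE h h'

theorem Derives.left (h : Γ ⊢ φ ∧ᶠ ψ) : Γ ⊢ φ := .andE₁ h

theorem Derives.right (h : Γ ⊢ φ ∧ᶠ ψ) : Γ ⊢ ψ := .andE₂ h

theorem iff_intro (h : ∀ {Δ} [Step Γ Δ], (Δ ⊢ φ) → (Δ ⊢ ψ))
    (h' : ∀ {Δ} [Step Γ Δ], (Δ ⊢ ψ) → (Δ ⊢ φ)) : Γ ⊢ φ ↔ᶠ ψ :=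
  .andI (imp_intro h) (imp_intro h')

theorem Derives.iff_mp (h : Γ ⊢ φ ↔ᶠ ψ) (h' : Γ ⊢ φ) : Γ ⊢ ψ := Derives.mp (.andE₁ h) h'

theorem Derives.iff_mpr (h : Γ ⊢ φ ↔ᶠ ψ) (h' : Γ ⊢ ψ) : Γ ⊢ φ := Derives.mp (.andE₂ h) h'

theorem Derives.absurd (h : Γ ⊢ .bot) : Γ ⊢ φ := .botE h

theorem Derives.cases (h : Γ ⊢ φ ∨ᶠ ψ) (h₁ : ∀ {Θ} [Step Γ Θ], (Θ ⊢ φ) → (Θ ⊢ χ))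
    (h₂ : ∀ {Θ} [Step Γ Θ], (Θ ⊢ ψ) → (Θ ⊢ χ)) : Γ ⊢ χ :=
  have := step_cons φ Γ
  have := step_cons ψ Γ
  .orE h (h₁ (.hyp (by simp))) (h₂ (.hyp (by simp)))

theorem Derives.obtain (h : Γ ⊢ .ex φ)
    (k : ∀ {Θ} [Step Γ Θ] t, (Θ ⊢ φ.inst t) → (Θ ⊢ χ)) : Γ ⊢ χ :=
  .ex_elim h fun t => have := step_cons (φ.inst t) Γ; k t (.hyp (by simp))

theorem Derives.spec (h : Γ ⊢ .all φ) (t : ℕ) : Γ ⊢ φ.inst t := .allE t h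

theorem ball_intro {y : ℕ} (h : ∀ {Δ} [Step Γ Δ] t, (Δ ⊢ t ∈ᶠ y) → (Δ ⊢ φ.inst t)) :
    Γ ⊢ ball y φ :=
  .all_intro fun t => imp_intro fun ht => h t ht

theorem Derives.ball_elim {y t : ℕ} (h : Γ ⊢ ball y φ) (ht : Γ ⊢ t ∈ᶠ y) :
    Γ ⊢ φ.inst t :=
  .impE (Derives.allE t h) ht

theorem bex_intro {y : ℕ} (t : ℕ) (h : Γ ⊢ t ∈ᶠ y) (h' : Γ ⊢ φ.inst t) : Γ ⊢ bex y φ :=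
  .exI t (.andI h h')

theorem Derives.obtain_mem {y : ℕ} (h : Γ ⊢ bex y φ)
    (k : ∀ {Θ} [Step Γ Θ] t, (Θ ⊢ t ∈ᶠ y) → (Θ ⊢ φ.inst t) → (Θ ⊢ χ)) : Γ ⊢ χ :=
  Derives.obtain h fun t ht => k t (Derives.left ht) (Derives.right ht)

/-! ### Equality and extensionality -/

theorem Derives.subst (φ : Fml) {x y : ℕ} (h : Γ ⊢ x ≡ᶠ y) (h' : Γ ⊢ φ.inst x) :
    Γ ⊢ φ.inst y := .eqE x y h h'

theorem Derives.symm {x y : ℕ} (h : Γ ⊢ x ≡ᶠ y) : Γ ⊢ y ≡ᶠ x :=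
  h.subst (0 ≡ᶠ (x + 1)) (.eqI x)

theorem Derives.trans {x y z : ℕ} (h : Γ ⊢ x ≡ᶠ y) (h' : Γ ⊢ y ≡ᶠ z) : Γ ⊢ x ≡ᶠ z :=
  h'.subst ((x + 1) ≡ᶠ 0) h

theorem Derives.mem_left {x y a : ℕ} (h : Γ ⊢ x ≡ᶠ y) (h' : Γ ⊢ x ∈ᶠ a) : Γ ⊢ y ∈ᶠ a :=
  h.subst (0 ∈ᶠ (a + 1)) h'

theorem Derives.mem_right {x y a : ℕ} (h : Γ ⊢ x ≡ᶠ y) (h' : Γ ⊢ a ∈ᶠ x) : Γ ⊢ a ∈ᶠ y :=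
  h.subst ((a + 1) ∈ᶠ 0) h'

theorem sub_intro {x y : ℕ} (h : ∀ {Δ} [Step Γ Δ] t, (Δ ⊢ t ∈ᶠ x) → (Δ ⊢ t ∈ᶠ y)) :
    Γ ⊢ sub x y := ball_intro fun t ht => h t ht

theorem Derives.sub_elim {x y t : ℕ} (h : Γ ⊢ sub x y) (ht : Γ ⊢ t ∈ᶠ x) : Γ ⊢ t ∈ᶠ y :=
  Derives.ball_elim h ht

theorem sub_refl (x : ℕ) : Γ ⊢ sub x x := sub_intro fun _ h => h

theorem eq_of_forall_mem_iff {x y : ℕ} (h : ∀ t, Γ ⊢ t ∈ᶠ x ↔ᶠ t ∈ᶠ y) : Γ ⊢ x ≡ᶠ y :=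
  have ax : Γ ⊢ .all (.all _) := .ax .extensionality
  Derives.mp (φ := .all (0 ∈ᶠ (x + 1) ↔ᶠ 0 ∈ᶠ (y + 1))) (Derives.spec (ax.spec x) y)
    (.all_intro fun t => h t)

theorem Derives.antisymm {x y : ℕ} (h : Γ ⊢ sub x y) (h' : Γ ⊢ sub y x) : Γ ⊢ x ≡ᶠ y :=
  eq_of_forall_mem_iff fun _ => iff_intro (fun h₁ => h.up.sub_elim h₁) fun h₁ => h'.up.sub_elim h₁

theorem Derives.sub_of_eq {x y : ℕ} (h : Γ ⊢ x ≡ᶠ y) : Γ ⊢ sub x y :=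
  sub_intro fun _ ht => h.up.mem_right ht

theorem isEmpty_intro {x : ℕ} (h : ∀ {Δ} [Step Γ Δ] t, (Δ ⊢ t ∈ᶠ x) → (Δ ⊢ .bot)) :
    Γ ⊢ isEmpty x := ball_intro h

theorem Derives.isEmpty_elim {x t : ℕ} (h : Γ ⊢ isEmpty x) (ht : Γ ⊢ t ∈ᶠ x) :
    Γ ⊢ φ :=
  .botE (Derives.ball_elim h ht)

theorem isTrans_intro {x : ℕ}
    (h : ∀ {Δ} [Step Γ Δ] y z, (Δ ⊢ y ∈ᶠ x) → (Δ ⊢ z ∈ᶠ y) → (Δ ⊢ z ∈ᶠ x)) : Γ ⊢ isTrans x :=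
  ball_intro fun {Δ} _ y hy => show Δ ⊢ sub y x from ball_intro fun {Θ} hΘ z hz =>
    show Θ ⊢ z ∈ᶠ x from
      have : Step Γ Θ := ⟨List.Subset.trans (Step.subset (Γ := Γ) (Δ := Δ)) hΘ.subset⟩
      h y z hy.up hz

theorem Derives.isTrans_sub {x y : ℕ} (h : Γ ⊢ isTrans x) (hy : Γ ⊢ y ∈ᶠ x) :
    Γ ⊢ sub y x := Derives.ball_elim h hy

theorem Derives.isTrans_elim {x y z : ℕ} (h : Γ ⊢ isTrans x) (hy : Γ ⊢ y ∈ᶠ x)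
    (hz : Γ ⊢ z ∈ᶠ y) : Γ ⊢ z ∈ᶠ x := (h.isTrans_sub hy).sub_elim hz

/-! ### Axioms of set existence, in continuation-passing form -/

/-- The class of all `z` with `φ(z)` is a set, where `z` is the variable `0` of `φ`. -/
def isSet (φ : Fml) : Fml := .ex (.all (0 ∈ᶠ 1 ↔ᶠ φ.rename (cons 0 (· + 2))))

/-- Cancels the shift past the variable of the set with its instantiation at `b`. -/
theorem isSet_body (φ : Fml) (b z : ℕ) :
    ((φ.rename (cons 0 (· + 2))).rename (lift (cons b fun n => n))).inst z = φ.inst z := by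
  simp only [Fml.inst, Fml.rename_rename]
  exact Fml.rename_ext _ (by rintro (_ | n) <;> rfl)

theorem isSet_inst (φ : Fml) (t : ℕ) :
    (isSet φ).inst t = isSet (φ.rename (lift (cons t fun n => n))) :=
  congrArg (fun ψ => Fml.ex (.all (0 ∈ᶠ 1 ↔ᶠ ψ)))
    (φ.rename_comm _ _ (by rintro (_ | _ | n) <;> rfl) :
      (φ.rename (cons 0 (· + 2))).rename (lift (lift (cons t fun n => n))) =
        (φ.rename (lift (cons t fun n => n))).rename (cons 0 (· + 2)))

theorem isSet_intro (b : ℕ) (h : ∀ {Δ} [Step Γ Δ] z, (Δ ⊢ z ∈ᶠ b) → (Δ ⊢ φ.inst z))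
    (h' : ∀ {Δ} [Step Γ Δ] z, (Δ ⊢ φ.inst z) → (Δ ⊢ z ∈ᶠ b)) : Γ ⊢ isSet φ := by
  refine .exI b (.all_intro fun z => ?_)
  have : Γ ⊢ z ∈ᶠ b ↔ᶠ φ.inst z := iff_intro (h z) (h' z)
  rw [← isSet_body φ b z] at this
  exact this

theorem Derives.isSet_elim (h : Γ ⊢ isSet φ)
    (k : ∀ {Θ} [Step Γ Θ] b, (∀ z, Θ ⊢ z ∈ᶠ b ↔ᶠ φ.inst z) → (Θ ⊢ χ)) :
    Γ ⊢ χ := by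
  refine Derives.obtain h fun {Θ} _ b hb => k b fun z => ?_
  have : Θ ⊢ z ∈ᶠ b ↔ᶠ ((φ.rename (cons 0 (· + 2))).rename (lift (cons b fun n => n))).inst z :=
    Derives.spec hb z
  rwa [isSet_body] at this

theorem Derives.isSet_congr (h : Γ ⊢ isSet φ)
    (h₁ : ∀ {Δ} [Step Γ Δ] z, (Δ ⊢ φ.inst z) → (Δ ⊢ ψ.inst z))
    (h₂ : ∀ {Δ} [Step Γ Δ] z, (Δ ⊢ ψ.inst z) → (Δ ⊢ φ.inst z)) : Γ ⊢ isSet ψ :=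
  have e : ∀ z, Γ ⊢ φ.inst z ↔ᶠ ψ.inst z := fun z => iff_intro (h₁ z) (h₂ z)
  h.isSet_elim fun b hb => isSet_intro b
    (fun z hz => (e z).up.iff_mp ((hb z).up.iff_mp hz)) fun z hz => (hb z).up.iff_mpr ((e z).up.iff_mpr hz)

theorem isSet_separation (a : ℕ) (hφ : IsBounded φ) : Γ ⊢ isSet (0 ∈ᶠ (a + 1) ∧ᶠ φ) := by
  have : Γ ⊢ .ex (.all (0 ∈ᶠ 1 ↔ᶠ 0 ∈ᶠ (a + 2) ∧ᶠ
      (φ.rename (cons 0 (· + 3))).rename (lift (lift (cons a fun n => n))))) :=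
    Derives.spec (.ax (CZF.boundedSeparation φ hφ) : Γ ⊢ _) a
  rw [Fml.rename_rename, Fml.rename_ext φ (g := cons 0 (· + 2)) (by rintro (_ | n) <;> rfl)] at this
  exact this

/-- Bounded separation from a class that is a set. -/
theorem Derives.isSet_and (h : Γ ⊢ isSet φ) (hψ : IsBounded ψ) : Γ ⊢ isSet (ψ ∧ᶠ φ) :=
  h.isSet_elim fun b hb => (isSet_separation b hψ).isSet_congr
    (fun z hz => .andI (Derives.right hz) ((hb z).up.iff_mp (Derives.left hz)))
    fun z hz => .andI ((hb z).up.iff_mpr (Derives.right hz)) (Derives.left hz)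

theorem isSet_union (a : ℕ) : Γ ⊢ isSet (bex (a + 1) (1 ∈ᶠ 0)) :=
  Derives.spec (.ax CZF.union : Γ ⊢ _) a

theorem isSet_pair (a b : ℕ) : Γ ⊢ isSet (0 ≡ᶠ (a + 1) ∨ᶠ 0 ≡ᶠ (b + 1)) :=
  Derives.spec (Derives.spec (.ax CZF.pairing : Γ ⊢ _) a) b

theorem isSet_mem (a : ℕ) : Γ ⊢ isSet (0 ∈ᶠ (a + 1)) :=
  isSet_intro a (fun _ h => h) fun _ h => h

/-- The union of the pair `{a, b}` of the two sets. -/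
theorem Derives.isSet_or (h : Γ ⊢ isSet φ) (h' : Γ ⊢ isSet ψ) : Γ ⊢ isSet (φ ∨ᶠ ψ) :=
  h.isSet_elim fun a ha => h'.up.isSet_elim fun b hb => (isSet_pair a b).isSet_elim fun c hc =>
    (isSet_union c).isSet_congr
      (fun z hz => Derives.obtain_mem hz fun u hu (hz : _ ⊢ z ∈ᶠ u) => ((hc u).up.iff_mp hu).cases
        (fun (e : _ ⊢ u ≡ᶠ a) => .orI₁ ((ha z).up.iff_mp (e.mem_right hz.up)))
        fun (e : _ ⊢ u ≡ᶠ b) => .orI₂ ((hb z).up.iff_mp (e.mem_right hz.up)))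
      fun z hz => Derives.cases hz
        (fun h => bex_intro a ((hc a).up.iff_mpr (.orI₁ (.eqI a))) ((ha z).up.iff_mpr h))
        fun h => bex_intro b ((hc b).up.iff_mpr (.orI₂ (.eqI b))) ((hb z).up.iff_mpr h)

theorem isSet_of_unique (b : ℕ) (h : Γ ⊢ φ.inst b)
    (h' : ∀ {Δ} [Step Γ Δ] z, (Δ ⊢ φ.inst z) → (Δ ⊢ z ≡ᶠ b)) : Γ ⊢ isSet φ :=
  (isSet_pair b b).isSet_elim fun c hc => isSet_intro c
    (fun z hz => ((hc z).up.iff_mp hz).cases (fun (e : _ ⊢ z ≡ᶠ b) => e.symm.subst φ h.up)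
      fun (e : _ ⊢ z ≡ᶠ b) => e.symm.subst φ h.up)
    fun z hz => (hc z).up.iff_mpr (.orI₁ ((imp_intro fun hz => h' z hz : Γ ⊢ _ →ᶠ z ≡ᶠ b).up.mp hz))

/-- Strong collection, for `φ(y, x)` with `y, x` the variables `0, 1` of `φ`. -/
theorem exists_collection (φ : Fml) (a : ℕ)
    (h : ∀ {Δ} [Step Γ Δ] x, (Δ ⊢ x ∈ᶠ a) → (Δ ⊢ .ex (φ.rename (cons 0 (cons (x + 1) (· + 1))))))
    (k : ∀ {Δ} [Step Γ Δ] b,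
      (∀ {Θ} [Ext Δ Θ] x χ, (Θ ⊢ x ∈ᶠ a) → (∀ {Θ'} [Step Θ Θ'] y, (Θ' ⊢ y ∈ᶠ b) →
        (Θ' ⊢ φ.rename (cons y (cons x fun n => n))) → (Θ' ⊢ χ)) → (Θ ⊢ χ)) →
      (∀ {Θ} [Ext Δ Θ] y χ, (Θ ⊢ y ∈ᶠ b) → (∀ {Θ'} [Step Θ Θ'] x, (Θ' ⊢ x ∈ᶠ a) →
        (Θ' ⊢ φ.rename (cons y (cons x fun n => n))) → (Θ' ⊢ χ)) → (Θ ⊢ χ)) → (Δ ⊢ χ)) :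
    Γ ⊢ χ := by
  have ax : Γ ⊢ ball a (.ex ((φ.rename (cons 0 (cons 1 (· + 3)))).rename
        (lift (lift (cons a fun n => n))))) →ᶠ
      .ex (ball (a + 1) (bex 1 ((φ.rename (cons 0 (cons 1 (· + 4)))).rename
          (lift (lift (lift (cons a fun n => n)))))) ∧ᶠ
        ball 0 (bex (a + 2) ((φ.rename (cons 1 (cons 0 (· + 4)))).rename
          (lift (lift (lift (cons a fun n => n))))))) := 
    Derives.spec (.ax (CZF.strongCollection φ) : Γ ⊢ _) a
  refine Derives.obtain (ax.mp (ball_intro fun {Δ} _ x hx => ?_)) fun {Δ} _ b hb => k b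
    (fun {Θ} _ x χ hx k => ?_) fun {Θ} _ y χ hy k => ?_
  · have := h x hx
    refine cast (congrArg (Derives CZF Δ) (congrArg Fml.ex ?_)) this
    simp only [Fml.rename_rename]
    exact Fml.rename_ext _ (by rintro (_ | _ | n) <;> rfl)
  · refine Derives.obtain_mem (Derives.ball_elim (Derives.left hb.up) hx) fun {Θ'} _ y hy h => k y hy ?_
    refine cast (congrArg (Derives CZF Θ') ?_) h
    simp only [Fml.inst, Fml.rename_rename]
    exact Fml.rename_ext _ (by rintro (_ | _ | n) <;> rfl)
  · refine Derives.obtain_mem (Derives.ball_elim (Derives.right hb.up) hy) fun {Θ'} _ x hx h => k x hx ?_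
    refine cast (congrArg (Derives CZF Θ') ?_) h
    simp only [Fml.inst, Fml.rename_rename]
    exact Fml.rename_ext _ (by rintro (_ | _ | n) <;> rfl)

/-- The union of a family of classes that are sets, indexed by the elements of a set: in
`φ(x, z)`, the index `x` is the variable `0` and the element `z` is the variable `1`. -/
theorem isSet_bex (a : ℕ) (φ : Fml)
    (h : ∀ {Δ} [Step Γ Δ] x, (Δ ⊢ x ∈ᶠ a) →
      (Δ ⊢ isSet (φ.rename (cons (x + 1) (cons 0 (· + 1)))))) :
    Γ ⊢ isSet (bex (a + 1) φ) := by
  have hinst : ∀ x z, (φ.rename (cons (x + 1) (cons 0 (· + 1)))).inst z =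
      φ.rename (cons x (cons z fun n => n)) := by
    intro x z
    simp only [Fml.inst, Fml.rename_rename]
    exact Fml.rename_ext _ (by rintro (_ | _ | n) <;> rfl)
  have hinst' : ∀ z x, (φ.rename (lift (cons z fun n => n))).inst x =
      φ.rename (cons x (cons z fun n => n)) := by
    intro x z
    simp only [Fml.inst, Fml.rename_rename]
    exact Fml.rename_ext _ (by rintro (_ | _ | n) <;> rfl)
  -- Strong collection is applied to the relation `y = {z | φ(x, z)}`. Its second half keeps all
  -- other sets out of `b`, so that `⋃ b` is exactly the desired class.
  refine exists_collection (.all (0 ∈ᶠ 1 ↔ᶠ φ.rename (cons 2 (cons 0 (· + 3))))) a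
    (fun {Δ} _ x hx => ?_) fun {Δ} _ b hb hb' => ?_
  · refine cast (congrArg (Derives CZF Δ) ?_) (h x hx)
    have e : (φ.rename (cons (x + 1) (cons 0 (· + 1)))).rename (cons 0 (· + 2)) =
        (φ.rename (cons 2 (cons 0 (· + 3)))).rename (lift (cons 0 (cons (x + 1) (· + 1)))) :=
      Fml.rename_comm φ _ _ (by rintro (_ | _ | n) <;> rfl)
    rw [isSet, e]
    rfl
  · have hbody : ∀ {Θ} x y z, (Θ ⊢ (Fml.all (0 ∈ᶠ 1 ↔ᶠ φ.rename (cons 2 (cons 0 (· + 3))))).rename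
        (cons y (cons x fun n => n))) → (Θ ⊢ z ∈ᶠ y ↔ᶠ φ.rename (cons x (cons z fun n => n))) := by
      intro Θ x y z h
      have h' : Θ ⊢ z ∈ᶠ y ↔ᶠ ((φ.rename (cons 2 (cons 0 (· + 3)))).rename
        (lift (cons y (cons x fun n => n)))).inst z := Derives.spec h z
      simp only [Fml.inst, Fml.rename_rename] at h'
      rwa [Fml.rename_ext φ (g := cons x (cons z fun n => n))
        (by rintro (_ | _ | n) <;> rfl)] at h'
    refine (isSet_union b).isSet_congr (fun {Θ} _ z hz => ?_) fun {Θ} _ z hz => ?_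
    · refine Derives.obtain_mem hz fun {Θ} _ y hy (hz : Θ ⊢ z ∈ᶠ y) => ?_
      refine hb' y _ hy fun x hx h => bex_intro x hx ?_
      rw [hinst']
      exact (hbody x y z h).iff_mp hz.up
    · refine Derives.obtain_mem hz fun {Θ} _ x hx hz => hb x _ hx fun y hy h =>
        bex_intro y hy ((hbody x y z h).iff_mpr ?_)
      rw [hinst'] at hz
      exact hz.up

/-! ### Set induction -/

/-- Set induction, for `φ(x)` with `x` the variable `0` of `φ`. -/
theorem set_induction (φ : Fml)
    (h : ∀ {Δ} [Step Γ Δ] a, (∀ {Θ} [Ext Δ Θ] x, (Θ ⊢ x ∈ᶠ a) → (Θ ⊢ φ.inst x)) →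
      (Δ ⊢ φ.inst a)) (a : ℕ) : Γ ⊢ φ.inst a := by
  have ax : Γ ⊢ .all (ball 0 (φ.rename (cons 0 (· + 2))) →ᶠ φ) →ᶠ .all φ := .ax (.setInduction φ)
  refine Derives.spec (ax.mp (.all_intro fun a => ?_)) a
  have : Γ ⊢ ball a ((φ.rename (cons 0 (· + 2))).rename (lift (cons a fun n => n))) →ᶠ φ.inst a :=
    imp_intro fun hyp => h a fun {Θ} _ x hx => by
      have := hyp.up.ball_elim hx
      rwa [isSet_body] at this
  exact this

theorem not_mem_self (x : ℕ) (h : Γ ⊢ x ∈ᶠ x) : Γ ⊢ φ :=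
  have : Γ ⊢ x ∈ᶠ x →ᶠ .bot := set_induction (0 ∈ᶠ 0 →ᶠ .bot)
    (fun {Γ} _ a ih => show Γ ⊢ a ∈ᶠ a →ᶠ .bot from
      imp_intro fun {Θ} _ ha => Derives.mp (ih a ha : Θ ⊢ a ∈ᶠ a →ᶠ .bot) ha) x
  (this.mp h.up).absurd

/-! ### Rules with several premises -/

theorem step_trans (_ : Step Γ Δ) {Θ : List Fml} (_ : Step Δ Θ) : Step Γ Θ :=
  ⟨List.Subset.trans (Step.subset (Γ := Γ) (Δ := Δ)) Step.subset⟩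

theorem imp_intro₂ (h : ∀ {Δ} [Step Γ Δ], (Δ ⊢ φ) → (Δ ⊢ ψ) → (Δ ⊢ χ)) : Γ ⊢ φ →ᶠ ψ →ᶠ χ :=
  imp_intro fun {_} i h₁ => imp_intro fun {_} j h₂ => have := step_trans i j; h h₁.up h₂

theorem imp_intro₃ (h : ∀ {Δ} [Step Γ Δ], (Δ ⊢ φ) → (Δ ⊢ ψ) → (Δ ⊢ χ) → (Δ ⊢ θ)) :
    Γ ⊢ φ →ᶠ ψ →ᶠ χ →ᶠ θ :=
  imp_intro₂ fun {_} i h₁ h₂ => imp_intro fun {_} j h₃ => have := step_trans i j; h h₁.up h₂.up h₃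

theorem Derives.mp₂ (h : Γ ⊢ φ →ᶠ ψ →ᶠ χ) (h₁ : Γ ⊢ φ) (h₂ : Γ ⊢ ψ) : Γ ⊢ χ :=
  (h.mp h₁).mp h₂

theorem Derives.mp₃ (h : Γ ⊢ φ →ᶠ ψ →ᶠ χ →ᶠ θ) (h₁ : Γ ⊢ φ) (h₂ : Γ ⊢ ψ)
    (h₃ : Γ ⊢ χ) : Γ ⊢ θ := (h.mp₂ h₁ h₂).mp h₃

/-! ### Boundedness of the basic formulas -/

theorem isBounded_sub (x y : ℕ) : IsBounded (sub x y) := .ball _ (.mem _ _)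

theorem isBounded_isEmpty (x : ℕ) : IsBounded (isEmpty x) := .ball _ .bot

theorem isBounded_isSucc (y x : ℕ) : IsBounded (isSucc y x) :=
  .and (isBounded_sub _ _) (.and (.mem _ _) (.ball _ (.or (.mem _ _) (.eq _ _))))

theorem isBounded_isPair (p a b : ℕ) : IsBounded (isPair p a b) :=
  .and (.mem _ _) (.and (.mem _ _) (.ball _ (.or (.eq _ _) (.eq _ _))))

theorem isBounded_isOPair (p a b : ℕ) : IsBounded (isOPair p a b) :=
  .and (.bex _ (isBounded_isPair _ _ _)) (.and (.bex _ (isBounded_isPair _ _ _))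
    (.ball _ (.or (isBounded_isPair _ _ _) (isBounded_isPair _ _ _))))

theorem isBounded_pairMem (a b r : ℕ) : IsBounded (pairMem a b r) :=
  .bex _ (isBounded_isOPair _ _ _)

theorem isBounded_isSnoc (t s n a : ℕ) : IsBounded (isSnoc t s n a) :=
  .and (isBounded_sub _ _) (.and (isBounded_pairMem _ _ _)
    (.ball _ (.or (.mem _ _) (isBounded_isOPair _ _ _))))

/-! ### Pairs -/

theorem Derives.mem_pair {p a b x : ℕ} (h : Γ ⊢ isPair p a b) (hx : Γ ⊢ x ∈ᶠ p) :
    Γ ⊢ x ≡ᶠ a ∨ᶠ x ≡ᶠ b := Derives.ball_elim h.right.right hx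

theorem Derives.pair_sub {p q a b : ℕ} (h : Γ ⊢ isPair p a b) (ha : Γ ⊢ a ∈ᶠ q)
    (hb : Γ ⊢ b ∈ᶠ q) : Γ ⊢ sub p q :=
  sub_intro fun _ hx => (h.up.mem_pair hx).cases (fun e => e.up.symm.mem_left ha.up)
    fun e => e.up.symm.mem_left hb.up

theorem Derives.pair_unique {p q a b : ℕ} (h : Γ ⊢ isPair p a b)
    (h' : Γ ⊢ isPair q a b) : Γ ⊢ p ≡ᶠ q :=
  (h.pair_sub h'.left h'.right.left).antisymm (h'.pair_sub h.up.left h.up.right.left)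

theorem exists_pair (a b : ℕ) (k : ∀ {Δ} [Step Γ Δ] p, (Δ ⊢ isPair p a b) → (Δ ⊢ χ)) : Γ ⊢ χ :=
  (isSet_pair a b).isSet_elim fun p hp => k p
    (.andI ((hp a).up.iff_mpr (.orI₁ (.eqI a))) (.andI ((hp b).up.iff_mpr (.orI₂ (.eqI b)))
      (ball_intro fun x hx => (hp x).up.iff_mp hx)))

theorem exists_opair (a b : ℕ) (k : ∀ {Δ} [Step Γ Δ] p, (Δ ⊢ isOPair p a b) → (Δ ⊢ χ)) :
    Γ ⊢ χ :=
  Derives.obtain (φ := isOPair 0 (a + 1) (b + 1))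
    (exists_pair a a fun u hu => exists_pair a b fun v hv => exists_pair u v fun p hp =>
      .exI p (.andI (bex_intro u hp.up.left hu.up) (.andI (bex_intro v hp.up.right.left hv.up)
        (ball_intro fun _ hx => (hp.up.mem_pair hx).cases
          (fun e => .orI₁ (e.up.symm.subst (isPair 0 (a + 1) (a + 1)) hu.up))
          fun e => .orI₂ (e.up.symm.subst (isPair 0 (a + 1) (b + 1)) hv.up))))) k

theorem Derives.opair_sub {p q a b : ℕ} (h : Γ ⊢ isOPair p a b)
    (h' : Γ ⊢ isOPair q a b) : Γ ⊢ sub p q :=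
  sub_intro fun _ hx => (Derives.ball_elim h.up.right.right hx).cases
    (fun h₁ => Derives.obtain_mem h'.up.left fun _ hu h₂ =>
      (Derives.pair_unique h₂ h₁.up).mem_left hu)
    fun h₁ => Derives.obtain_mem h'.up.right.left fun _ hu h₂ =>
      (Derives.pair_unique h₂ h₁.up).mem_left hu

theorem Derives.opair_unique {p q a b : ℕ} (h : Γ ⊢ isOPair p a b)
    (h' : Γ ⊢ isOPair q a b) : Γ ⊢ p ≡ᶠ q := (h.opair_sub h').antisymm (h'.opair_sub h.up)

/-- The member `{a}` of `p` is `{c}` or `{c, d}`; in both cases it contains `c`. -/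
theorem Derives.opair_fst {p a b c d : ℕ} (h : Γ ⊢ isOPair p a b)
    (h' : Γ ⊢ isOPair p c d) : Γ ⊢ a ≡ᶠ c :=
  Derives.obtain_mem h.up.left fun {Θ} _ u hu (hu' : Θ ⊢ isPair u a a) =>
    have hc : Θ ⊢ c ∈ᶠ u := Derives.cases (h'.up.right.right.ball_elim hu)
      (fun h => Derives.left h.up) fun h => Derives.left h.up
    (hu'.up.mem_pair hc).cases (fun e => e.up.symm) fun e => e.up.symm

theorem Derives.opair_snd_cases {p a b c d : ℕ} (h : Γ ⊢ isOPair p a b)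
    (h' : Γ ⊢ isOPair p c d) : Γ ⊢ b ≡ᶠ c ∨ᶠ b ≡ᶠ d :=
  Derives.obtain_mem h.up.right.left fun {_} _ v hv (hv' : _ ⊢ isPair v a b) =>
    Derives.cases (h'.up.right.right.ball_elim hv)
      (fun (h : _ ⊢ isPair v c c) =>
        (h.up.mem_pair hv'.up.right.left).cases (fun e => .orI₁ e) fun e => .orI₁ e)
      fun (h : _ ⊢ isPair v c d) => h.up.mem_pair hv'.up.right.left

/-- It is not decided whether `a = b`, so the pairs are compared in both directions: `b` is `c` or
`d`, and `d` is `a` or `b`. In the only crossed case, `b = c` and `d = a`, all four are equal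
because `a = c`. -/
theorem Derives.opair_snd {p a b c d : ℕ} (h : Γ ⊢ isOPair p a b)
    (h' : Γ ⊢ isOPair p c d) : Γ ⊢ b ≡ᶠ d :=
  (h.up.opair_snd_cases h'.up).cases
    (fun e => (h'.up.opair_snd_cases h.up).cases
      (fun e' => e.up.trans ((h.up.opair_fst h'.up).symm.trans e'.up.symm)) fun e' => e'.up.symm)
    fun e => e

theorem pairMem_intro {a b r : ℕ} (p : ℕ) (hp : Γ ⊢ p ∈ᶠ r) (h : Γ ⊢ isOPair p a b) :
    Γ ⊢ pairMem a b r := bex_intro p hp h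

theorem Derives.obtain_pair {a b r : ℕ} (h : Γ ⊢ pairMem a b r)
    (k : ∀ {Θ} [Step Γ Θ] p, (Θ ⊢ p ∈ᶠ r) → (Θ ⊢ isOPair p a b) → (Θ ⊢ χ)) : Γ ⊢ χ :=
  Derives.obtain_mem h k

theorem Derives.mem_of_pairMem {a b p r : ℕ} (h : Γ ⊢ pairMem a b r)
    (hp : Γ ⊢ isOPair p a b) : Γ ⊢ p ∈ᶠ r :=
  h.up.obtain_pair fun _ hq h => (h.up.opair_unique hp.up).mem_left hq

theorem Derives.pairMem_mono {a b r s : ℕ} (h : Γ ⊢ sub r s) (hp : Γ ⊢ pairMem a b r) :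
    Γ ⊢ pairMem a b s :=
  hp.up.obtain_pair fun p hp h' => pairMem_intro p (h.up.sub_elim hp.up) h'

theorem Derives.pairMem_fst {a a' b r : ℕ} (h : Γ ⊢ a ≡ᶠ a') (hp : Γ ⊢ pairMem a b r) :
    Γ ⊢ pairMem a' b r := h.subst (pairMem 0 (b + 1) (r + 1)) hp

theorem Derives.pairMem_snd {a b b' r : ℕ} (h : Γ ⊢ b ≡ᶠ b') (hp : Γ ⊢ pairMem a b r) :
    Γ ⊢ pairMem a b' r := h.subst (pairMem (a + 1) 0 (r + 1)) hp

/-! ### Adjoining an element -/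

theorem isSet_singleton (a : ℕ) : Γ ⊢ isSet (0 ≡ᶠ (a + 1)) :=
  isSet_of_unique a (.eqI a) fun _ h => h

theorem exists_insert (s a : ℕ) (k : ∀ {Δ} [Step Γ Δ] t,
    (∀ z, Δ ⊢ z ∈ᶠ t ↔ᶠ z ∈ᶠ s ∨ᶠ z ≡ᶠ a) → (Δ ⊢ χ)) : Γ ⊢ χ :=
  ((isSet_mem s).isSet_or (isSet_singleton a) : Γ ⊢ _).isSet_elim fun t ht => k t ht

/-! ### The natural numbers -/

theorem isSucc_intro {y x : ℕ} (h : ∀ z, Γ ⊢ z ∈ᶠ y ↔ᶠ z ∈ᶠ x ∨ᶠ z ≡ᶠ x) : Γ ⊢ isSucc y x :=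
  .andI (sub_intro fun z hz => (h z).up.iff_mpr (.orI₁ hz))
    (.andI ((h x).up.iff_mpr (.orI₂ (.eqI x))) (ball_intro fun z hz => (h z).up.iff_mp hz))

theorem exists_succ (x : ℕ) (k : ∀ {Δ} [Step Γ Δ] y, (Δ ⊢ isSucc y x) → (Δ ⊢ χ)) : Γ ⊢ χ :=
  exists_insert x x fun y hy => k y (isSucc_intro hy)

theorem Derives.mem_succ {x y z : ℕ} (h : Γ ⊢ isSucc y x) (hz : Γ ⊢ z ∈ᶠ y) :
    Γ ⊢ z ∈ᶠ x ∨ᶠ z ≡ᶠ x := h.right.right.ball_elim hz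

theorem Derives.sub_succ {x y : ℕ} (h : Γ ⊢ isSucc y x) : Γ ⊢ sub x y := h.left

theorem Derives.self_mem_succ {x y : ℕ} (h : Γ ⊢ isSucc y x) : Γ ⊢ x ∈ᶠ y := h.right.left

theorem Derives.succ_sub {x y z : ℕ} (h : Γ ⊢ isSucc y x) (hs : Γ ⊢ sub x z)
    (hx : Γ ⊢ x ∈ᶠ z) : Γ ⊢ sub y z :=
  sub_intro fun _ hu => (h.up.mem_succ hu).cases (fun hu => hs.up.sub_elim hu)
    fun e => e.up.symm.mem_left hx.up

theorem Derives.succ_unique {x y z : ℕ} (h : Γ ⊢ isSucc y x) (h' : Γ ⊢ isSucc z x) :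
    Γ ⊢ y ≡ᶠ z :=
  (h.succ_sub h'.sub_succ h'.self_mem_succ).antisymm (h'.succ_sub h.up.sub_succ h.up.self_mem_succ)

theorem Derives.empty_sub {x y : ℕ} (h : Γ ⊢ isEmpty x) : Γ ⊢ sub x y :=
  sub_intro fun _ hz => h.up.isEmpty_elim hz

theorem Derives.empty_unique {x y : ℕ} (h : Γ ⊢ isEmpty x) (h' : Γ ⊢ isEmpty y) :
    Γ ⊢ x ≡ᶠ y := (h.empty_sub (Γ := Γ)).antisymm h'.empty_sub

theorem exists_empty (k : ∀ {Δ} [Step Γ Δ] e, (Δ ⊢ isEmpty e) → (Δ ⊢ χ)) : Γ ⊢ χ :=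
  Derives.obtain (.ax .emptySet : Γ ⊢ _) k

theorem Derives.empty_mem_omega {w e : ℕ} (hw : Γ ⊢ isOmega w) (he : Γ ⊢ isEmpty e) :
    Γ ⊢ e ∈ᶠ w :=
  Derives.obtain_mem hw.up.left.left fun _ hx h => (Derives.empty_unique h he.up).mem_left hx

theorem Derives.succ_mem_omega {w n m : ℕ} (hw : Γ ⊢ isOmega w) (hn : Γ ⊢ n ∈ᶠ w)
    (h : Γ ⊢ isSucc m n) : Γ ⊢ m ∈ᶠ w :=
  Derives.obtain_mem (hw.up.left.right.ball_elim hn.up) fun _ hx h' =>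
    (Derives.succ_unique h' h.up).mem_left hx

/-- Bounded separation makes `{n ∈ ω | φ(n)}` a set; it is inductive, so it contains `ω`. -/
theorem omega_bounded_induction {w : ℕ} (hw : Γ ⊢ isOmega w) (hφ : IsBounded φ)
    (h₀ : ∀ {Δ} [Step Γ Δ] e, (Δ ⊢ isEmpty e) → (Δ ⊢ φ.inst e))
    (hs : ∀ {Δ} [Step Γ Δ] n m, (Δ ⊢ n ∈ᶠ w) → (Δ ⊢ isSucc m n) → (Δ ⊢ φ.inst n) →
      (Δ ⊢ φ.inst m)) {n : ℕ} (hn : Γ ⊢ n ∈ᶠ w) : Γ ⊢ φ.inst n :=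
  -- A premise that speaks of contexts right after `Γ` is repackaged as a derivable implication,
  -- which `Derives.up` can carry to any later context. The device recurs throughout.
  have h₀ := fun e => imp_intro (h₀ e)
  have hs := fun n m => imp_intro₃ (hs n m)
  (isSet_separation w hφ).isSet_elim fun {Δ} _ b hb =>
    have hind : Δ ⊢ isInd b := .andI
      (exists_empty fun e he => bex_intro e ((hb e).up.iff_mpr (.andI (hw.up.empty_mem_omega he)
        ((h₀ e).up.mp he))) he)
      (ball_intro fun n hn => show _ ⊢ bex b (isSucc 0 (n + 1)) from
        exists_succ n fun {Θ} _ m hm =>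
          have hn' : Θ ⊢ n ∈ᶠ w ∧ᶠ φ.inst n := (hb n).up.iff_mp hn.up
          bex_intro m ((hb m).up.iff_mpr (.andI (hw.up.succ_mem_omega (Derives.left hn') hm)
            ((hs n m).up.mp₃ (Derives.left hn') hm (Derives.right hn')))) hm)
    have hsub : Δ ⊢ isInd b →ᶠ sub w b := hw.up.right.spec b
    Derives.right ((hb n).up.iff_mp ((hsub.mp hind).sub_elim hn.up))

theorem Derives.omega_cases {w n : ℕ} (hw : Γ ⊢ isOmega w) (hn : Γ ⊢ n ∈ᶠ w) :
    Γ ⊢ isEmpty n ∨ᶠ bex w (isSucc (n + 1) 0) :=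
  omega_bounded_induction (φ := isEmpty 0 ∨ᶠ bex (w + 1) (isSucc 1 0)) (w := w) hw.up
    (.or (isBounded_isEmpty _) (.bex _ (isBounded_isSucc _ _)))
    (fun _ he => .orI₁ he) (fun n _ hn hm _ => .orI₂ (bex_intro n hn hm)) hn.up

/-- Induction on the natural numbers, for arbitrary formulas. -/
theorem omega_induction (φ : Fml) {w : ℕ} (hw : Γ ⊢ isOmega w)
    (h₀ : ∀ {Δ} [Step Γ Δ] e, (Δ ⊢ isEmpty e) → (Δ ⊢ φ.inst e))
    (hs : ∀ {Δ} [Step Γ Δ] n m, (Δ ⊢ n ∈ᶠ w) → (Δ ⊢ isSucc m n) → (Δ ⊢ φ.inst n) →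
      (Δ ⊢ φ.inst m)) {n : ℕ} (hn : Γ ⊢ n ∈ᶠ w) : Γ ⊢ φ.inst n :=
  have h₀ := fun e => imp_intro (h₀ e)
  have hs := fun n m => imp_intro₃ (hs n m)
  -- Separation is not available for an unbounded `φ`. Set induction is used instead;
  -- `Derives.omega_cases`, itself a bounded induction, supplies the predecessor.
  have : Γ ⊢ n ∈ᶠ w →ᶠ φ.inst n := set_induction (0 ∈ᶠ (w + 1) →ᶠ φ)
    (fun {Δ} _ a ih => show Δ ⊢ a ∈ᶠ w →ᶠ φ.inst a from imp_intro fun ha =>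
      (hw.up.omega_cases ha).cases (fun he => (h₀ a).up.mp he) fun h =>
        Derives.obtain_mem h fun {Θ} _ m hm (hs' : _ ⊢ isSucc a m) =>
          have ihm : Θ ⊢ m ∈ᶠ w →ᶠ φ.inst m := ih m hs'.up.self_mem_succ
          (hs m a).up.mp₃ hm hs' (ihm.mp hm)) n
  this.mp hn

/-! ### Ordinals, and the order of the natural numbers -/

theorem isOrd_intro {x : ℕ} (h : Γ ⊢ isTrans x)
    (h' : ∀ {Δ} [Step Γ Δ] y, (Δ ⊢ y ∈ᶠ x) → (Δ ⊢ isTrans y)) : Γ ⊢ isOrd x :=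
  .andI h (ball_intro h')

theorem Derives.ord_trans {x : ℕ} (h : Γ ⊢ isOrd x) : Γ ⊢ isTrans x := h.left

theorem Derives.ord_mem {x y : ℕ} (h : Γ ⊢ isOrd x) (hy : Γ ⊢ y ∈ᶠ x) : Γ ⊢ isOrd y :=
  isOrd_intro (h.up.right.ball_elim hy.up) fun _ hz => h.up.right.ball_elim (h.up.left.isTrans_elim hy.up hz)

theorem Derives.ord_succ {x y : ℕ} (h : Γ ⊢ isOrd x) (hy : Γ ⊢ isSucc y x) :
    Γ ⊢ isOrd y :=
  isOrd_intro
    (isTrans_intro fun _ _ hu hv => (hy.up.mem_succ hu).cases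
      (fun hu => hy.up.sub_succ.sub_elim (h.up.left.isTrans_elim hu hv.up))
      fun e => hy.up.sub_succ.sub_elim (e.up.mem_right hv.up))
    fun _ hu => (hy.up.mem_succ hu).cases (fun hu => h.up.right.ball_elim hu)
      fun e => e.up.symm.subst (isTrans 0) h.up.left

theorem Derives.empty_ord {x : ℕ} (h : Γ ⊢ isEmpty x) : Γ ⊢ isOrd x :=
  isOrd_intro (isTrans_intro fun _ _ hy _ => h.up.isEmpty_elim hy) fun _ hy => h.up.isEmpty_elim hy

theorem Derives.nat_ord {w n : ℕ} (hw : Γ ⊢ isOmega w) (hn : Γ ⊢ n ∈ᶠ w) : Γ ⊢ isOrd n :=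
  omega_induction (isOrd 0) (w := w) hw.up (fun _ he => he.up.empty_ord)
    (fun _ _ _ hm h => Derives.ord_succ h hm) hn.up

theorem Derives.omega_trans {w : ℕ} (hw : Γ ⊢ isOmega w) : Γ ⊢ isTrans w :=
  ball_intro fun n hn => show _ ⊢ sub n w from
    omega_induction (sub 0 (w + 1)) (w := w) hw.up (fun _ he => he.up.empty_sub)
      (fun _ _ hn hm h => Derives.succ_sub hm h hn) hn

theorem Derives.omega_ord {w : ℕ} (hw : Γ ⊢ isOmega w) : Γ ⊢ isOrd w :=
  isOrd_intro hw.up.omega_trans fun _ hn => (hw.up.nat_ord hn).left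

theorem Derives.nat_of_mem_omega {w n : ℕ} (hw : Γ ⊢ isOmega w) (hn : Γ ⊢ n ∈ᶠ w) :
    Γ ⊢ isNat n := .exI w (.andI hw.up hn)

theorem Derives.mem_omega_of_nat {w n : ℕ} (hw : Γ ⊢ isOmega w) (hn : Γ ⊢ isNat n) :
    Γ ⊢ n ∈ᶠ w :=
  Derives.obtain hn.up fun v (hv : _ ⊢ isOmega v ∧ᶠ n ∈ᶠ v) =>
    (Derives.mp (hv.up.left.right.spec w) hw.up.left).sub_elim hv.up.right

theorem Derives.succ_mem_succ {w l l' n n' : ℕ} (hw : Γ ⊢ isOmega w) (hn : Γ ⊢ n ∈ᶠ w)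
    (hl : Γ ⊢ l ∈ᶠ n) (hl' : Γ ⊢ isSucc l' l) (hn' : Γ ⊢ isSucc n' n) : Γ ⊢ l' ∈ᶠ n' :=
  have key : Γ ⊢ ball n (.all (.all (isSucc 1 2 →ᶠ isSucc 0 (n + 3) →ᶠ 1 ∈ᶠ 0))) :=
    omega_induction (ball 0 (.all (.all (isSucc 1 2 →ᶠ isSucc 0 3 →ᶠ 1 ∈ᶠ 0)))) (w := w) hw.up
      (fun e he => ball_intro fun l hl => he.up.isEmpty_elim hl.up)
      (fun {Θ} _ n m hn hm ih => ball_intro fun l hl => .all_intro fun l' => .all_intro fun m' =>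
        show _ ⊢ isSucc l' l →ᶠ isSucc m' m →ᶠ l' ∈ᶠ m' from imp_intro₂ fun {Θ'} _ hl' hm' =>
          (hm.up.mem_succ hl.up).cases
            (fun {Θ'} _ hl =>
              have h : Θ' ⊢ isSucc l' l →ᶠ isSucc m n →ᶠ l' ∈ᶠ m :=
                Derives.spec (Derives.spec (Derives.ball_elim ih.up hl) l') m
              hm'.up.sub_succ.sub_elim (h.up.mp₂ hl'.up hm.up))
            fun e => (Derives.succ_unique hm.up (e.up.subst (isSucc (l' + 1) 0) hl'.up)).mem_left
              hm'.up.self_mem_succ) hn.up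
  Derives.mp₂ (φ := isSucc l' l) (ψ := isSucc n' n)
    (Derives.spec (Derives.spec (key.ball_elim hl.up) l') n') hl' hn'.up

theorem Derives.empty_mem_succ {w e n m : ℕ} (hw : Γ ⊢ isOmega w) (he : Γ ⊢ isEmpty e)
    (hn : Γ ⊢ n ∈ᶠ w) (hm : Γ ⊢ isSucc m n) : Γ ⊢ e ∈ᶠ m :=
  have key : Γ ⊢ isEmpty n ∨ᶠ e ∈ᶠ n :=
    omega_induction (isEmpty 0 ∨ᶠ (e + 1) ∈ᶠ 0) (w := w) hw (fun _ h => .orI₁ h)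
      (fun n m _ hm h => Derives.cases h
        (fun h => .orI₂ ((h.empty_unique he.up).mem_left hm.up.self_mem_succ))
        fun h => .orI₂ (hm.up.sub_succ.sub_elim h)) hn
  key.cases (fun h => (h.empty_unique he.up).mem_left hm.up.self_mem_succ)
    fun h => hm.up.sub_succ.sub_elim h

/-- Any two natural numbers are less than a third one. -/
theorem Derives.exists_gt {w m n : ℕ} (hw : Γ ⊢ isOmega w) (hm : Γ ⊢ m ∈ᶠ w) (hn : Γ ⊢ n ∈ᶠ w)
    (k : ∀ {Δ} [Step Γ Δ] l, (Δ ⊢ l ∈ᶠ w) → (Δ ⊢ m ∈ᶠ l) → (Δ ⊢ n ∈ᶠ l) → (Δ ⊢ χ)) : Γ ⊢ χ :=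
  -- Induction on `n` with `m` fixed, starting from `l = m⁺`; at each step `l` is replaced by its
  -- successor. This avoids comparing `m` with `n`.
  have key : Γ ⊢ bex w ((m + 1) ∈ᶠ 0 ∧ᶠ (n + 1) ∈ᶠ 0) :=
    omega_induction (bex (w + 1) ((m + 2) ∈ᶠ 0 ∧ᶠ 1 ∈ᶠ 0)) (w := w) hw
      (fun {Δ} _ e he => exists_succ m fun {Δ} _ l hl =>
        bex_intro l (hw.up.succ_mem_omega hm.up hl) (show Δ ⊢ m ∈ᶠ l ∧ᶠ e ∈ᶠ l from
          .andI hl.self_mem_succ (hw.up.empty_mem_succ he.up hm.up hl)))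
      (fun {Δ} _ n n' hn hn' ih => Derives.obtain_mem ih fun {Δ} _ l hl
          (h : Δ ⊢ m ∈ᶠ l ∧ᶠ n ∈ᶠ l) => exists_succ l fun {Δ} _ l' hl' =>
        bex_intro l' (hw.up.succ_mem_omega hl.up hl') (show Δ ⊢ m ∈ᶠ l' ∧ᶠ n' ∈ᶠ l' from
          .andI (hl'.sub_succ.sub_elim h.up.left)
            (hw.up.succ_mem_succ hl.up h.up.right hn'.up hl'))) hn
  key.obtain_mem fun l hl h => k l hl (Derives.left h) (Derives.right h)

/-! ### Finite sequences -/

theorem Derives.seq_mem {s n X p : ℕ} (h : Γ ⊢ isSeq s n X) (hp : Γ ⊢ p ∈ᶠ s)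
    (k : ∀ {Δ} [Step Γ Δ] i a, (Δ ⊢ i ∈ᶠ n) → (Δ ⊢ a ∈ᶠ X) → (Δ ⊢ isOPair p i a) → (Δ ⊢ χ)) :
    Γ ⊢ χ :=
  Derives.obtain_mem (h.left.ball_elim hp) fun {_} st i hi h₁ =>
    Derives.obtain_mem h₁ fun {_} st' a ha h₂ => have := step_trans st st'; k i a hi.up ha h₂

theorem Derives.seq_dom {s n X i a : ℕ} (h : Γ ⊢ isSeq s n X) (hp : Γ ⊢ pairMem i a s) :
    Γ ⊢ i ∈ᶠ n ∧ᶠ a ∈ᶠ X :=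
  hp.obtain_pair fun _ hp hp' => h.up.seq_mem hp fun _ _ hi ha h' =>
    .andI ((h'.opair_fst hp'.up).mem_left hi) ((h'.opair_snd hp'.up).mem_left ha)

theorem Derives.seq_val {s n X i : ℕ} (h : Γ ⊢ isSeq s n X) (hi : Γ ⊢ i ∈ᶠ n)
    (k : ∀ {Δ} [Step Γ Δ] a, (Δ ⊢ a ∈ᶠ X) → (Δ ⊢ pairMem i a s) → (Δ ⊢ χ)) : Γ ⊢ χ :=
  Derives.obtain_mem (h.right.ball_elim hi) fun a ha h' => k a ha (Derives.left h')

theorem Derives.seq_unique {s n X i a b : ℕ} (h : Γ ⊢ isSeq s n X) (ha : Γ ⊢ pairMem i a s)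
    (hb : Γ ⊢ pairMem i b s) : Γ ⊢ a ≡ᶠ b :=
  -- Both values are compared with the single value `c` that `isSeq` provides at `i`.
  have key : ∀ {a}, (Γ ⊢ pairMem i a s) → (Γ ⊢ ball X (pairMem (i + 1) 0 (s + 1) →ᶠ
      bex (X + 1) (ball (X + 2) (pairMem (i + 3) 0 (s + 3) →ᶠ 0 ≡ᶠ 1) ∧ᶠ 1 ≡ᶠ 0))) := fun ha =>
    ball_intro fun {Δ} _ a ha' => show Δ ⊢ pairMem i a s →ᶠ
        bex X (ball (X + 1) (pairMem (i + 2) 0 (s + 2) →ᶠ 0 ≡ᶠ 1) ∧ᶠ (a + 1) ≡ᶠ 0) from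
      imp_intro fun {Δ} _ ha => Derives.obtain_mem (h.up.right.ball_elim (h.up.seq_dom ha).left)
        fun {Δ} _ c hc (hc' : Δ ⊢ pairMem i c s ∧ᶠ ball X (pairMem (i + 1) 0 (s + 1) →ᶠ
          0 ≡ᶠ (c + 1))) => bex_intro c hc (.andI hc'.right
            (Derives.mp (φ := pairMem i a s) (hc'.right.ball_elim ha'.up) ha.up))
  have ha' : Γ ⊢ pairMem i a s →ᶠ bex X (ball (X + 1) (pairMem (i + 2) 0 (s + 2) →ᶠ 0 ≡ᶠ 1) ∧ᶠ
    (a + 1) ≡ᶠ 0) := (key ha).ball_elim (h.seq_dom ha).right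
  (ha'.mp ha).obtain_mem fun {Δ} _ c _ (hc' : Δ ⊢ ball X (pairMem (i + 1) 0 (s + 1) →ᶠ
      0 ≡ᶠ (c + 1)) ∧ᶠ a ≡ᶠ c) =>
    have hb' : Δ ⊢ pairMem i b s →ᶠ b ≡ᶠ c := hc'.left.ball_elim (h.seq_dom hb).right.up
    hc'.right.trans (hb'.mp hb.up).symm

theorem isSeq_intro {s n X : ℕ}
    (h₁ : ∀ {Δ} [Step Γ Δ] p, (Δ ⊢ p ∈ᶠ s) → (Δ ⊢ bex n (bex (X + 1) (isOPair (p + 2) 1 0))))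
    (h₂ : ∀ {Δ} [Step Γ Δ] i, (Δ ⊢ i ∈ᶠ n) → (Δ ⊢ bex X (pairMem (i + 1) 0 (s + 1))))
    (h₃ : ∀ {Δ} [Step Γ Δ] i a b, (Δ ⊢ pairMem i a s) → (Δ ⊢ pairMem i b s) → (Δ ⊢ a ≡ᶠ b)) :
    Γ ⊢ isSeq s n X :=
  have h₃ := fun i a b => imp_intro₂ (h₃ i a b)
  .andI (ball_intro h₁) (ball_intro fun {Δ} _ i hi => Derives.obtain_mem (h₂ i hi)
    fun {Δ} _ a ha (hp : Δ ⊢ pairMem i a s) => bex_intro a ha (show Δ ⊢ pairMem i a s ∧ᶠ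
      ball X (pairMem (i + 1) 0 (s + 1) →ᶠ 0 ≡ᶠ (a + 1)) from .andI hp (ball_intro
        fun {Δ} _ b hb => show Δ ⊢ pairMem i b s →ᶠ b ≡ᶠ a from imp_intro fun hp' =>
          (h₃ i b a).up.mp₂ hp' hp.up)))

theorem Derives.seq_mono {s n X Y : ℕ} (h : Γ ⊢ isSeq s n X) (hs : Γ ⊢ sub X Y) :
    Γ ⊢ isSeq s n Y :=
  isSeq_intro (fun p hp => h.up.seq_mem hp fun i a hi ha h' =>
      bex_intro i hi (bex_intro a (hs.up.sub_elim ha) h'))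
    (fun i hi => h.up.seq_val hi fun a ha h' => bex_intro a (hs.up.sub_elim ha) h')
    fun i a b h₁ h₂ => h.up.seq_unique h₁ h₂

theorem Derives.empty_seq {s n X : ℕ} (hn : Γ ⊢ isEmpty n) (hs : Γ ⊢ isEmpty s) :
    Γ ⊢ isSeq s n X :=
  isSeq_intro (fun _ hp => hs.up.isEmpty_elim hp) (fun _ hi => hn.up.isEmpty_elim hi)
    fun _ _ _ h _ => h.obtain_pair fun _ hp _ => hs.up.isEmpty_elim hp

theorem Derives.seq_empty {s n X : ℕ} (h : Γ ⊢ isSeq s n X) (hn : Γ ⊢ isEmpty n) :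
    Γ ⊢ isEmpty s :=
  isEmpty_intro fun _ hp => h.up.seq_mem hp fun _ _ hi _ _ => hn.up.isEmpty_elim hi

/-! ### Extending a sequence by one term -/

theorem exists_snoc (s n a : ℕ) (k : ∀ {Δ} [Step Γ Δ] t, (Δ ⊢ isSnoc t s n a) → (Δ ⊢ χ)) :
    Γ ⊢ χ :=
  Derives.obtain (Γ := Γ) (φ := isSnoc 0 (s + 1) (n + 1) (a + 1))
    (exists_opair n a fun p hp => exists_insert s p fun t ht => .exI t (.andI
      (sub_intro fun z hz => (ht z).up.iff_mpr (.orI₁ hz))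
      (.andI (pairMem_intro p ((ht p).iff_mpr (.orI₂ (.eqI p))) hp.up)
        (ball_intro fun z hz => ((ht z).up.iff_mp hz).cases (fun hz => .orI₁ hz)
          fun e => .orI₂ (e.symm.subst (isOPair 0 (n + 1) (a + 1)) hp.up))))) k

theorem Derives.snoc_mem {t s n a p : ℕ} (h : Γ ⊢ isSnoc t s n a) (hp : Γ ⊢ p ∈ᶠ t) :
    Γ ⊢ p ∈ᶠ s ∨ᶠ isOPair p n a := h.right.right.ball_elim hp

theorem Derives.snoc_pair {t s n a i b : ℕ} (h : Γ ⊢ isSnoc t s n a) (hp : Γ ⊢ pairMem i b t) :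
    Γ ⊢ pairMem i b s ∨ᶠ i ≡ᶠ n ∧ᶠ b ≡ᶠ a :=
  hp.obtain_pair fun p hp hp' => (h.up.snoc_mem hp).cases
    (fun h => .orI₁ (pairMem_intro p h hp'.up))
    fun h => .orI₂ (.andI (hp'.up.opair_fst h) (hp'.up.opair_snd h))

theorem Derives.snoc_sub {t t' s n a : ℕ} (h : Γ ⊢ isSnoc t s n a) (h' : Γ ⊢ isSnoc t' s n a) :
    Γ ⊢ sub t t' :=
  sub_intro fun _ hp => (h.up.snoc_mem hp).cases (fun hp => h'.up.left.sub_elim hp)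
    fun hp => h'.up.right.left.mem_of_pairMem hp

theorem Derives.snoc_unique {t t' s n a : ℕ} (h : Γ ⊢ isSnoc t s n a) (h' : Γ ⊢ isSnoc t' s n a) :
    Γ ⊢ t ≡ᶠ t' := (h.snoc_sub h').antisymm (h'.snoc_sub h)

/-- The new pair cannot clash with an old one, because the domain of `s` is `n` and `n ∉ n`. -/
theorem Derives.snoc_seq {t s n m a X : ℕ} (h : Γ ⊢ isSnoc t s n a) (hs : Γ ⊢ isSeq s n X)
    (ha : Γ ⊢ a ∈ᶠ X) (hm : Γ ⊢ isSucc m n) : Γ ⊢ isSeq t m X :=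
  isSeq_intro
    (fun p hp => (h.up.snoc_mem hp).cases
      (fun hp => hs.up.seq_mem hp fun i b hi hb h' =>
        bex_intro i (hm.up.sub_succ.sub_elim hi) (bex_intro b hb h'))
      fun hp => bex_intro n hm.up.self_mem_succ (bex_intro a ha.up hp))
    (fun i hi => (hm.up.mem_succ hi).cases
      (fun hi => hs.up.seq_val hi fun b hb h' =>
        bex_intro b hb (h.up.left.pairMem_mono h'))
      fun e => bex_intro a ha.up (e.symm.pairMem_fst h.up.right.left))
    fun i b c hb hc => (h.up.snoc_pair hb).cases
      (fun hb => (h.up.snoc_pair hc.up).cases (fun hc => hs.up.seq_unique hb.up hc)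
        fun e => not_mem_self n (e.left.mem_left (hs.up.seq_dom hb.up).left))
      fun e => (h.up.snoc_pair hc.up).cases
        (fun hc => not_mem_self n (e.up.left.mem_left (hs.up.seq_dom hc).left))
        fun e' => e.up.right.trans e'.right.symm

/-- The initial part consists of the pairs of `t` whose first component lies in `n`, a bounded
condition; the last term is the value at `n`. Together with `Derives.snoc_seq` this describes `Xⁿ⁺¹`
in terms of `Xⁿ`. -/
theorem Derives.seq_restrict {t n m X : ℕ} (h : Γ ⊢ isSeq t m X) (hm : Γ ⊢ isSucc m n)
    (k : ∀ {Δ} [Step Γ Δ] s a, (Δ ⊢ isSeq s n X) → (Δ ⊢ a ∈ᶠ X) → (Δ ⊢ isSnoc t s n a) →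
      (Δ ⊢ χ)) : Γ ⊢ χ := by
  refine (isSet_separation (φ := bex (n + 1) (bex (X + 2) (isOPair 2 1 0))) t
    (.bex _ (.bex _ (isBounded_isOPair _ _ _)))).isSet_elim fun {Δ} st s hs => ?_
  replace hs : ∀ p, Δ ⊢ p ∈ᶠ s ↔ᶠ p ∈ᶠ t ∧ᶠ bex n (bex (X + 1) (isOPair (p + 2) 1 0)) := hs
  have hst : Δ ⊢ sub s t := sub_intro fun p hp => ((hs p).up.iff_mp hp).left
  have hseq : Δ ⊢ isSeq s n X := by
    refine isSeq_intro (fun p hp => ((hs p).up.iff_mp hp).right)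
      (fun i hi => h.up.seq_val (hm.up.sub_succ.sub_elim hi) fun a ha hp =>
        hp.obtain_pair fun p hp hp' => ?_) ?_
    · exact bex_intro a ha.up (pairMem_intro p ((hs p).up.iff_mpr
        (.andI hp (bex_intro i hi.up (bex_intro a ha.up hp')))) hp')
    · exact fun i a b ha hb => h.up.seq_unique (hst.up.pairMem_mono ha) (hst.up.pairMem_mono hb)
  refine h.up.seq_val hm.up.self_mem_succ fun {Θ} st' a ha hp => ?_
  have := step_trans st st'
  refine k s a hseq.up ha (.andI hst.up (.andI hp (ball_intro fun {Θ'} _ q hq => ?_)))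
  show Θ' ⊢ q ∈ᶠ s ∨ᶠ isOPair q n a
  refine h.up.seq_mem hq fun i b hi hb hq' => (hm.up.mem_succ hi).cases (fun hi => ?_) fun e => ?_
  · exact .orI₁ ((hs q).up.iff_mpr (.andI hq.up (bex_intro i hi (bex_intro b hb.up hq'.up))))
  · have hq'' : _ ⊢ isOPair q n b := e.subst (isOPair (q + 1) 0 (b + 1)) hq'.up
    have e' : _ ⊢ b ≡ᶠ a := h.up.seq_unique (pairMem_intro q hq.up hq'') hp.up
    exact .orI₂ (e'.subst (isOPair (q + 1) (n + 1) 0) hq'')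

theorem isSet_snoc (s n a : ℕ) : Γ ⊢ isSet (isSnoc 0 (s + 1) (n + 1) (a + 1)) :=
  exists_snoc s n a fun t ht => isSet_of_unique t ht fun _ hz => Derives.snoc_unique hz ht.up

/-- For a natural number `n`, the sequences of length `n` form a set. -/
theorem isSet_seq {w n : ℕ} (hw : Γ ⊢ isOmega w) (hn : Γ ⊢ n ∈ᶠ w) (X : ℕ) :
    Γ ⊢ isSet (isSeq 0 (n + 1) (X + 1)) := by
  have hinst : ∀ n, (isSet (isSeq 0 1 (X + 2))).inst n = isSet (isSeq 0 (n + 1) (X + 1)) :=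
    fun n => isSet_inst _ n
  rw [← hinst]
  refine omega_induction (isSet (isSeq 0 1 (X + 2))) (w := w) hw (fun {Δ} _ e he => ?_)
    (fun {Δ} _ n m hn hm ih => ?_) hn
  · rw [hinst]
    exact isSet_of_unique e (he.empty_seq he) fun {Δ} _ z (hz : Δ ⊢ isSeq z e X) =>
      (hz.seq_empty he.up).empty_unique he.up
  · rw [hinst] at ih ⊢
    refine ih.isSet_elim fun {Δ} _ E hE => ?_
    replace hE : ∀ s, Δ ⊢ s ∈ᶠ E ↔ᶠ isSeq s n X := hE
    -- `Xⁿ⁺¹` is the union, over `s ∈ Xⁿ` and `a ∈ X`, of the singletons of `s` followed by `a`; no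
    -- exponentiation is needed.
    refine Derives.isSet_congr (φ := bex (E + 1) (bex (X + 2) (isSnoc 2 1 (n + 3) 0)))
      (isSet_bex _ _ fun s hs => isSet_bex X (isSnoc 1 (s + 2) (n + 2) 0) fun a ha =>
        isSet_snoc s n a) (fun t ht => ?_) fun {Θ} _ t (ht : Θ ⊢ isSeq t m X) => ?_
    · exact Derives.obtain_mem ht fun s hs ht => Derives.obtain_mem ht
        fun {Θ} _ a ha (ht : Θ ⊢ isSnoc t s n a) =>
          ht.snoc_seq ((hE s).up.iff_mp hs.up) ha hm.up
    · exact ht.seq_restrict hm.up fun s a hs ha h =>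
        bex_intro s ((hE s).up.iff_mpr hs) (bex_intro a ha h)

/-! ### Substitution for two variables -/

theorem Derives.of_eq (h : Γ ⊢ φ) (e : φ = ψ) : Γ ⊢ ψ := e ▸ h

/-- Replacing the variables `0` and `1` by `a` and `b`. -/
def Fml.inst₂ (φ : Fml) (a b : ℕ) : Fml := φ.rename (cons a (cons b fun n => n))

theorem Derives.inst₂_left {z z' x : ℕ} (h : Γ ⊢ ρ.inst₂ z x) (e : Γ ⊢ z ≡ᶠ z') :
    Γ ⊢ ρ.inst₂ z' x := by
  have key : ∀ z, (ρ.rename (cons 0 (cons (x + 1) (· + 1)))).inst z = ρ.inst₂ z x := fun z => by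
    rw [Fml.inst, Fml.rename_rename, Fml.inst₂]
    exact Fml.rename_ext _ (by rintro (_ | _ | n) <;> rfl)
  rw [← key] at h ⊢
  exact e.subst _ h

theorem Derives.inst₂_right {z x x' : ℕ} (h : Γ ⊢ ρ.inst₂ z x) (e : Γ ⊢ x ≡ᶠ x') :
    Γ ⊢ ρ.inst₂ z x' := by
  have key : ∀ x, (ρ.rename (cons (z + 1) (cons 0 (· + 1)))).inst x = ρ.inst₂ z x := fun x => by
    rw [Fml.inst, Fml.rename_rename, Fml.inst₂]
    exact Fml.rename_ext _ (by rintro (_ | _ | n) <;> rfl)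
  rw [← key] at h ⊢
  exact e.subst _ h

/-! ### Functions -/

theorem isFun_intro {f d : ℕ}
    (h₁ : ∀ {Δ} [Step Γ Δ] p, (Δ ⊢ p ∈ᶠ f) → (Δ ⊢ bex d (.ex (isOPair (p + 2) 1 0))))
    (h₂ : ∀ {Δ} [Step Γ Δ] i, (Δ ⊢ i ∈ᶠ d) → (Δ ⊢ .ex (pairMem (i + 1) 0 (f + 1))))
    (h₃ : ∀ {Δ} [Step Γ Δ] i a b, (Δ ⊢ pairMem i a f) → (Δ ⊢ pairMem i b f) → (Δ ⊢ a ≡ᶠ b)) :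
    Γ ⊢ isFun f d :=
  have h₃ := fun i a b => imp_intro₂ (h₃ i a b)
  .andI (ball_intro h₁) (ball_intro fun {Δ} _ i hi => Derives.obtain (h₂ i hi)
    fun {Δ} _ a (hp : Δ ⊢ pairMem i a f) => .exI a (show Δ ⊢ pairMem i a f ∧ᶠ
      .all (pairMem (i + 1) 0 (f + 1) →ᶠ 0 ≡ᶠ (a + 1)) from .andI hp (.all_intro
        fun b => show Δ ⊢ pairMem i b f →ᶠ b ≡ᶠ a from imp_intro fun hp' =>
          (h₃ i b a).up.mp₂ hp' hp.up)))

theorem Derives.fun_dom {f d i a : ℕ} (h : Γ ⊢ isFun f d) (hp : Γ ⊢ pairMem i a f) : Γ ⊢ i ∈ᶠ d :=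
  hp.obtain_pair fun p hp hp' => Derives.obtain_mem (h.up.left.ball_elim hp) fun j hj h' =>
    Derives.obtain h' fun {Δ} _ b (h' : Δ ⊢ isOPair p j b) =>
      (h'.opair_fst hp'.up).mem_left hj.up

theorem Derives.fun_val {f d i : ℕ} (h : Γ ⊢ isFun f d) (hi : Γ ⊢ i ∈ᶠ d)
    (k : ∀ {Δ} [Step Γ Δ] a, (Δ ⊢ pairMem i a f) → (Δ ⊢ χ)) : Γ ⊢ χ :=
  Derives.obtain (h.right.ball_elim hi) fun a h' => k a (Derives.left h')

theorem Derives.fun_unique {f d i a b : ℕ} (h : Γ ⊢ isFun f d) (ha : Γ ⊢ pairMem i a f)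
    (hb : Γ ⊢ pairMem i b f) : Γ ⊢ a ≡ᶠ b :=
  Derives.obtain (h.right.ball_elim (h.fun_dom ha)) fun {Δ} _ c (hc : Δ ⊢ pairMem i c f ∧ᶠ
    .all (pairMem (i + 1) 0 (f + 1) →ᶠ 0 ≡ᶠ (c + 1))) =>
    have h' : ∀ a, Δ ⊢ pairMem i a f →ᶠ a ≡ᶠ c := hc.right.spec
    ((h' a).mp ha.up).trans ((h' b).mp hb.up).symm

/-- Replacement: a class function on a set is a set. In `ψ(y, x)`, the argument `x` is the
variable `1` and the value `y` is the variable `0`. -/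
theorem exists_fun (ψ : Fml) (a : ℕ)
    (h : ∀ {Δ} [Step Γ Δ] x, (Δ ⊢ x ∈ᶠ a) → (Δ ⊢ .ex (ψ.rename (cons 0 (cons (x + 1) (· + 1))))))
    (hu : ∀ {Δ} [Step Γ Δ] x y y', (Δ ⊢ x ∈ᶠ a) → (Δ ⊢ ψ.inst₂ y x) → (Δ ⊢ ψ.inst₂ y' x) →
      (Δ ⊢ y ≡ᶠ y'))
    (k : ∀ {Δ} [Step Γ Δ] f, (∀ x y, Δ ⊢ pairMem x y f ↔ᶠ x ∈ᶠ a ∧ᶠ ψ.inst₂ y x) →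
      (Δ ⊢ isFun f a) → (Δ ⊢ χ)) : Γ ⊢ χ := by
  have hu := fun x y y' => imp_intro₃ (hu x y y')
  have hinst : ∀ x y, (ψ.rename (cons 0 (cons (x + 1) (· + 1)))).inst y = ψ.inst₂ y x := by
    intro x y
    rw [Fml.inst, Fml.rename_rename, Fml.inst₂]
    exact Fml.rename_ext _ (by rintro (_ | _ | n) <;> rfl)
  have hinst₁ : ∀ x, (Fml.ex (ψ.rename (cons 0 (cons 1 (· + 3))) ∧ᶠ isOPair 2 1 0)).rename
      (cons (x + 1) (cons 0 (· + 1))) =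
        .ex (ψ.rename (cons 0 (cons (x + 2) (· + 2))) ∧ᶠ isOPair 1 (x + 2) 0) := by
    intro x
    simp only [Fml.rename, Fml.rename_rename]
    rw [Fml.rename_ext ψ (g := cons 0 (cons (x + 2) (· + 2))) (by rintro (_ | _ | n) <;> rfl)]
    rfl
  have hinst₂ : ∀ x p, (Fml.ex (ψ.rename (cons 0 (cons (x + 2) (· + 2))) ∧ᶠ
      isOPair 1 (x + 2) 0)).inst p =
        .ex (ψ.rename (cons 0 (cons (x + 1) (· + 1))) ∧ᶠ isOPair (p + 1) (x + 1) 0) := by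
    intro x p
    simp only [Fml.inst, Fml.rename, Fml.rename_rename]
    rw [Fml.rename_ext ψ (g := cons 0 (cons (x + 1) (· + 1))) (by rintro (_ | _ | n) <;> rfl)]
    rfl
  have intro_pair : ∀ {Δ x y p}, (Δ ⊢ ψ.inst₂ y x) → (Δ ⊢ isOPair p x y) →
      (Δ ⊢ (Fml.ex (ψ.rename (cons 0 (cons (x + 2) (· + 2))) ∧ᶠ isOPair 1 (x + 2) 0)).inst p) := by
    intro Δ x y p h h'
    rw [hinst₂]
    exact .exI y (.andI (h.of_eq (hinst x y).symm) h')
  have elim_pair : ∀ {Δ x p χ},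
      (Δ ⊢ (Fml.ex (ψ.rename (cons 0 (cons (x + 2) (· + 2))) ∧ᶠ isOPair 1 (x + 2) 0)).inst p) →
      (∀ {Θ} [Step Δ Θ] y, (Θ ⊢ ψ.inst₂ y x) → (Θ ⊢ isOPair p x y) → (Θ ⊢ χ)) → (Δ ⊢ χ) := by
    intro Δ x p χ h k
    rw [hinst₂] at h
    exact h.obtain fun y h => k y ((Derives.left h).of_eq (hinst x y)) (Derives.right h)
  -- The graph is the union over `x ∈ a` of the singletons of the pairs `⟨x, y⟩` with `ψ(y, x)`;
  -- uniqueness of `y` makes each of these a singleton.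
  refine Derives.isSet_elim (Γ := Γ)
    (isSet_bex a (.ex (ψ.rename (cons 0 (cons 1 (· + 3))) ∧ᶠ isOPair 2 1 0)) fun {Δ} _ x hx => ?_)
    fun {Δ} _ f hf => ?_
  · rw [hinst₁]
    refine (h x hx).obtain fun {Θ} _ y hy => ?_
    rw [hinst] at hy
    refine exists_opair x y fun {Θ} _ p hp => isSet_of_unique p (intro_pair hy.up hp)
      fun {Θ} _ q hq => elim_pair hq fun {Θ} _ y' hy' hq' => ?_
    have e : Θ ⊢ y' ≡ᶠ y := (hu x y' y).up.mp₃ hx.up hy' hy.up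
    exact (e.subst (isOPair (q + 1) (x + 1) 0) hq').opair_unique hp.up
  have hinst₃ : ∀ p x, ((Fml.ex (ψ.rename (cons 0 (cons 1 (· + 3))) ∧ᶠ
      isOPair 2 1 0)).rename (lift (cons p fun n => n))).inst x = (Fml.ex (ψ.rename
        (cons 0 (cons (x + 2) (· + 2))) ∧ᶠ isOPair 1 (x + 2) 0)).inst p := by
    intro p x
    rw [← hinst₁, Fml.inst, Fml.inst, Fml.rename_rename, Fml.rename_rename]
    exact Fml.rename_ext _ (by rintro (_ | _ | n) <;> rfl)
  have hmem : ∀ p, Δ ⊢ p ∈ᶠ f ↔ᶠ bex a ((Fml.ex (ψ.rename (cons 0 (cons 1 (· + 3))) ∧ᶠ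
      isOPair 2 1 0)).rename (lift (cons p fun n => n))) := hf
  have mem_intro : ∀ {Θ} [Ext Δ Θ] {p x y}, (Θ ⊢ x ∈ᶠ a) → (Θ ⊢ ψ.inst₂ y x) →
      (Θ ⊢ isOPair p x y) → (Θ ⊢ p ∈ᶠ f) := fun {Θ} _ {p x y} hx hy hp =>
    (hmem p).up.iff_mpr (bex_intro x hx ((intro_pair hy hp).of_eq (hinst₃ p x).symm))
  have elim_mem : ∀ {Θ} [Ext Δ Θ] {p χ}, (Θ ⊢ p ∈ᶠ f) → (∀ {Ξ} [Step Θ Ξ] x y, (Ξ ⊢ x ∈ᶠ a) →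
      (Ξ ⊢ ψ.inst₂ y x) → (Ξ ⊢ isOPair p x y) → (Ξ ⊢ χ)) → (Θ ⊢ χ) := by
    intro Θ _ p χ hp k
    refine ((hmem p).up.iff_mp hp).obtain_mem fun {Ξ} st x hx h => ?_
    exact elim_pair (h.of_eq (hinst₃ p x)) fun {Ξ'} st' y h h' =>
      have := step_trans st st'; k x y hx.up h h'
  have hpair : ∀ x y, Δ ⊢ pairMem x y f ↔ᶠ x ∈ᶠ a ∧ᶠ ψ.inst₂ y x := fun x y =>
    iff_intro (fun {Θ} _ hp => hp.obtain_pair fun {Θ} _ p hp hp' =>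
      elim_mem hp fun {Θ} _ x' y' hx' hy' hp'' => by
        have ex : Θ ⊢ x' ≡ᶠ x := hp''.opair_fst hp'.up
        have ey : Θ ⊢ y' ≡ᶠ y := hp''.opair_snd hp'.up
        exact .andI (ex.mem_left hx') ((hy'.inst₂_left ey).inst₂_right ex))
      fun {Θ} _ hp => exists_opair x y fun {Θ} _ p hp' =>
        pairMem_intro p (mem_intro hp.up.left hp.up.right hp') hp'
  refine k f hpair (isFun_intro (fun {Θ} _ p hp => ?_) (fun {Θ} _ x hx => ?_)
    fun {Θ} _ x y y' hy hy' => ?_)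
  · exact elim_mem hp fun x y hx _ hp => bex_intro x hx (.exI y hp)
  · refine Derives.obtain ((imp_intro (h x)).up.mp hx) fun {Θ} _ y hy => .exI y ?_
    exact (hpair x y).up.iff_mpr (.andI hx.up (hy.of_eq (hinst x y)))
  · have hy := (hpair x y).up.iff_mp hy
    exact (hu x y y').up.mp₃ hy.left hy.right ((hpair x y').up.iff_mp hy').right

/-! ### Recursion -/

/-- `∃ γ ∈ β, ∃ z, ⟨γ, z⟩ ∈ f ∧ ρ(z, x)`. -/
def recBody (ρ : Fml) (f β x : ℕ) : Fml :=
  bex β (.ex (pairMem 1 0 (f + 2) ∧ᶠ ρ.rename (cons 0 (cons (x + 2) (· + 2)))))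

theorem recBody_intro {f β x γ z : ℕ} (hγ : Γ ⊢ γ ∈ᶠ β) (hz : Γ ⊢ pairMem γ z f)
    (hx : Γ ⊢ ρ.inst₂ z x) : Γ ⊢ recBody ρ f β x := by
  refine bex_intro γ hγ (.exI z (.andI hz ?_))
  refine hx.of_eq ?_
  rw [Fml.rename_rename, Fml.rename_rename]
  exact Fml.rename_ext _ (by rintro (_ | _ | n) <;> rfl)

theorem Derives.recBody_obtain {f β x : ℕ} (h : Γ ⊢ recBody ρ f β x)
    (k : ∀ {Δ} [Step Γ Δ] γ z, (Δ ⊢ γ ∈ᶠ β) → (Δ ⊢ pairMem γ z f) → (Δ ⊢ ρ.inst₂ z x) →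
      (Δ ⊢ χ)) : Γ ⊢ χ := by
  refine Derives.obtain_mem h fun {Δ} st γ hγ h => Derives.obtain h fun {Θ} st' z h => ?_
  have := step_trans st st'
  refine k γ z hγ.up (Derives.left h) ((Derives.right h).of_eq ?_)
  rw [Fml.rename_rename, Fml.rename_rename]
  exact Fml.rename_ext _ (by rintro (_ | _ | n) <;> rfl)

theorem Derives.recBody_mono {f g β γ x : ℕ} (h : Γ ⊢ recBody ρ f β x)
    (hb : Γ ⊢ sub β γ) (hs : Γ ⊢ sub f g) : Γ ⊢ recBody ρ g γ x :=
  h.recBody_obtain fun δ z hδ hz hx =>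
    recBody_intro (hb.up.sub_elim hδ) (hs.up.pairMem_mono hz) hx

/-- A union over `γ ∈ β` of the sets `{x | ρ(f(γ), x)}`; the quantifier over the value `z`
disappears because `f(γ)` is unique. -/
theorem isSet_recBody {f β : ℕ} (hf : Γ ⊢ isFun f β)
    (hρ : ∀ z, Γ ⊢ isSet (ρ.rename (cons (z + 1) (cons 0 (· + 1))))) :
    Γ ⊢ isSet (recBody (ρ.rename (lift (lift (· + 1)))) (f + 1) (β + 1) 0) := by
  refine isSet_bex β _ fun {Δ} _ γ hγ => hf.up.fun_val hγ fun {Δ} _ z hz => ?_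
  refine (hρ z).up.isSet_congr (fun {Δ} _ x hx => .exI z (.andI hz.up ?_)) fun {Δ} _ x hx =>
    Derives.obtain hx fun {Δ} _ z' h => ?_
  · refine hx.of_eq ?_
    simp only [Fml.inst, Fml.rename_rename]
    exact Fml.rename_ext _ (by rintro (_ | _ | n) <;> rfl)
  · have hz' : Δ ⊢ pairMem γ z' f := Derives.left h
    have e : Δ ⊢ z' ≡ᶠ z := hf.up.fun_unique hz' hz.up
    have h' : Δ ⊢ ρ.inst₂ z' x := (Derives.right h).of_eq (by
      simp only [Fml.inst₂, Fml.rename_rename]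
      exact Fml.rename_ext _ (by rintro (_ | _ | n) <;> rfl))
    refine (h'.inst₂_left e).of_eq ?_
    simp only [Fml.inst₂, Fml.inst, Fml.rename_rename]
    exact Fml.rename_ext _ (by rintro (_ | _ | n) <;> rfl)

theorem recBody_inst (ρ : Fml) (f β x : ℕ) :
    (recBody (ρ.rename (lift (lift (· + 1)))) (f + 1) (β + 1) 0).inst x = recBody ρ f β x := by
  simp only [recBody, bex, Fml.inst, Fml.rename, Fml.rename_rename]
  rw [Fml.rename_ext ρ (g := cons 0 (cons (x + 2) (· + 2))) (by rintro (_ | _ | n) <;> rfl)]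
  rfl

/-- `f(β) = {x | ∃ γ ∈ β, ρ(f(γ), x)}` for all `β` in the domain of `f`. -/
def isRecursion (ρ : Fml) (f : ℕ) : Fml :=
  .all (.all (pairMem 1 0 (f + 2) →ᶠ
    .all (0 ∈ᶠ 1 ↔ᶠ recBody (ρ.rename (lift (lift (· + 3)))) (f + 3) 2 0)))

theorem isRecursion_intro {f : ℕ} (h : ∀ {Δ} [Step Γ Δ] β y x, (Δ ⊢ pairMem β y f) →
    (Δ ⊢ x ∈ᶠ y ↔ᶠ recBody ρ f β x)) : Γ ⊢ isRecursion ρ f := by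
  refine .all_intro fun β => .all_intro fun y => imp_intro fun {Δ} _ hp => .all_intro fun x => ?_
  have h' := h β y x hp
  refine h'.of_eq (Eq.symm ?_)
  simp only [recBody, bex, Fml.iff, Fml.inst, Fml.rename, Fml.rename_rename]
  rw [Fml.rename_ext ρ (g := cons 0 (cons (x + 2) (· + 2))) (by rintro (_ | _ | n) <;> rfl)]
  rfl

theorem Derives.recursion_mem {f β y : ℕ} (h : Γ ⊢ isRecursion ρ f) (hp : Γ ⊢ pairMem β y f)
    (x : ℕ) : Γ ⊢ x ∈ᶠ y ↔ᶠ recBody ρ f β x := by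
  refine (Derives.spec (Derives.mp (Derives.spec (Derives.spec h β) y) hp) x).of_eq ?_
  simp only [recBody, bex, Fml.iff, Fml.inst, Fml.rename, Fml.rename_rename]
  rw [Fml.rename_ext ρ (f := fun n => _) (g := cons 0 (cons (x + 2) (· + 2))) (by rintro (_ | _ | n) <;> rfl)]
  rfl

/-- `y` is the value at `α` of the function defined by the recursion `isRecursion`. -/
def isRec (ρ : Fml) (α y : ℕ) : Fml :=
  .ex (.ex (isOrd 1 ∧ᶠ isFun 0 1 ∧ᶠ (α + 2) ∈ᶠ 1 ∧ᶠ pairMem (α + 2) (y + 2) 0 ∧ᶠ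
    isRecursion (ρ.rename (lift (lift (· + 2)))) 0))

theorem rename_isRecursion (ρ : Fml) (n : ℕ) (f : ℕ → ℕ) :
    (isRecursion ρ n).rename f = isRecursion (ρ.rename (lift (lift f))) (f n) := by
  simp only [isRecursion, recBody, bex, Fml.iff, Fml.rename, Fml.rename_rename]
  rw [Fml.rename_ext ρ (g := cons 0 (cons 2 fun n => f n + 5)) (by rintro (_ | _ | n) <;> rfl),
    Fml.rename_ext ρ (f := fun m => (cons 0 (cons (0 + 2) fun x => x + 2) _))
      (g := cons 0 (cons 2 fun n => f n + 5)) (by rintro (_ | _ | n) <;> rfl)]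
  rfl

theorem rename_isRec (ρ : Fml) (α y : ℕ) (f : ℕ → ℕ) :
    (isRec ρ α y).rename f = isRec (ρ.rename (lift (lift f))) (f α) (f y) := by
  simp only [isRec, Fml.rename, rename_isRecursion, Fml.rename_rename]
  rw [Fml.rename_ext ρ (g := lift (lift fun n => f n + 2)) (by rintro (_ | _ | n) <;> rfl),
    Fml.rename_ext ρ (f := fun n => lift (lift (· + 2)) _)
      (g := lift (lift fun n => f n + 2)) (by rintro (_ | _ | n) <;> rfl)]
  rfl

theorem isRec_intro {d f α y : ℕ} (hd : Γ ⊢ isOrd d) (hf : Γ ⊢ isFun f d) (hα : Γ ⊢ α ∈ᶠ d)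
    (hy : Γ ⊢ pairMem α y f) (hr : Γ ⊢ isRecursion ρ f) : Γ ⊢ isRec ρ α y := by
  have : (isOrd 1 ∧ᶠ isFun 0 1 ∧ᶠ (α + 2) ∈ᶠ 1 ∧ᶠ pairMem (α + 2) (y + 2) 0 ∧ᶠ
      isRecursion (ρ.rename (lift (lift (· + 2)))) 0).rename (cons f (cons d fun n => n)) =
      (isOrd d ∧ᶠ isFun f d ∧ᶠ α ∈ᶠ d ∧ᶠ pairMem α y f ∧ᶠ isRecursion ρ f) := by
    simp only [Fml.rename, rename_isRecursion, Fml.rename_rename]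
    rw [Fml.rename_ext ρ (g := fun n => n) (by rintro (_ | _ | n) <;> rfl), Fml.rename_id]
    rfl
  refine .exI d (.exI f ?_)
  rw [Fml.inst, Fml.rename_rename, Fml.rename_ext _ (g := cons f (cons d fun n => n))
    (by rintro (_ | _ | n) <;> rfl), this]
  exact .andI hd (.andI hf (.andI hα (.andI hy hr)))

theorem Derives.rec_obtain {α y : ℕ} (h : Γ ⊢ isRec ρ α y)
    (k : ∀ {Δ} [Step Γ Δ] d f, (Δ ⊢ isOrd d) → (Δ ⊢ isFun f d) → (Δ ⊢ α ∈ᶠ d) →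
      (Δ ⊢ pairMem α y f) → (Δ ⊢ isRecursion ρ f) → (Δ ⊢ χ)) : Γ ⊢ χ := by
  refine Derives.obtain h fun {Δ} st d h => Derives.obtain h fun {Θ} st' f h => ?_
  have := step_trans st st'
  have e : (isOrd 1 ∧ᶠ isFun 0 1 ∧ᶠ (α + 2) ∈ᶠ 1 ∧ᶠ pairMem (α + 2) (y + 2) 0 ∧ᶠ
      isRecursion (ρ.rename (lift (lift (· + 2)))) 0).rename (cons f (cons d fun n => n)) =
      (isOrd d ∧ᶠ isFun f d ∧ᶠ α ∈ᶠ d ∧ᶠ pairMem α y f ∧ᶠ isRecursion ρ f) := by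
    simp only [Fml.rename, rename_isRecursion, Fml.rename_rename]
    rw [Fml.rename_ext ρ (g := fun n => n) (by rintro (_ | _ | n) <;> rfl), Fml.rename_id]
    rfl
  rw [Fml.inst, Fml.rename_rename, Fml.rename_ext _ (g := cons f (cons d fun n => n))
    (by rintro (_ | _ | n) <;> rfl), e] at h
  exact k d f h.left h.right.left h.right.right.left h.right.right.right.left
    h.right.right.right.right

/-- Functions defined by the same recursion agree. -/
theorem Derives.recursion_unique {f d g e α : ℕ} (hf : Γ ⊢ isFun f d) (hg : Γ ⊢ isFun g e)
    (hd : Γ ⊢ isOrd d) (he : Γ ⊢ isOrd e) (hf' : Γ ⊢ isRecursion ρ f) (hg' : Γ ⊢ isRecursion ρ g)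
    {y z : ℕ} (hy : Γ ⊢ pairMem α y f) (hz : Γ ⊢ pairMem α z g) : Γ ⊢ y ≡ᶠ z := by
  -- Set induction on the argument, for all values at once. Since `d` and `e` are transitive, each
  -- function has a value at every smaller argument at which the other one is defined.
  have key : Γ ⊢ .all (.all (pairMem (α + 2) 1 (f + 2) →ᶠ pairMem (α + 2) 0 (g + 2) →ᶠ 1 ≡ᶠ 0)) := by
    refine set_induction (.all (.all (pairMem 2 1 (f + 3) →ᶠ pairMem 2 0 (g + 3) →ᶠ 1 ≡ᶠ 0)))
      (fun {Δ} _ a ih => .all_intro fun y => .all_intro fun z => ?_) α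
    show Δ ⊢ pairMem a y f →ᶠ pairMem a z g →ᶠ y ≡ᶠ z
    have ih' : ∀ {Θ} [Ext Δ Θ] x y z, (Θ ⊢ x ∈ᶠ a) → (Θ ⊢ pairMem x y f) → (Θ ⊢ pairMem x z g) →
        (Θ ⊢ y ≡ᶠ z) := fun {Θ} _ x y z hx hy hz =>
      have : Θ ⊢ pairMem x y f →ᶠ pairMem x z g →ᶠ y ≡ᶠ z := Derives.spec (Derives.spec (ih x hx) y) z
      this.mp₂ hy hz
    refine imp_intro₂ fun {Θ} _ hy hz => Derives.antisymm (sub_intro fun {Θ} _ x hx => ?_)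
      (sub_intro fun {Θ} _ x hx => ?_)
    · refine ((hf'.up.recursion_mem hy.up x).iff_mp hx).recBody_obtain
        fun {Θ} _ γ u hγ hu hx => ?_
      refine hg.up.fun_val (he.up.ord_trans.isTrans_elim (hg.up.fun_dom hz.up) hγ)
        fun {Θ} _ v hv => ?_
      exact (hg'.up.recursion_mem hz.up x).iff_mpr (recBody_intro hγ.up hv
        (hx.up.inst₂_left (ih' γ u v hγ.up hu.up hv)))
    · refine ((hg'.up.recursion_mem hz.up x).iff_mp hx).recBody_obtain
        fun {Θ} _ γ u hγ hu hx => ?_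
      refine hf.up.fun_val (hd.up.ord_trans.isTrans_elim (hf.up.fun_dom hy.up) hγ)
        fun {Θ} _ v hv => ?_
      exact (hf'.up.recursion_mem hy.up x).iff_mpr (recBody_intro hγ.up hv
        (hx.up.inst₂_left (ih' γ v u hγ.up hv hu.up).symm))
  have key' : Γ ⊢ pairMem α y f →ᶠ pairMem α z g →ᶠ y ≡ᶠ z := (key.spec y).spec z
  exact key'.mp₂ hy hz

theorem Derives.rec_unique {α y z : ℕ} (hy : Γ ⊢ isRec ρ α y) (hz : Γ ⊢ isRec ρ α z) :
    Γ ⊢ y ≡ᶠ z :=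
  hy.rec_obtain fun d f hd hf _ hy hf' => hz.up.rec_obtain fun e g he hg _ hz hg' =>
    Derives.recursion_unique hf.up hg hd.up he hf'.up hg' hy.up hz

theorem Derives.rec_mem {α y γ z x : ℕ} (hy : Γ ⊢ isRec ρ α y) (hγ : Γ ⊢ γ ∈ᶠ α)
    (hz : Γ ⊢ isRec ρ γ z) (hx : Γ ⊢ ρ.inst₂ z x) : Γ ⊢ x ∈ᶠ y :=
  hy.rec_obtain fun d f hd hf hα hy hf' =>
    hf.fun_val (hd.ord_trans.isTrans_elim hα hγ.up) fun u hu =>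
      (hf'.up.recursion_mem hy.up x).iff_mpr (recBody_intro hγ.up hu (hx.up.inst₂_left
        (hz.up.rec_unique (isRec_intro hd.up hf.up (hf.up.fun_dom hu) hu hf'.up))))

theorem Derives.rec_mem_obtain {α y x : ℕ} (hy : Γ ⊢ isRec ρ α y) (hx : Γ ⊢ x ∈ᶠ y)
    (k : ∀ {Δ} [Step Γ Δ] γ z, (Δ ⊢ γ ∈ᶠ α) → (Δ ⊢ isRec ρ γ z) → (Δ ⊢ ρ.inst₂ z x) →
      (Δ ⊢ χ)) : Γ ⊢ χ :=
  hy.rec_obtain fun {_} st d f hd hf hα hy hf' =>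
    ((hf'.recursion_mem hy x).iff_mp hx.up).recBody_obtain fun {_} st' γ z hγ hz hx =>
      have := step_trans st st'
      k γ z hγ (isRec_intro hd.up hf.up (hf.up.fun_dom hz) hz hf'.up) hx

theorem isRec_inst (ρ : Fml) (α y : ℕ) :
    (isRec (ρ.rename (lift (lift (· + 1)))) (α + 1) 0).inst y = isRec ρ α y := by
  rw [Fml.inst, rename_isRec, Fml.rename_rename,
    Fml.rename_ext ρ (g := fun n => n) (by rintro (_ | _ | n) <;> rfl), Fml.rename_id]
  rfl

/-- Functions defined by recursion on the ordinals exist. -/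
theorem exists_rec {α : ℕ} (hα : Γ ⊢ isOrd α)
    (hρ : ∀ z, Γ ⊢ isSet (ρ.rename (cons (z + 1) (cons 0 (· + 1)))))
    (k : ∀ {Δ} [Step Γ Δ] y, (Δ ⊢ isRec ρ α y) → (Δ ⊢ χ)) : Γ ⊢ χ := by
  have hinst : ∀ a, (isOrd 0 →ᶠ .ex (isRec (ρ.rename (lift (lift (· + 2)))) 1 0)).inst a =
      (isOrd a →ᶠ .ex (isRec (ρ.rename (lift (lift (· + 1)))) (a + 1) 0)) := by
    intro a
    simp only [Fml.inst, Fml.rename, rename_isRec, Fml.rename_rename]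
    rw [Fml.rename_ext ρ (g := lift (lift (· + 1))) (by rintro (_ | _ | n) <;> rfl)]
    rfl
  have key : ∀ a, Γ ⊢ isOrd a →ᶠ .ex (isRec (ρ.rename (lift (lift (· + 1)))) (a + 1) 0) := by
    intro a
    rw [← hinst]
    refine set_induction _ (fun {Δ} _ α ih => ?_) a
    rw [hinst]
    have ih : ∀ {Θ} [Ext Δ Θ] β, (Θ ⊢ β ∈ᶠ α) → (Θ ⊢ isOrd β) →
        (Θ ⊢ .ex (isRec (ρ.rename (lift (lift (· + 1)))) (β + 1) 0)) := fun {Θ} _ β hβ hβ' =>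
      ((ih β hβ).of_eq (hinst β)).mp hβ'
    refine imp_intro fun {Δ} _ hα => ?_
    have hinst₂ : ∀ β y, (isRec (ρ.rename (lift (lift (· + 2)))) 1 0).inst₂ y β = isRec ρ β y := by
      intro β y
      rw [Fml.inst₂, rename_isRec, Fml.rename_rename,
        Fml.rename_ext ρ (g := fun n => n) (by rintro (_ | _ | n) <;> rfl), Fml.rename_id]
      rfl
    -- By the induction hypothesis and uniqueness, `β ↦` the value at `β` is a class function on
    -- `α`; replacement turns it into a set function `f₀`.
    refine exists_fun (isRec (ρ.rename (lift (lift (· + 2)))) 1 0) α (fun {Θ} _ β hβ => ?_)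
      (fun {Θ} _ β y z hβ hy hz => ?_) fun {Δ} _ f₀ hf₀ hfun => ?_
    · refine (ih β hβ (hα.up.ord_mem hβ)).of_eq (congrArg Fml.ex ?_)
      rw [rename_isRec, Fml.rename_rename]
      exact congrArg (isRec · (β + 1) 0) (Fml.rename_ext ρ (by rintro (_ | _ | n) <;> rfl))
    · rw [hinst₂] at hy hz
      exact hy.rec_unique hz
    refine (isSet_recBody hfun fun z => (hρ z).up).isSet_elim fun {Δ} _ y₀ hy₀ => ?_
    replace hy₀ : ∀ x, Δ ⊢ x ∈ᶠ y₀ ↔ᶠ recBody ρ f₀ α x := fun x =>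
      (hy₀ x).of_eq (congrArg _ (recBody_inst ρ f₀ α x))
    -- The witness is `f₀ ∪ {⟨α, y₀⟩}` on the domain `α⁺`, with `y₀` computed from `f₀`.
    refine exists_snoc f₀ α y₀ fun {Δ} _ f hf => exists_succ α fun {Δ} _ d hd => ?_
    refine .exI y₀ (Derives.of_eq (isRec_intro (d := d) (f := f) (hα.up.ord_succ hd)
      (isFun_intro (fun p hp => (hf.up.snoc_mem hp).cases
          (fun hp => Derives.obtain_mem (hfun.up.left.ball_elim hp) fun i hi h =>
            bex_intro i (hd.up.sub_succ.sub_elim hi) h)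
          fun hp => bex_intro α hd.up.self_mem_succ (.exI y₀ hp))
        (fun i hi => (hd.up.mem_succ hi).cases
          (fun hi => hfun.up.fun_val hi fun a ha => .exI a (hf.up.left.pairMem_mono ha))
          fun e => .exI y₀ (e.symm.pairMem_fst hf.up.right.left))
        fun i a b ha hb => (hf.up.snoc_pair ha).cases
          (fun ha => (hf.up.snoc_pair hb.up).cases (fun hb => hfun.up.fun_unique ha.up hb)
            fun e => not_mem_self α (e.left.mem_left (hfun.up.fun_dom ha.up)))
          fun e => (hf.up.snoc_pair hb.up).cases
            (fun hb => not_mem_self α (e.up.left.mem_left (hfun.up.fun_dom hb)))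
            fun e' => e.up.right.trans e'.right.symm)
      hd.self_mem_succ hf.up.right.left
      (isRecursion_intro fun {Θ} _ β y x hp => ?_)) (isRec_inst ρ α y₀).symm)
    -- At `β ∈ α` the equation is inherited from the function witnessing the value at `β`, and at
    -- `α` it is the choice of `y₀`. The new pair never enters as an earlier value, because `α ∉ α`.
    refine iff_intro (fun {Θ} _ hx => (hf.up.snoc_pair hp.up).cases (fun {Θ} _ hp => ?_)
      fun {Θ} _ e => ?_) fun {Θ} _ hx => (hf.up.snoc_pair hp.up).cases (fun {Θ} _ hp => ?_)
      fun {Θ} _ e => ?_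
    · have hβ := (hf₀ β y).up.iff_mp hp
      refine (hβ.right.of_eq (hinst₂ β y)).rec_mem_obtain hx.up fun {Θ} _ γ z hγ hz hx => ?_
      exact recBody_intro hγ (hf.up.left.pairMem_mono ((hf₀ γ z).up.iff_mpr
        (.andI (hα.up.ord_trans.isTrans_elim hβ.up.left hγ) (hz.of_eq (hinst₂ γ z).symm)))) hx
    · exact ((hy₀ x).up.iff_mp (e.right.mem_right hx.up)).recBody_mono
        e.left.symm.sub_of_eq hf.up.left
    · have hβ := (hf₀ β y).up.iff_mp hp
      refine hx.up.recBody_obtain fun {Θ} _ γ z hγ hz hx => ?_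
      refine (hf.up.snoc_pair hz).cases (fun {Θ} _ hz => ?_) fun {Θ} _ e =>
        not_mem_self α (hα.up.ord_trans.isTrans_elim hβ.up.left (e.left.mem_left hγ.up))
      have hz := (hf₀ γ z).up.iff_mp hz
      exact (hβ.up.right.of_eq (hinst₂ β y)).rec_mem hγ.up (hz.right.of_eq (hinst₂ γ z)) hx.up
    · refine e.right.symm.mem_right ((hy₀ x).up.iff_mpr ?_)
      refine hx.up.recBody_obtain fun {Θ} _ γ z hγ hz hx => ?_
      have hγ : Θ ⊢ γ ∈ᶠ α := e.left.up.mem_right hγ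
      exact (hf.up.snoc_pair hz).cases (fun hz => recBody_intro hγ.up hz hx.up)
        fun e => not_mem_self α (e.left.mem_left hγ.up)
  exact Derives.obtain ((key α).mp hα) fun y hy => k y (hy.of_eq (isRec_inst ρ α y))

/-- A property that is inherited from the elements of `E` to the `z` with `ρ(E, z)` holds for all
elements of all sets defined by the recursion. -/
theorem rec_induction (φ : Fml)
    (h : ∀ {Δ} [Step Γ Δ] E z, (Δ ⊢ ball E φ) → (Δ ⊢ ρ.inst₂ E z) → (Δ ⊢ φ.inst z)) {α y z : ℕ}
    (hy : Γ ⊢ isRec ρ α y) (hz : Γ ⊢ z ∈ᶠ y) : Γ ⊢ φ.inst z := by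
  have h := fun E z => imp_intro₂ (h E z)
  have hinst : ∀ a, (Fml.all (isRec (ρ.rename (lift (lift (· + 2)))) 1 0 →ᶠ
      ball 0 (φ.rename (cons 0 (· + 3))))).inst a = .all (isRec (ρ.rename (lift (lift (· + 1))))
        (a + 1) 0 →ᶠ ball 0 (φ.rename (cons 0 (· + 2)))) := by
    intro a
    simp only [Fml.inst, ball, Fml.rename, rename_isRec, Fml.rename_rename]
    rw [Fml.rename_ext ρ (g := lift (lift (· + 1))) (by rintro (_ | _ | n) <;> rfl),
      Fml.rename_ext φ (g := cons 0 (· + 2)) (by rintro (_ | _ | n) <;> rfl)]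
    rfl
  have hinst' : ∀ a y, (isRec (ρ.rename (lift (lift (· + 1)))) (a + 1) 0 →ᶠ
      ball 0 (φ.rename (cons 0 (· + 2)))).inst y = (isRec ρ a y →ᶠ ball y φ) := by
    intro a y
    refine congrArg₂ Fml.imp (isRec_inst ρ a y) ?_
    simp only [ball, Fml.rename, Fml.rename_rename]
    rw [Fml.rename_ext φ (g := fun n => n) (by rintro (_ | _ | n) <;> rfl), Fml.rename_id]
    rfl
  have key : ∀ a, Γ ⊢ .all (isRec (ρ.rename (lift (lift (· + 1)))) (a + 1) 0 →ᶠ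
      ball 0 (φ.rename (cons 0 (· + 2)))) := by
    intro a
    rw [← hinst]
    refine set_induction _ (fun {Δ} _ a ih => ?_) a
    rw [hinst]
    refine .all_intro fun y => Derives.of_eq (imp_intro fun {Θ} _ hy =>
      ball_intro fun {Θ} _ z hz => ?_) (hinst' a y).symm
    refine hy.up.rec_mem_obtain hz fun {Θ} _ γ u hγ hu hz => ?_
    have ih := (((ih γ hγ).of_eq (hinst γ)).spec u).of_eq (hinst' γ u)
    exact (h u z).up.mp₂ (ih.mp hu) hz
  exact ((((key α).spec y).of_eq (hinst' α y)).mp hy).ball_elim hz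

theorem Derives.rec_mono {α β y z : ℕ} (hy : Γ ⊢ isRec ρ α y) (hz : Γ ⊢ isRec ρ β z)
    (hs : Γ ⊢ sub α β) : Γ ⊢ sub y z :=
  sub_intro fun x hx => hy.up.rec_mem_obtain hx fun γ u hγ hu hx =>
    hz.up.rec_mem (hs.up.sub_elim hγ) hu hx

/-! ### Renaming of the basic formulas -/

section
variable (f : ℕ → ℕ)

@[simp] theorem rename_ball (y : ℕ) (φ : Fml) :
    (ball y φ).rename f = ball (f y) (φ.rename (lift f)) := rfl

@[simp] theorem rename_bex (y : ℕ) (φ : Fml) :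
    (bex y φ).rename f = bex (f y) (φ.rename (lift f)) := rfl

@[simp] theorem rename_isSucc (y x : ℕ) : (isSucc y x).rename f = isSucc (f y) (f x) := rfl

@[simp] theorem rename_pairMem (a b r : ℕ) :
    (pairMem a b r).rename f = pairMem (f a) (f b) (f r) := rfl

@[simp] theorem rename_isSeq (s n X : ℕ) : (isSeq s n X).rename f = isSeq (f s) (f n) (f X) := rfl

@[simp] theorem rename_isSnoc (t s n a : ℕ) :
    (isSnoc t s n a).rename f = isSnoc (f t) (f s) (f n) (f a) := rfl

end

/-! ### The relation on `Xⁿ` defined by a formula -/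

/-- `z = ⟨n, {s ∈ Xⁿ | ψ(s)}⟩`, where `s` is the variable `0` of `ψ`. -/
def isRel (z n X : ℕ) (ψ : Fml) : Fml :=
  .ex (isOPair (z + 1) (n + 1) 0 ∧ᶠ
    .all (0 ∈ᶠ 1 ↔ᶠ isSeq 0 (n + 2) (X + 2) ∧ᶠ ψ.rename (cons 0 (· + 2))))

@[simp] theorem rename_isRel (f : ℕ → ℕ) (z n X : ℕ) (ψ : Fml) :
    (isRel z n X ψ).rename f = isRel (f z) (f n) (f X) (ψ.rename (lift f)) := by
  simp only [isRel, Fml.iff, Fml.rename, Fml.rename_rename]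
  rw [Fml.rename_ext ψ (g := cons 0 fun n => f n + 2) (by rintro (_ | n) <;> rfl),
    Fml.rename_ext ψ (f := fun n => cons 0 (· + 2) _) (g := cons 0 fun n => f n + 2)
      (by rintro (_ | n) <;> rfl)]
  rfl

theorem rel_body_inst (ψ : Fml) (n X R s : ℕ) :
    ((0 ∈ᶠ 1 ↔ᶠ isSeq 0 (n + 2) (X + 2) ∧ᶠ ψ.rename (cons 0 (· + 2))).rename
      (lift (cons R fun n => n))).inst s = (s ∈ᶠ R ↔ᶠ isSeq s n X ∧ᶠ ψ.inst s) := by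
  simp only [Fml.inst, Fml.iff, Fml.rename, Fml.rename_rename]
  rw [Fml.rename_ext ψ (g := cons s fun n => n) (by rintro (_ | n) <;> rfl)]
  rfl

theorem isRel_intro {z n X : ℕ} (R : ℕ) (hz : Γ ⊢ isOPair z n R)
    (h : ∀ s, Γ ⊢ s ∈ᶠ R ↔ᶠ isSeq s n X ∧ᶠ ψ.inst s) : Γ ⊢ isRel z n X ψ :=
  .exI R (.andI hz (.all_intro fun s => (h s).of_eq (rel_body_inst ψ n X R s).symm))

theorem Derives.rel_obtain {z n X : ℕ} (h : Γ ⊢ isRel z n X ψ)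
    (k : ∀ {Δ} [Step Γ Δ] R, (Δ ⊢ isOPair z n R) →
      (∀ s, Δ ⊢ s ∈ᶠ R ↔ᶠ isSeq s n X ∧ᶠ ψ.inst s) → (Δ ⊢ χ)) : Γ ⊢ χ :=
  Derives.obtain h fun R h => k R (Derives.left h) fun s =>
    (Derives.spec (Derives.right h) s).of_eq (rel_body_inst ψ n X R s)

theorem Derives.rel_unique {z z' n X : ℕ} (h : Γ ⊢ isRel z n X ψ) (h' : Γ ⊢ isRel z' n X ψ) :
    Γ ⊢ z ≡ᶠ z' :=
  h.rel_obtain fun R hR hs => h'.up.rel_obtain fun {Δ} _ R' hR' hs' =>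
    have e : Δ ⊢ R ≡ᶠ R' := eq_of_forall_mem_iff fun s => iff_intro
      (fun h => (hs' s).up.iff_mpr ((hs s).up.iff_mp h))
      fun h => (hs s).up.iff_mpr ((hs' s).up.iff_mp h)
    (e.subst (isOPair (z + 1) (n + 1) 0) hR.up).opair_unique hR'

/-- A bounded `ψ` cuts the relation out of the set `Xⁿ`. All clauses qualify, since their
quantifiers range over `X` and over relations already constructed. -/
theorem exists_rel {w n : ℕ} (hw : Γ ⊢ isOmega w) (hn : Γ ⊢ n ∈ᶠ w) (X : ℕ) (hψ : IsBounded ψ)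
    (k : ∀ {Δ} [Step Γ Δ] z, (Δ ⊢ isRel z n X ψ) → (Δ ⊢ χ)) : Γ ⊢ χ :=
  ((isSet_seq hw hn X).isSet_and hψ).isSet_elim fun {_} st R hR =>
    exists_opair n R fun {Δ} st' z hz => have := step_trans st st'
      k z (isRel_intro R hz fun s =>
        have h : Δ ⊢ s ∈ᶠ R ↔ᶠ ψ.inst s ∧ᶠ isSeq s n X := (hR s).up
        iff_intro (fun hs => .andI (h.up.iff_mp hs).right (h.up.iff_mp hs).left)
          fun hs => h.up.iff_mpr (.andI hs.right hs.left))

theorem isSet_isRel {w n : ℕ} (hw : Γ ⊢ isOmega w) (hn : Γ ⊢ n ∈ᶠ w) (X : ℕ) (hψ : IsBounded ψ) :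
    Γ ⊢ isSet (isRel 0 (n + 1) (X + 1) (ψ.rename (lift (· + 1)))) := by
  have hinst : ∀ z, (isRel 0 (n + 1) (X + 1) (ψ.rename (lift (· + 1)))).inst z = isRel z n X ψ := by
    intro z
    rw [Fml.inst, rename_isRel, Fml.rename_rename,
      Fml.rename_ext ψ (g := fun n => n) (by rintro (_ | n) <;> rfl), Fml.rename_id]
    rfl
  refine exists_rel hw hn X hψ fun z hz => isSet_of_unique z (hz.of_eq (hinst z).symm)
    fun z' hz' => ?_
  rw [hinst] at hz'
  exact hz'.rel_unique hz.up

/-- Passes from the second component `R`, on which `hasRel` quantifies, to the whole pair `z`; `ψ`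
is shifted by two because `hasRel` places it below both `s` and `R`. -/
theorem Derives.hasRel_elim {n X D z : ℕ}
    (h : Γ ⊢ hasRel n X D (ψ.rename (cons 0 (· + 2)))) (hz : Γ ⊢ isRel z n X ψ) : Γ ⊢ z ∈ᶠ D :=
  Derives.obtain hz fun {Δ} _ R hR =>
    have hp : Δ ⊢ pairMem n R D := Derives.mp (Derives.spec h.up R) (Derives.right hR)
    hp.mem_of_pairMem (Derives.left hR)

theorem hasRel_intro {n X D : ℕ} (h : ∀ {Δ} [Step Γ Δ] z, (Δ ⊢ isRel z n X ψ) → (Δ ⊢ z ∈ᶠ D)) :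
    Γ ⊢ hasRel n X D (ψ.rename (cons 0 (· + 2))) :=
  have h := fun z => imp_intro (h z)
  .all_intro fun R => imp_intro fun {Δ} _ hR => show Δ ⊢ pairMem n R D from
    exists_opair n R fun z hz => pairMem_intro z ((h z).up.mp (.exI R (.andI hz hR.up))) hz

/-- `s(i) = s(j)`, with `s` the variable `0`. -/
def relEq (i j X : ℕ) : Fml := bex (X + 1) (pairMem (i + 2) 0 1 ∧ᶠ pairMem (j + 2) 0 1)

/-- `s(i) ∈ s(j)`, with `s` the variable `0`. -/
def relMem (i j X : ℕ) : Fml :=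
  bex (X + 1) (bex (X + 2) (pairMem (i + 3) 1 2 ∧ᶠ pairMem (j + 3) 0 2 ∧ᶠ 1 ∈ᶠ 0))

/-- `∃ a ∈ X, s ∪ {⟨n, a⟩} ∈ R`, with `s` the variable `0`. -/
def relEx (n X R : ℕ) : Fml := bex (X + 1) (bex (R + 2) (isSnoc 0 2 (n + 3) 1))

/-- `∀ a ∈ X, s ∪ {⟨n, a⟩} ∈ R`, with `s` the variable `0`. -/
def relAll (n X R : ℕ) : Fml := ball (X + 1) (bex (R + 2) (isSnoc 0 2 (n + 3) 1))

section
variable (f : ℕ → ℕ)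

@[simp] theorem rename_relEq (i j X : ℕ) :
    (relEq i j X).rename (lift f) = relEq (f i) (f j) (f X) := rfl

@[simp] theorem rename_relMem (i j X : ℕ) :
    (relMem i j X).rename (lift f) = relMem (f i) (f j) (f X) := rfl

@[simp] theorem rename_relEx (n X R : ℕ) :
    (relEx n X R).rename (lift f) = relEx (f n) (f X) (f R) := rfl

@[simp] theorem rename_relAll (n X R : ℕ) :
    (relAll n X R).rename (lift f) = relAll (f n) (f X) (f R) := rfl

end

/-- `z` is one of the atomic relations on `X`. -/
def stepAtomic (w X z : ℕ) : Fml :=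
  bex w (isRel (z + 1) 0 (X + 1) .bot ∨ᶠ bex 0 (bex 1 (isRel (z + 3) 2 (X + 3) (relEq 1 0 (X + 3)) ∨ᶠ
    isRel (z + 3) 2 (X + 3) (relMem 1 0 (X + 3)))))

/-- `z` is obtained from the `n`-ary relations `R` and `S` by a connective. -/
def stepConnective (n X R S z : ℕ) : Fml :=
  isRel z n X (0 ∈ᶠ (R + 1) ∧ᶠ 0 ∈ᶠ (S + 1)) ∨ᶠ isRel z n X (0 ∈ᶠ (R + 1) ∨ᶠ 0 ∈ᶠ (S + 1)) ∨ᶠ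
    isRel z n X (0 ∈ᶠ (R + 1) →ᶠ 0 ∈ᶠ (S + 1))

/-- `z` is obtained from the `n`-ary relation `R` by a quantifier. -/
def stepQuantifier (w n X R z : ℕ) : Fml :=
  bex w (isSucc (n + 1) 0 ∧ᶠ (isRel (z + 1) 0 (X + 1) (relAll 0 (X + 1) (R + 1)) ∨ᶠ
    isRel (z + 1) 0 (X + 1) (relEx 0 (X + 1) (R + 1))))

/-- `z` is obtained from elements of `D` by one of Tarski's clauses over `⟨X; ∈⟩`, where
`w = ω`. -/
def step (w X D z : ℕ) : Fml :=
  stepAtomic w X z ∨ᶠ bex w (.ex (.ex (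
    -- variables: `S = 0`, `R = 1`, `n = 2`
    pairMem 2 1 (D + 3) ∧ᶠ pairMem 2 0 (D + 3) ∧ᶠ
      (stepConnective 2 (X + 3) 1 0 (z + 3) ∨ᶠ stepQuantifier (w + 3) 2 (X + 3) 1 (z + 3)))))

section
variable (f : ℕ → ℕ)

@[simp] theorem rename_stepAtomic (w X z : ℕ) :
    (stepAtomic w X z).rename f = stepAtomic (f w) (f X) (f z) := by
  simp [stepAtomic, Fml.rename]

@[simp] theorem rename_stepConnective (n X R S z : ℕ) :
    (stepConnective n X R S z).rename f = stepConnective (f n) (f X) (f R) (f S) (f z) := by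
  simp [stepConnective, Fml.rename]

@[simp] theorem rename_stepQuantifier (w n X R z : ℕ) :
    (stepQuantifier w n X R z).rename f = stepQuantifier (f w) (f n) (f X) (f R) (f z) := by
  simp [stepQuantifier, Fml.rename]

@[simp] theorem rename_step (w X D z : ℕ) :
    (step w X D z).rename f = step (f w) (f X) (f D) (f z) := by
  simp [step, Fml.rename]

end

theorem isBounded_relEq (i j X : ℕ) : IsBounded (relEq i j X) :=
  .bex _ (.and (isBounded_pairMem _ _ _) (isBounded_pairMem _ _ _))

theorem isBounded_relMem (i j X : ℕ) : IsBounded (relMem i j X) :=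
  .bex _ (.bex _ (.and (isBounded_pairMem _ _ _) (.and (isBounded_pairMem _ _ _) (.mem _ _))))

theorem isBounded_relEx (n X R : ℕ) : IsBounded (relEx n X R) :=
  .bex _ (.bex _ (isBounded_isSnoc _ _ _ _))

theorem isBounded_relAll (n X R : ℕ) : IsBounded (relAll n X R) :=
  .ball _ (.bex _ (isBounded_isSnoc _ _ _ _))

/-! ### Introduction and elimination of Tarski's clauses -/

theorem step_bot {w X D z n : ℕ} (hn : Γ ⊢ n ∈ᶠ w) (hz : Γ ⊢ isRel z n X .bot) :
    Γ ⊢ step w X D z :=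
  .orI₁ (bex_intro n hn (.orI₁ (hz.of_eq (by simp [Fml.rename]))))

theorem step_eq {w X D z n i j : ℕ} (hn : Γ ⊢ n ∈ᶠ w) (hi : Γ ⊢ i ∈ᶠ n) (hj : Γ ⊢ j ∈ᶠ n)
    (hz : Γ ⊢ isRel z n X (relEq i j X)) : Γ ⊢ step w X D z :=
  .orI₁ (bex_intro n hn (.orI₂ (bex_intro i hi (bex_intro j hj (.orI₁
    (hz.of_eq (by simp)))))))

theorem step_mem {w X D z n i j : ℕ} (hn : Γ ⊢ n ∈ᶠ w) (hi : Γ ⊢ i ∈ᶠ n) (hj : Γ ⊢ j ∈ᶠ n)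
    (hz : Γ ⊢ isRel z n X (relMem i j X)) : Γ ⊢ step w X D z :=
  .orI₁ (bex_intro n hn (.orI₂ (bex_intro i hi (bex_intro j hj (.orI₂
    (hz.of_eq (by simp)))))))

theorem step_compound {w X D z n R S : ℕ} (hn : Γ ⊢ n ∈ᶠ w) (hR : Γ ⊢ pairMem n R D)
    (hS : Γ ⊢ pairMem n S D) (hz : Γ ⊢ stepConnective n X R S z ∨ᶠ stepQuantifier w n X R z) :
    Γ ⊢ step w X D z := by
  refine .orI₂ (bex_intro n hn (.exI R (.exI S (.andI hR (.andI hS (hz.of_eq ?_))))))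
  simp [Fml.rename]

theorem step_and {w X D z n R S : ℕ} (hn : Γ ⊢ n ∈ᶠ w) (hR : Γ ⊢ pairMem n R D)
    (hS : Γ ⊢ pairMem n S D) (hz : Γ ⊢ isRel z n X (0 ∈ᶠ (R + 1) ∧ᶠ 0 ∈ᶠ (S + 1))) :
    Γ ⊢ step w X D z := step_compound hn hR hS (.orI₁ (.orI₁ hz))

theorem step_or {w X D z n R S : ℕ} (hn : Γ ⊢ n ∈ᶠ w) (hR : Γ ⊢ pairMem n R D)
    (hS : Γ ⊢ pairMem n S D) (hz : Γ ⊢ isRel z n X (0 ∈ᶠ (R + 1) ∨ᶠ 0 ∈ᶠ (S + 1))) :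
    Γ ⊢ step w X D z := step_compound hn hR hS (.orI₁ (.orI₂ (.orI₁ hz)))

theorem step_imp {w X D z n R S : ℕ} (hn : Γ ⊢ n ∈ᶠ w) (hR : Γ ⊢ pairMem n R D)
    (hS : Γ ⊢ pairMem n S D) (hz : Γ ⊢ isRel z n X (0 ∈ᶠ (R + 1) →ᶠ 0 ∈ᶠ (S + 1))) :
    Γ ⊢ step w X D z := step_compound hn hR hS (.orI₁ (.orI₂ (.orI₂ hz)))

/-- A quantifier has a single premise, of arity `m = n⁺`; the place of the second relation in `step`
is filled with `R` again. -/
theorem step_all {w X D z n m R : ℕ} (hn : Γ ⊢ n ∈ᶠ w) (hm : Γ ⊢ m ∈ᶠ w) (h : Γ ⊢ isSucc m n)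
    (hR : Γ ⊢ pairMem m R D) (hz : Γ ⊢ isRel z n X (relAll n X R)) :
    Γ ⊢ step w X D z := step_compound hm hR hR (.orI₂ (bex_intro n hn
    (.andI h (.orI₁ (hz.of_eq (by simp))))))

theorem step_ex {w X D z n m R : ℕ} (hn : Γ ⊢ n ∈ᶠ w) (hm : Γ ⊢ m ∈ᶠ w) (h : Γ ⊢ isSucc m n)
    (hR : Γ ⊢ pairMem m R D) (hz : Γ ⊢ isRel z n X (relEx n X R)) :
    Γ ⊢ step w X D z := step_compound hm hR hR (.orI₂ (bex_intro n hn
    (.andI h (.orI₂ (hz.of_eq (by simp))))))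

theorem Derives.step_elim {w X D z : ℕ} (h : Γ ⊢ step w X D z)
    (h₁ : ∀ {Δ} [Step Γ Δ], (Δ ⊢ stepAtomic w X z) → (Δ ⊢ χ))
    (h₂ : ∀ {Δ} [Step Γ Δ] n R S, (Δ ⊢ n ∈ᶠ w) → (Δ ⊢ pairMem n R D) → (Δ ⊢ pairMem n S D) →
      (Δ ⊢ stepConnective n X R S z ∨ᶠ stepQuantifier w n X R z) → (Δ ⊢ χ)) : Γ ⊢ χ := by
  refine h.cases h₁ fun {_} st h => Derives.obtain_mem h fun {_} st₁ n hn h =>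
    Derives.obtain h fun {_} st₂ R h => Derives.obtain h fun {Δ} st₃ S h => ?_
  have := step_trans (step_trans st st₁) (step_trans st₂ st₃)
  refine h₂ n R S hn.up (Derives.left h) (Derives.left (Derives.right h))
    ((Derives.right (Derives.right h)).of_eq ?_)
  simp [Fml.rename]

theorem Derives.stepAtomic_elim {w X z : ℕ} (h : Γ ⊢ stepAtomic w X z)
    (hbot : ∀ {Δ} [Step Γ Δ] n, (Δ ⊢ n ∈ᶠ w) → (Δ ⊢ isRel z n X .bot) → (Δ ⊢ χ))
    (heq : ∀ {Δ} [Step Γ Δ] n i j, (Δ ⊢ n ∈ᶠ w) → (Δ ⊢ i ∈ᶠ n) → (Δ ⊢ j ∈ᶠ n) →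
      (Δ ⊢ isRel z n X (relEq i j X)) → (Δ ⊢ χ))
    (hmem : ∀ {Δ} [Step Γ Δ] n i j, (Δ ⊢ n ∈ᶠ w) → (Δ ⊢ i ∈ᶠ n) → (Δ ⊢ j ∈ᶠ n) →
      (Δ ⊢ isRel z n X (relMem i j X)) → (Δ ⊢ χ)) : Γ ⊢ χ := by
  refine Derives.obtain_mem h fun {_} st n hn h => Derives.cases h (fun {_} st₁ h => ?_)
    fun {_} st₁ h => Derives.obtain_mem h fun {_} st₂ i hi h => Derives.obtain_mem h
      fun {_} st₃ j hj h => Derives.cases h (fun {_} st₄ h => ?_) fun {_} st₄ h => ?_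
  · have := step_trans st st₁
    exact hbot n hn.up (h.of_eq (by simp [Fml.rename]))
  · have := step_trans (step_trans st st₁) (step_trans st₂ (step_trans st₃ st₄))
    exact heq n i j hn.up hi.up hj.up (h.of_eq (by simp))
  · have := step_trans (step_trans st st₁) (step_trans st₂ (step_trans st₃ st₄))
    exact hmem n i j hn.up hi.up hj.up (h.of_eq (by simp))

theorem Derives.stepConnective_elim {n X R S z : ℕ} (h : Γ ⊢ stepConnective n X R S z)
    (hand : ∀ {Δ} [Step Γ Δ], (Δ ⊢ isRel z n X (0 ∈ᶠ (R + 1) ∧ᶠ 0 ∈ᶠ (S + 1))) → (Δ ⊢ χ))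
    (hor : ∀ {Δ} [Step Γ Δ], (Δ ⊢ isRel z n X (0 ∈ᶠ (R + 1) ∨ᶠ 0 ∈ᶠ (S + 1))) → (Δ ⊢ χ))
    (himp : ∀ {Δ} [Step Γ Δ], (Δ ⊢ isRel z n X (0 ∈ᶠ (R + 1) →ᶠ 0 ∈ᶠ (S + 1))) → (Δ ⊢ χ)) :
    Γ ⊢ χ :=
  h.cases hand fun {_} st h => h.cases (fun {_} st' h => have := step_trans st st'; hor h)
    fun {_} st' h => have := step_trans st st'; himp h

theorem Derives.stepQuantifier_elim {w m X R z : ℕ} (h : Γ ⊢ stepQuantifier w m X R z)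
    (hall : ∀ {Δ} [Step Γ Δ] n, (Δ ⊢ n ∈ᶠ w) → (Δ ⊢ isSucc m n) →
      (Δ ⊢ isRel z n X (relAll n X R)) → (Δ ⊢ χ))
    (hex : ∀ {Δ} [Step Γ Δ] n, (Δ ⊢ n ∈ᶠ w) → (Δ ⊢ isSucc m n) →
      (Δ ⊢ isRel z n X (relEx n X R)) → (Δ ⊢ χ)) : Γ ⊢ χ :=
  Derives.obtain_mem h fun {_} st n hn h => Derives.cases (Derives.right h)
    (fun {_} st' h' => have := step_trans st st'; hall n hn.up (Derives.left h).up
      (h'.of_eq (by simp)))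
    fun {_} st' h' => have := step_trans st st'; hex n hn.up (Derives.left h).up
      (h'.of_eq (by simp))

/-- `D` occurs only positively. Monotonicity is what makes the iteration of `step` lie inside every
closed set. -/
theorem Derives.step_mono {w X D E z : ℕ} (h : Γ ⊢ step w X D z) (hs : Γ ⊢ sub D E) :
    Γ ⊢ step w X E z :=
  h.step_elim (fun h => .orI₁ h) fun n R S hn hR hS h =>
    step_compound hn (hs.up.pairMem_mono hR) (hs.up.pairMem_mono hS) h

/-! ### Sets closed under Tarski's clauses -/

@[simp] theorem rename_hasRel (f : ℕ → ℕ) (n X D : ℕ) (ψ : Fml) :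
    (hasRel n X D ψ).rename f = hasRel (f n) (f X) (f D) (ψ.rename (lift (lift f))) := rfl

theorem closedAtomic_iff (n X D i j : ℕ) :
    ((hasRel (n + 2) (X + 2) (D + 2)
        (bex (X + 4) (pairMem 4 0 1 ∧ᶠ pairMem 3 0 1)) ∧ᶠ
      hasRel (n + 2) (X + 2) (D + 2)
        (bex (X + 4) (bex (X + 5) (pairMem 5 1 2 ∧ᶠ pairMem 4 0 2 ∧ᶠ 1 ∈ᶠ 0)))).rename
          (lift (cons i fun n => n))).inst j =
    (hasRel n X D ((relEq i j X).rename (cons 0 (· + 2))) ∧ᶠ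
      hasRel n X D ((relMem i j X).rename (cons 0 (· + 2)))) := by
  simp [relEq, relMem, Fml.inst, Fml.rename]

theorem closedConnectives_iff (n X D R S : ℕ) :
    ((pairMem (n + 2) 1 (D + 2) ∧ᶠ pairMem (n + 2) 0 (D + 2) →ᶠ
      hasRel (n + 2) (X + 2) (D + 2) (0 ∈ᶠ 3 ∧ᶠ 0 ∈ᶠ 2) ∧ᶠ
      hasRel (n + 2) (X + 2) (D + 2) (0 ∈ᶠ 3 ∨ᶠ 0 ∈ᶠ 2) ∧ᶠ
      hasRel (n + 2) (X + 2) (D + 2) (0 ∈ᶠ 3 →ᶠ 0 ∈ᶠ 2)).rename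
        (lift (cons R fun n => n))).inst S =
    (pairMem n R D ∧ᶠ pairMem n S D →ᶠ
      hasRel n X D ((0 ∈ᶠ (R + 1) ∧ᶠ 0 ∈ᶠ (S + 1)).rename (cons 0 (· + 2))) ∧ᶠ
      hasRel n X D ((0 ∈ᶠ (R + 1) ∨ᶠ 0 ∈ᶠ (S + 1)).rename (cons 0 (· + 2))) ∧ᶠ
      hasRel n X D ((0 ∈ᶠ (R + 1) →ᶠ 0 ∈ᶠ (S + 1)).rename (cons 0 (· + 2)))) := by
  simp [Fml.inst, Fml.rename]

theorem closedQuantifiers_iff (n X D m R : ℕ) :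
    ((isSucc 1 (n + 2) ∧ᶠ pairMem 1 0 (D + 2) →ᶠ
      hasRel (n + 2) (X + 2) (D + 2) (ball (X + 4) (bex 3 (isSnoc 0 2 (n + 6) 1))) ∧ᶠ
      hasRel (n + 2) (X + 2) (D + 2) (bex (X + 4) (bex 3 (isSnoc 0 2 (n + 6) 1)))).rename
        (lift (cons m fun n => n))).inst R =
    (isSucc m n ∧ᶠ pairMem m R D →ᶠ hasRel n X D ((relAll n X R).rename (cons 0 (· + 2))) ∧ᶠ
      hasRel n X D ((relEx n X R).rename (cons 0 (· + 2)))) := by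
  simp [relAll, relEx, Fml.inst, Fml.rename]

theorem closed_inst (n X D : ℕ) :
    (isNat 0 →ᶠ closedAtomic 0 (X + 1) (D + 1) ∧ᶠ closedConnectives 0 (X + 1) (D + 1) ∧ᶠ
      closedQuantifiers 0 (X + 1) (D + 1)).inst n =
    (isNat n →ᶠ closedAtomic n X D ∧ᶠ closedConnectives n X D ∧ᶠ closedQuantifiers n X D) := by
  simp [closedAtomic, closedConnectives, closedQuantifiers, Fml.inst, Fml.rename]
  rfl

/-- With its converse `isClosed_intro`, this identifies the closed sets with the sets `D` that
contain everything produced by `step` from `D`. From here on the syntactic clauses are replaced by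
one monotone operator. -/
theorem Derives.closed_step {w X D z : ℕ} (hw : Γ ⊢ isOmega w) (hD : Γ ⊢ isClosed X D)
    (h : Γ ⊢ step w X D z) : Γ ⊢ z ∈ᶠ D := by
  have hc : ∀ {Θ} [Ext Γ Θ] n, (Θ ⊢ n ∈ᶠ w) → (Θ ⊢ closedAtomic n X D ∧ᶠ
      closedConnectives n X D ∧ᶠ closedQuantifiers n X D) := fun {Θ} _ n hn =>
    ((Derives.spec hD.up n).of_eq (closed_inst n X D)).mp (hw.up.nat_of_mem_omega hn)
  refine h.step_elim (fun h => h.stepAtomic_elim (fun n hn hz => ?_) (fun n i j hn hi hj hz => ?_)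
    (fun n i j hn hi hj hz => ?_)) fun n R S hn hR hS h => h.cases
      (fun {Δ} _ h => ?_) fun {Δ} _ h => h.stepQuantifier_elim
        (fun {Δ} _ m hm hs hz => ?_) (fun {Δ} _ m hm hs hz => ?_)
  · exact Derives.hasRel_elim (hc n hn).left.left hz
  · exact Derives.hasRel_elim ((((hc n hn).left.right.ball_elim hi).ball_elim hj).of_eq
      (closedAtomic_iff n X D i j)).left hz
  · exact Derives.hasRel_elim ((((hc n hn).left.right.ball_elim hi).ball_elim hj).of_eq
      (closedAtomic_iff n X D i j)).right hz
  · have := ((Derives.spec (Derives.spec (hc (Θ := Δ) n hn.up).right.left R) S).of_eq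
      (closedConnectives_iff n X D R S)).mp (.andI hR.up hS.up)
    exact h.stepConnective_elim (fun hz => Derives.hasRel_elim this.up.left hz)
      (fun hz => Derives.hasRel_elim this.up.right.left hz)
      fun hz => Derives.hasRel_elim this.up.right.right hz
  · exact Derives.hasRel_elim (((Derives.spec (Derives.spec (hc m hm).right.right n) R).of_eq
      (closedQuantifiers_iff m X D n R)).mp (.andI hs hR.up)).left hz
  · exact Derives.hasRel_elim (((Derives.spec (Derives.spec (hc m hm).right.right n) R).of_eq
      (closedQuantifiers_iff m X D n R)).mp (.andI hs hR.up)).right hz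

theorem isClosed_intro {w X D : ℕ} (hw : Γ ⊢ isOmega w)
    (h : ∀ {Δ} [Step Γ Δ] z, (Δ ⊢ step w X D z) → (Δ ⊢ z ∈ᶠ D)) : Γ ⊢ isClosed X D := by
  have h := fun z => imp_intro (h z)
  refine .all_intro fun n => Derives.of_eq (imp_intro fun {Δ} _ hn => ?_) (closed_inst n X D).symm
  have hn : Δ ⊢ n ∈ᶠ w := hw.up.mem_omega_of_nat hn
  refine .andI (.andI ?_ ?_) (.andI ?_ ?_)
  · exact hasRel_intro fun z hz => (h z).up.mp (step_bot hn.up hz)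
  · exact ball_intro fun i hi => ball_intro fun j hj => Derives.of_eq (.andI
      (hasRel_intro fun z hz => (h z).up.mp (step_eq hn.up hi.up hj.up hz))
      (hasRel_intro fun z hz => (h z).up.mp (step_mem hn.up hi.up hj.up hz)))
      (closedAtomic_iff n X D i j).symm
  · refine .all_intro fun R => .all_intro fun S => Derives.of_eq (imp_intro fun {Θ} _ hRS => ?_)
      (closedConnectives_iff n X D R S).symm
    exact .andI (hasRel_intro fun z hz => (h z).up.mp (step_and hn.up hRS.up.left hRS.up.right hz))
      (.andI (hasRel_intro fun z hz => (h z).up.mp (step_or hn.up hRS.up.left hRS.up.right hz))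
        (hasRel_intro fun z hz => (h z).up.mp (step_imp hn.up hRS.up.left hRS.up.right hz)))
  · refine .all_intro fun m => .all_intro fun R => Derives.of_eq (imp_intro fun {Θ} _ hR => ?_)
      (closedQuantifiers_iff n X D m R).symm
    have hm : Θ ⊢ m ∈ᶠ w := hw.up.succ_mem_omega hn.up hR.left
    exact .andI (hasRel_intro fun z hz => (h z).up.mp (step_all hn.up hm.up hR.up.left hR.up.right hz))
      (hasRel_intro fun z hz => (h z).up.mp (step_ex hn.up hm.up hR.up.left hR.up.right hz))

/-- The second components of the pairs in `D` lie in a set. -/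
theorem exists_range (D : ℕ) (k : ∀ {Δ} [Step Γ Δ] U,
    (∀ {Θ} [Ext Δ Θ] n R, (Θ ⊢ pairMem n R D) → (Θ ⊢ R ∈ᶠ U)) → (Δ ⊢ χ)) : Γ ⊢ χ :=
  -- `R ∈ {n, R} ∈ ⟨n, R⟩ ∈ D`, so `U = ⋃⋃D` works.
  (isSet_union D).isSet_elim fun {_} st V hV => (isSet_union V).isSet_elim fun {Δ} st' U hU =>
    have hV : ∀ z, Δ ⊢ z ∈ᶠ V ↔ᶠ bex D ((z + 1) ∈ᶠ 0) := fun z => (hV z).up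
    have := step_trans st st'
    k U fun {Θ} _ n R h => h.obtain_pair fun {_} _ p hp h => h.right.left.obtain_mem fun {Ξ} _ q hq
      (hq' : Ξ ⊢ isPair q n R) => (hU R).up.iff_mpr (bex_intro q
        ((hV q).up.iff_mpr (bex_intro p hp.up hq)) hq'.right.left)

/-! ### The set of definable relations -/

theorem isSet_rel {w n : ℕ} {ψ : Fml} (hw : Γ ⊢ isOmega w) (hn : Γ ⊢ n ∈ᶠ w) (X : ℕ)
    (hψ : IsBounded ψ) {ψ' : Fml} (e : ψ' = ψ.rename (lift (· + 1))) :
    Γ ⊢ isSet (isRel 0 (n + 1) (X + 1) ψ') := e ▸ isSet_isRel hw hn X hψ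

theorem isSet_stepAtomic {w : ℕ} (hw : Γ ⊢ isOmega w) (X : ℕ) :
    Γ ⊢ isSet (stepAtomic (w + 1) (X + 1) 0) := by
  refine isSet_bex w _ fun {Δ} _ n hn => Derives.of_eq (φ := isSet (isRel 0 (n + 1) (X + 1) .bot ∨ᶠ
    bex (n + 1) (bex (n + 2) (isRel 2 (n + 3) (X + 3) (relEq 1 0 (X + 3)) ∨ᶠ
      isRel 2 (n + 3) (X + 3) (relMem 1 0 (X + 3)))))) ?_ (congrArg isSet (by simp [Fml.rename]))
  refine Derives.isSet_or (isSet_rel hw.up hn X .bot rfl)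
    (isSet_bex n _ fun {Θ} _ i hi => ?_)
  refine Derives.of_eq (φ := isSet (bex (n + 1) (isRel 1 (n + 2) (X + 2) (relEq (i + 2) 0 (X + 2)) ∨ᶠ
    isRel 1 (n + 2) (X + 2) (relMem (i + 2) 0 (X + 2))))) ?_
    (congrArg isSet (by simp [Fml.rename]))
  refine isSet_bex n _ fun {Θ} _ j hj => ?_
  refine Derives.of_eq (φ := isSet (isRel 0 (n + 1) (X + 1) (relEq (i + 1) (j + 1) (X + 1)) ∨ᶠ
    isRel 0 (n + 1) (X + 1) (relMem (i + 1) (j + 1) (X + 1)))) ?_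
    (congrArg isSet (by simp [Fml.rename]))
  exact (isSet_rel hw.up hn.up X (isBounded_relEq i j X) (by simp)).isSet_or
    (isSet_rel hw.up hn.up X (isBounded_relMem i j X) (by simp))

theorem isSet_stepConnective {w n : ℕ} (hw : Γ ⊢ isOmega w) (hn : Γ ⊢ n ∈ᶠ w) (X R S : ℕ) :
    Γ ⊢ isSet (stepConnective (n + 1) (X + 1) (R + 1) (S + 1) 0) :=
  (isSet_rel hw hn X (ψ := 0 ∈ᶠ (R + 1) ∧ᶠ 0 ∈ᶠ (S + 1)) (.and (.mem _ _) (.mem _ _)) rfl).isSet_or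
    ((isSet_rel hw hn X (ψ := 0 ∈ᶠ (R + 1) ∨ᶠ 0 ∈ᶠ (S + 1)) (.or (.mem _ _) (.mem _ _))
      rfl).isSet_or (isSet_rel hw hn X (ψ := 0 ∈ᶠ (R + 1) →ᶠ 0 ∈ᶠ (S + 1))
        (.imp (.mem _ _) (.mem _ _)) rfl))

theorem isSet_stepQuantifier {w : ℕ} (hw : Γ ⊢ isOmega w) (n X R : ℕ) :
    Γ ⊢ isSet (stepQuantifier (w + 1) (n + 1) (X + 1) (R + 1) 0) := by
  refine isSet_bex w _ fun {Δ} _ m hm => Derives.of_eq (φ := isSet (isSucc (n + 1) (m + 1) ∧ᶠ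
    (isRel 0 (m + 1) (X + 1) (relAll (m + 1) (X + 1) (R + 1)) ∨ᶠ
      isRel 0 (m + 1) (X + 1) (relEx (m + 1) (X + 1) (R + 1))))) ?_
    (congrArg isSet (by simp [Fml.rename]))
  exact ((isSet_rel hw.up hm X (isBounded_relAll m X R) (by simp)).isSet_or
    (isSet_rel hw.up hm X (isBounded_relEx m X R) (by simp))).isSet_and (isBounded_isSucc _ _)

/-- The quantifiers over `R` and `S` in `step` are unbounded, but relations occurring in `D` lie in
the set given by `exists_range`. With these bounds the class is a union of sets indexed by sets. -/
theorem isSet_step {w : ℕ} (hw : Γ ⊢ isOmega w) (X D : ℕ) :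
    Γ ⊢ isSet (step (w + 1) (X + 1) (D + 1) 0) := by
  have key : ∀ n R S, (pairMem (n + 1) (R + 1) (D + 1) ∧ᶠ pairMem (n + 1) (S + 1) (D + 1) ∧ᶠ
      (stepConnective (n + 1) (X + 1) (R + 1) (S + 1) 0 ∨ᶠ
        stepQuantifier (w + 1) (n + 1) (X + 1) (R + 1) 0)) =
      ((((pairMem 2 1 (D + 4) ∧ᶠ pairMem 2 0 (D + 4) ∧ᶠ
        (stepConnective 2 (X + 4) 1 0 3 ∨ᶠ stepQuantifier (w + 4) 2 (X + 4) 1 3)).rename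
          (lift (lift (cons (n + 1) (cons 0 (· + 1)))))).rename
          (lift (cons (R + 1) (cons 0 (· + 1))))).rename (cons (S + 1) (cons 0 (· + 1)))) := by
    intro n R S
    simp [Fml.rename]
  refine exists_range D fun {Δ} _ U hU => (((isSet_stepAtomic hw.up X).isSet_or (isSet_bex w
    (bex (U + 2) (bex (U + 3) (pairMem 2 1 (D + 4) ∧ᶠ pairMem 2 0 (D + 4) ∧ᶠ
      (stepConnective 2 (X + 4) 1 0 3 ∨ᶠ stepQuantifier (w + 4) 2 (X + 4) 1 3))))
    fun {Δ} _ n hn => isSet_bex U _ fun {Δ} _ R hR => isSet_bex U _ fun {Δ} _ S hS =>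
      Derives.of_eq ?_ (congrArg isSet (key n R S))) : Δ ⊢ _)).isSet_congr
    (fun {Θ} _ z hz => ?_) fun {Θ} _ z hz => ?_
  · exact (((isSet_stepConnective hw.up hn.up X R S).isSet_or (isSet_stepQuantifier hw.up n X R)
      ).isSet_and (isBounded_pairMem _ _ _)).isSet_and (isBounded_pairMem _ _ _)
  · refine Derives.of_eq (φ := step w X D z) ?_ (by simp [Fml.inst])
    refine Derives.cases hz (fun {Ξ} _ h => ?_) fun {Ξ} _ h => Derives.obtain_mem h
      fun {Ξ} _ n hn h => Derives.obtain_mem h fun {Ξ} _ R hR h => Derives.obtain_mem h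
        fun {Ξ} _ S hS h => ?_
    · exact .orI₁ (h.of_eq (by simp))
    · replace h : Ξ ⊢ pairMem n R D ∧ᶠ pairMem n S D ∧ᶠ (stepConnective n X R S z ∨ᶠ
        stepQuantifier w n X R z) := h.of_eq (by simp [Fml.inst, Fml.rename])
      exact step_compound hn.up h.left h.right.left h.right.right
  · replace hz : Θ ⊢ step w X D z := hz.of_eq (by simp [Fml.inst])
    refine hz.step_elim (fun {Ξ} _ h => .orI₁ (h.of_eq (by simp)))
      fun {Ξ} _ n R S hn hR hS h => .orI₂ (bex_intro n hn (bex_intro R (hU n R hR)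
        (bex_intro S (hU n S hS) (Derives.of_eq (.andI hR (.andI hS h)) ?_))))
    simp [Fml.inst, Fml.rename]

theorem step_inst₂ (w X D z : ℕ) : (step (w + 2) (X + 2) 0 1).inst₂ D z = step w X D z := by
  simp [Fml.inst₂]

/-- Iterating `step` along `ω` reaches the least closed set, because each clause has at most two
premises. The description of `D` as the value of a recursion at `ω` is kept, since it gives
induction for unbounded formulas in `defRels_induction`. -/
theorem exists_defRels {w : ℕ} (hw : Γ ⊢ isOmega w) (X : ℕ)
    (k : ∀ {Δ} [Step Γ Δ] D, (Δ ⊢ isDefRels X D) →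
      (Δ ⊢ isRec (step (w + 2) (X + 2) 0 1) w D) → (Δ ⊢ χ)) : Γ ⊢ χ := by
  have hρ : ∀ {Δ}, (Δ ⊢ isOmega w) → ∀ z, Δ ⊢ isSet ((step (w + 2) (X + 2) 0 1).rename
      (cons (z + 1) (cons 0 (· + 1)))) := fun {Δ} hw z =>
    (isSet_step hw X z).of_eq (by simp)
  refine exists_rec hw.omega_ord (hρ hw) fun {Δ} _ D hD => k D (.andI ?_ ?_) hD
  · replace hw : Δ ⊢ isOmega w := hw.up
    have hl : ∀ {Θ} [Ext Δ Θ] l z, (Θ ⊢ l ∈ᶠ w) → (∀ {Ξ} [Step Θ Ξ] E,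
        (Ξ ⊢ isRec (step (w + 2) (X + 2) 0 1) l E) → (Ξ ⊢ step w X E z)) → (Θ ⊢ z ∈ᶠ D) :=
      fun {Θ} _ l z hl hE => exists_rec (hw.up.nat_ord hl) (hρ hw.up) fun E hE' =>
        hD.up.rec_mem hl.up hE' ((hE E hE').of_eq (step_inst₂ w X E z).symm)
    -- Atomic relations arise from stage `∅`. The two premises of a compound clause are produced by
    -- `step` from stages `i` and `j`; both belong to any stage `l` with `i, j ∈ l`, and `step`
    -- applied to that stage lands in `D`.
    refine isClosed_intro hw.up fun {Θ} _ z h => h.step_elim (fun h => exists_empty fun e he =>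
      hl e z (hw.up.empty_mem_omega he) fun E hE => .orI₁ h.up) fun n R S hn hR hS h =>
        hR.obtain_pair fun p hp hp' => hS.up.obtain_pair fun q hq hq' =>
          hD.up.rec_mem_obtain hp.up fun i z₁ hi hz₁ hp₁ => hD.up.rec_mem_obtain hq.up
            fun j z₂ hj hz₂ hq₂ => hw.up.exists_gt hi.up hj fun l hlw hil hjl =>
              hl l z hlw fun E hE => step_compound (n := n) (R := R) (S := S) hn.up
                (pairMem_intro p (hE.rec_mem hil.up hz₁.up hp₁.up) hp'.up)
                (pairMem_intro q (hE.rec_mem hjl.up hz₂.up hq₂.up) hq'.up) h.up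
  · refine .all_intro fun C => ?_
    show Δ ⊢ isClosed X C →ᶠ sub D C
    refine imp_intro fun {Θ} _ hC => sub_intro fun {Θ} _ z hz => ?_
    -- Leastness: if a stage is contained in the closed set `C`, then so is what `step` produces
    -- from it.
    refine rec_induction (0 ∈ᶠ (C + 1)) (fun {Ξ} _ E z hE hz => ?_) hD.up hz
    exact hw.up.closed_step hC.up ((hz.of_eq (step_inst₂ w X E z)).step_mono hE)

theorem Derives.defRels_unique {X D D' : ℕ} (h : Γ ⊢ isDefRels X D) (h' : Γ ⊢ isDefRels X D') :
    Γ ⊢ D ≡ᶠ D' := by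
  have h₁ : Γ ⊢ isClosed X D' →ᶠ sub D D' := Derives.spec (Derives.right h) D'
  have h₂ : Γ ⊢ isClosed X D →ᶠ sub D' D := Derives.spec (Derives.right h') D
  exact (h₁.mp (Derives.left h')).antisymm (h₂.mp (Derives.left h))

/-- Induction on the generation of definable relations, for arbitrary formulas. -/
theorem defRels_induction (φ : Fml) {w X D z : ℕ} (hw : Γ ⊢ isOmega w) (hD : Γ ⊢ isDefRels X D)
    (h : ∀ {Δ} [Step Γ Δ] E z, (Δ ⊢ ball E φ) → (Δ ⊢ step w X E z) → (Δ ⊢ φ.inst z))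
    (hz : Γ ⊢ z ∈ᶠ D) : Γ ⊢ φ.inst z :=
  have h := fun E z => imp_intro₂ (h E z)
  exists_defRels hw X fun D' hD' hr => rec_induction φ
    (fun E z hE hz => (h E z).up.mp₂ hE (hz.of_eq (step_inst₂ w X E z))) hr
    ((hD.up.defRels_unique hD').mem_right hz.up)

/-! ### Definable subsets -/

/-- `Y = {a ∈ X | p ∪ {⟨n, a⟩} ∈ R}`. -/
def isSection (Y X R n p : ℕ) : Fml :=
  .all (0 ∈ᶠ (Y + 1) ↔ᶠ 0 ∈ᶠ (X + 1) ∧ᶠ bex (R + 1) (isSnoc 0 (p + 2) (n + 2) 1))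

section
variable (f : ℕ → ℕ)

@[simp] theorem rename_isSection (Y X R n p : ℕ) :
    (isSection Y X R n p).rename f = isSection (f Y) (f X) (f R) (f n) (f p) := rfl

@[simp] theorem rename_isNat (n : ℕ) : (isNat n).rename f = isNat (f n) := rfl

@[simp] theorem rename_closedAtomic (n X D : ℕ) :
    (closedAtomic n X D).rename f = closedAtomic (f n) (f X) (f D) := by
  simp [closedAtomic, Fml.rename]

@[simp] theorem rename_closedConnectives (n X D : ℕ) :
    (closedConnectives n X D).rename f = closedConnectives (f n) (f X) (f D) := by
  simp [closedConnectives, Fml.rename]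

@[simp] theorem rename_closedQuantifiers (n X D : ℕ) :
    (closedQuantifiers n X D).rename f = closedQuantifiers (f n) (f X) (f D) := by
  simp [closedQuantifiers, Fml.rename]

@[simp] theorem rename_isClosed (X D : ℕ) :
    (isClosed X D).rename f = isClosed (f X) (f D) := by
  simp [isClosed, Fml.rename]

@[simp] theorem rename_sub (x y : ℕ) : (sub x y).rename f = sub (f x) (f y) := rfl

@[simp] theorem rename_isDefRels (X D : ℕ) :
    (isDefRels X D).rename f = isDefRels (f X) (f D) := by
  simp [isDefRels, Fml.rename]

theorem inDef_eq (X Y : ℕ) : inDef X Y = .ex (.ex (.ex (.ex (.ex (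
    isDefRels (X + 5) 4 ∧ᶠ isNat 3 ∧ᶠ isSucc 2 3 ∧ᶠ pairMem 2 1 4 ∧ᶠ isSeq 0 3 (X + 5) ∧ᶠ
      isSection (Y + 5) (X + 5) 1 3 0))))) := rfl

@[simp] theorem rename_inDef (X Y : ℕ) : (inDef X Y).rename f = inDef (f X) (f Y) := by
  simp [inDef_eq, Fml.rename]

end

theorem isSection_intro {Y X R n p : ℕ}
    (h : ∀ {Δ} [Step Γ Δ] a t, (Δ ⊢ a ∈ᶠ X) → (Δ ⊢ t ∈ᶠ R) → (Δ ⊢ isSnoc t p n a) → (Δ ⊢ a ∈ᶠ Y))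
    (h₁ : ∀ {Δ} [Step Γ Δ] a, (Δ ⊢ a ∈ᶠ Y) → (Δ ⊢ a ∈ᶠ X))
    (h₂ : ∀ {Δ} [Step Γ Δ] a t, (Δ ⊢ a ∈ᶠ Y) → (Δ ⊢ isSnoc t p n a) → (Δ ⊢ t ∈ᶠ R)) :
    Γ ⊢ isSection Y X R n p := by
  have h := fun a t => imp_intro₃ (h a t)
  have h₂ := fun a t => imp_intro₂ (h₂ a t)
  refine .all_intro fun a => ?_
  show Γ ⊢ a ∈ᶠ Y ↔ᶠ a ∈ᶠ X ∧ᶠ bex R (isSnoc 0 (p + 1) (n + 1) (a + 1))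
  exact iff_intro (fun ha => .andI (h₁ a ha) (exists_snoc p n a fun t ht =>
      bex_intro t ((h₂ a t).up.mp₂ ha.up ht) ht))
    fun ha => ha.right.obtain_mem fun t ht ht' => (h a t).up.mp₃ ha.up.left ht ht'

theorem Derives.section_mem {Y X R n p a t : ℕ} (h : Γ ⊢ isSection Y X R n p) (ha : Γ ⊢ a ∈ᶠ X)
    (ht : Γ ⊢ t ∈ᶠ R) (hs : Γ ⊢ isSnoc t p n a) : Γ ⊢ a ∈ᶠ Y := by
  have h' : Γ ⊢ a ∈ᶠ Y ↔ᶠ a ∈ᶠ X ∧ᶠ bex R (isSnoc 0 (p + 1) (n + 1) (a + 1)) := Derives.spec h a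
  exact h'.iff_mpr (.andI ha (bex_intro t ht hs))

theorem Derives.section_sub {Y X R n p : ℕ} (h : Γ ⊢ isSection Y X R n p) : Γ ⊢ sub Y X :=
  sub_intro fun {Δ} _ a ha =>
    have h' : Δ ⊢ a ∈ᶠ Y ↔ᶠ a ∈ᶠ X ∧ᶠ bex R (isSnoc 0 (p + 1) (n + 1) (a + 1)) := Derives.spec h.up a
    (h'.iff_mp ha).left

theorem Derives.section_snoc {Y X R n p a t : ℕ} (h : Γ ⊢ isSection Y X R n p) (ha : Γ ⊢ a ∈ᶠ Y)
    (hs : Γ ⊢ isSnoc t p n a) : Γ ⊢ t ∈ᶠ R := by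
  have h' : Γ ⊢ a ∈ᶠ Y ↔ᶠ a ∈ᶠ X ∧ᶠ bex R (isSnoc 0 (p + 1) (n + 1) (a + 1)) := Derives.spec h a
  exact (h'.iff_mp ha).right.obtain_mem fun t' ht' h' => (Derives.snoc_unique h' hs.up).mem_left ht'

theorem Derives.section_unique {Y Y' X R n p : ℕ} (h : Γ ⊢ isSection Y X R n p)
    (h' : Γ ⊢ isSection Y' X R n p) : Γ ⊢ Y ≡ᶠ Y' :=
  eq_of_forall_mem_iff fun a => iff_intro
    (fun ha => exists_snoc p n a fun t ht => h'.up.section_mem (h.up.section_sub.sub_elim ha.up)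
      (h.up.section_snoc ha.up ht) ht)
    fun ha => exists_snoc p n a fun t ht => h.up.section_mem (h'.up.section_sub.sub_elim ha.up)
      (h'.up.section_snoc ha.up ht) ht

theorem isSet_isSection (X R n p : ℕ) :
    Γ ⊢ isSet (isSection 0 (X + 1) (R + 1) (n + 1) (p + 1)) :=
  (isSet_separation (φ := bex (R + 1) (isSnoc 0 (p + 2) (n + 2) 1)) X
    (.bex _ (isBounded_isSnoc _ _ _ _))).isSet_elim fun {Δ} _ Y hY =>
      have h : Δ ⊢ isSection Y X R n p := .all_intro fun a => hY a
      isSet_of_unique Y h fun Z hZ => Derives.section_unique hZ h.up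

theorem inDef_intro {w X Y D n m R p : ℕ} (hw : Γ ⊢ isOmega w) (hD : Γ ⊢ isDefRels X D)
    (hn : Γ ⊢ n ∈ᶠ w) (hm : Γ ⊢ isSucc m n) (hR : Γ ⊢ pairMem m R D) (hp : Γ ⊢ isSeq p n X)
    (hY : Γ ⊢ isSection Y X R n p) : Γ ⊢ inDef X Y := by
  rw [inDef_eq]
  refine .exI D (.exI n (.exI m (.exI R (.exI p (Derives.of_eq (.andI hD (.andI
    (hw.nat_of_mem_omega hn) (.andI hm (.andI hR (.andI hp hY))))) ?_)))))
  simp [Fml.inst, Fml.rename]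

theorem Derives.inDef_elim {w X Y : ℕ} (hw : Γ ⊢ isOmega w) (h : Γ ⊢ inDef X Y)
    (k : ∀ {Δ} [Step Γ Δ] D n m R p, (Δ ⊢ isDefRels X D) → (Δ ⊢ n ∈ᶠ w) → (Δ ⊢ isSucc m n) →
      (Δ ⊢ pairMem m R D) → (Δ ⊢ isSeq p n X) → (Δ ⊢ isSection Y X R n p) → (Δ ⊢ χ)) :
    Γ ⊢ χ := by
  rw [inDef_eq] at h
  refine h.obtain fun {_} s₁ D h => Derives.obtain h fun {_} s₂ n h => Derives.obtain h
    fun {_} s₃ m h => Derives.obtain h fun {_} s₄ R h => Derives.obtain h fun {Δ} s₅ p h => ?_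
  have := step_trans s₁ (step_trans s₂ (step_trans s₃ (step_trans s₄ s₅)))
  replace h : Δ ⊢ isDefRels X D ∧ᶠ isNat n ∧ᶠ isSucc m n ∧ᶠ pairMem m R D ∧ᶠ isSeq p n X ∧ᶠ
    isSection Y X R n p := h.of_eq (by simp [Fml.inst, Fml.rename])
  exact k D n m R p h.left (hw.up.mem_omega_of_nat h.right.left) h.right.right.left
    h.right.right.right.left h.right.right.right.right.left h.right.right.right.right.right

theorem Derives.inDef_sub {w X Y : ℕ} (hw : Γ ⊢ isOmega w) (h : Γ ⊢ inDef X Y) : Γ ⊢ sub Y X :=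
  hw.inDef_elim h fun _ _ _ _ _ _ _ _ _ _ hY => hY.section_sub

/-- The definable subsets of a set form a set. -/
theorem isSet_inDef {w : ℕ} (hw : Γ ⊢ isOmega w) (X : ℕ) : Γ ⊢ isSet (inDef (X + 1) 0) := by
  refine exists_defRels hw X fun {Δ} _ D hD _ => exists_range D fun {Δ} _ U hU => ?_
  have hseq : ∀ {Θ} [Ext Δ Θ] n R, (Θ ⊢ n ∈ᶠ w) →
      (Θ ⊢ isSet (.ex (isSeq 0 (n + 2) (X + 2) ∧ᶠ isSection 1 (X + 2) (R + 2) (n + 2) 0))) := by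
    intro Θ _ n R hn
    refine (isSet_seq (hw.up (Δ := Δ)).up hn X).isSet_elim fun {Θ'} _ E hE => ?_
    replace hE : ∀ p, Θ' ⊢ p ∈ᶠ E ↔ᶠ isSeq p n X := hE
    refine Derives.isSet_congr (φ := bex (E + 1) (isSection 1 (X + 2) (R + 2) (n + 2) 0))
      (isSet_bex E _ fun p hp => isSet_isSection X R n p) (fun {Ξ} _ Y hY => ?_)
      fun {Ξ} _ Y hY => ?_
    · exact Derives.obtain_mem hY fun p hp h => .exI p (.andI ((hE p).up.iff_mp hp) h)
    · exact Derives.obtain hY fun p h => bex_intro p ((hE p).up.iff_mpr (Derives.left h))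
        (Derives.right h)
  have key : ∀ n m R, (isSucc (m + 1) (n + 1) ∧ᶠ pairMem (m + 1) (R + 1) (D + 1) ∧ᶠ
      .ex (isSeq 0 (n + 2) (X + 2) ∧ᶠ isSection 1 (X + 2) (R + 2) (n + 2) 0)) =
      ((((isSucc 1 2 ∧ᶠ pairMem 1 0 (D + 4) ∧ᶠ
        .ex (isSeq 0 3 (X + 5) ∧ᶠ isSection 4 (X + 5) 1 3 0)).rename
          (lift (lift (cons (n + 1) (cons 0 (· + 1)))))).rename
          (lift (cons (m + 1) (cons 0 (· + 1))))).rename (cons (R + 1) (cons 0 (· + 1)))) := by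
    intro n m R
    simp [Fml.rename]
  -- A section is determined by `n`, `m`, `R` and `p`. The first three range over `ω`, `ω` and the
  -- range of `D`, and `p` over the set `Xⁿ`, so the class is a union of singletons.
  refine Derives.isSet_congr (φ := bex (w + 1) (bex (w + 2) (bex (U + 3) (isSucc 1 2 ∧ᶠ
      pairMem 1 0 (D + 4) ∧ᶠ .ex (isSeq 0 3 (X + 5) ∧ᶠ isSection 4 (X + 5) 1 3 0)))))
    (isSet_bex w _ fun {Θ} _ n hn => isSet_bex w _ fun {Θ} _ m hm => isSet_bex U _
      fun {Θ} _ R hR => Derives.of_eq (((hseq n R hn.up).isSet_and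
        (isBounded_pairMem _ _ _)).isSet_and (isBounded_isSucc _ _)) (congrArg isSet (key n m R)))
    (fun {Θ} _ Y hY => ?_) fun {Θ} _ Y hY => ?_
  · refine Derives.of_eq (φ := inDef X Y) ?_ (by simp [Fml.inst])
    refine Derives.obtain_mem hY fun {_} _ n hn h => Derives.obtain_mem h fun {_} _ m hm h =>
      Derives.obtain_mem h fun {Ξ} _ R hR h => ?_
    replace h : Ξ ⊢ isSucc m n ∧ᶠ pairMem m R D ∧ᶠ .ex (isSeq 0 (n + 1) (X + 1) ∧ᶠ
      isSection (Y + 1) (X + 1) (R + 1) (n + 1) 0) := h.of_eq (by simp [Fml.inst, Fml.rename])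
    exact h.right.right.obtain fun p hp => inDef_intro hw.up hD.up hn.up h.up.left
      h.up.right.left (Derives.left hp) (Derives.right hp)
  · replace hY : Θ ⊢ inDef X Y := hY.of_eq (by simp [Fml.inst])
    refine Derives.inDef_elim hw.up hY fun {Ξ} _ D' n m R p hD' hn hm hR hp hs => ?_
    have hR : Ξ ⊢ pairMem m R D :=
      (hD'.defRels_unique hD.up).subst (pairMem (m + 1) (R + 1) 0) hR
    refine bex_intro n hn (bex_intro m (hw.up.succ_mem_omega hn hm) (bex_intro R (hU m R hR)
      (Derives.of_eq (.andI hm (.andI hR (.exI (φ := isSeq 0 (n + 1) (X + 1) ∧ᶠ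
        isSection (Y + 1) (X + 1) (R + 1) (n + 1) 0) p (.andI hp hs)))) ?_)))
    simp [Fml.inst, Fml.rename]

/-- The constructible hierarchy is the ordinal recursion whose `ρ(z, x)` is `x ∈ Def(z)`. -/
theorem isRec_inDef (α y : ℕ) : isRec (inDef 0 1) α y = isLevel α y := rfl

/-! ### Definability of relations -/

theorem Derives.isRel_congr {z n X : ℕ} (h : Γ ⊢ isRel z n X ψ)
    (e : ∀ {Δ} [Step Γ Δ] s, (Δ ⊢ isSeq s n X) → (Δ ⊢ ψ.inst s ↔ᶠ χ.inst s)) :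
    Γ ⊢ isRel z n X χ :=
  have e := fun s => imp_intro (e s)
  h.rel_obtain fun {Δ} _ R hz hR => isRel_intro R hz fun s => iff_intro
    (fun {Θ} _ hs =>
      have hs : Θ ⊢ isSeq s n X ∧ᶠ ψ.inst s := (hR s).up.iff_mp hs
      .andI hs.left (((e s).up.mp hs.left).iff_mp hs.right))
    fun {Θ} _ hs => (hR s).up.iff_mpr (.andI hs.left (((e s).up.mp hs.left).iff_mpr hs.right))

/-- The relation `{s ∈ Xⁿ | ψ(s)}` belongs to `D`, where `s` is the variable `0` of `ψ`. -/
def isDefinable (n X D : ℕ) (ψ : Fml) : Fml :=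
  bex D (isRel 0 (n + 1) (X + 1) (ψ.rename (lift (· + 1))))

@[simp] theorem rename_isDefinable (f : ℕ → ℕ) (n X D : ℕ) (ψ : Fml) :
    (isDefinable n X D ψ).rename f = isDefinable (f n) (f X) (f D) (ψ.rename (lift f)) := by
  simp only [isDefinable, rename_bex, rename_isRel, Fml.rename_rename]
  rw [Fml.rename_ext ψ (g := cons 0 fun n => f n + 2) (by rintro (_ | n) <;> rfl),
    Fml.rename_ext ψ (f := fun n => lift (· + 1) _) (g := cons 0 fun n => f n + 2)
      (by rintro (_ | n) <;> rfl)]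
  rfl

theorem isDefinable_body (z n X : ℕ) (ψ : Fml) :
    (isRel 0 (n + 1) (X + 1) (ψ.rename (lift (· + 1)))).inst z = isRel z n X ψ := by
  rw [Fml.inst, rename_isRel, Fml.rename_rename,
    Fml.rename_ext ψ (g := fun n => n) (by rintro (_ | n) <;> rfl), Fml.rename_id]
  rfl

theorem isDefinable_intro {n X D z : ℕ} (hz : Γ ⊢ z ∈ᶠ D) (h : Γ ⊢ isRel z n X ψ) :
    Γ ⊢ isDefinable n X D ψ := bex_intro z hz (h.of_eq (isDefinable_body z n X ψ).symm)

theorem Derives.isDefinable_elim {n X D : ℕ} (h : Γ ⊢ isDefinable n X D ψ)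
    (k : ∀ {Δ} [Step Γ Δ] R, (Δ ⊢ pairMem n R D) →
      (∀ s, Δ ⊢ s ∈ᶠ R ↔ᶠ isSeq s n X ∧ᶠ ψ.inst s) → (Δ ⊢ χ)) : Γ ⊢ χ :=
  Derives.obtain_mem h fun {_} st z hz h => (h.of_eq (isDefinable_body z n X ψ)).rel_obtain
    fun {_} st' R hR h => have := step_trans st st'; k R (pairMem_intro z hz.up hR) h

/-- The clauses yield relations in a fixed form `ψ`; only their extension on `Xⁿ` matters, so `ψ`
may be exchanged for any `χ` equivalent there, even an unbounded one. -/
theorem isDefinable_of_step {w n X D : ℕ} (hw : Γ ⊢ isOmega w) (hD : Γ ⊢ isClosed X D)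
    (hn : Γ ⊢ n ∈ᶠ w) (hψ : IsBounded ψ)
    (h : ∀ {Δ} [Step Γ Δ] z, (Δ ⊢ isRel z n X ψ) → (Δ ⊢ step w X D z))
    (e : ∀ {Δ} [Step Γ Δ] s, (Δ ⊢ isSeq s n X) → (Δ ⊢ ψ.inst s ↔ᶠ χ.inst s)) :
    Γ ⊢ isDefinable n X D χ :=
  have e := fun s => imp_intro (e s)
  exists_rel hw hn X hψ fun z hz => isDefinable_intro (hw.up.closed_step hD.up (h z hz))
    (hz.isRel_congr fun s hs => (e s).up.mp hs)

theorem Derives.isDefinable_congr {n X D : ℕ} (h : Γ ⊢ isDefinable n X D ψ)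
    (h₁ : ∀ {Δ} [Step Γ Δ] s, (Δ ⊢ isSeq s n X) → (Δ ⊢ ψ.inst s) → (Δ ⊢ χ.inst s))
    (h₂ : ∀ {Δ} [Step Γ Δ] s, (Δ ⊢ isSeq s n X) → (Δ ⊢ χ.inst s) → (Δ ⊢ ψ.inst s)) :
    Γ ⊢ isDefinable n X D χ :=
  have h₁ := fun s => imp_intro₂ (h₁ s)
  have h₂ := fun s => imp_intro₂ (h₂ s)
  Derives.obtain_mem h fun z hz h => isDefinable_intro hz
    ((h.of_eq (isDefinable_body z n X ψ)).isRel_congr fun s hs => iff_intro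
      (fun hψ => (h₁ s).up.mp₂ hs.up hψ) fun hχ => (h₂ s).up.mp₂ hs.up hχ)

theorem iff_refl : Γ ⊢ φ ↔ᶠ φ := iff_intro (fun h => h) fun h => h

theorem isDefinable_bot {w n X D : ℕ} (hw : Γ ⊢ isOmega w) (hD : Γ ⊢ isClosed X D)
    (hn : Γ ⊢ n ∈ᶠ w) : Γ ⊢ isDefinable n X D .bot :=
  isDefinable_of_step hw hD hn .bot (fun z hz => step_bot hn.up hz) fun s _ => iff_refl

theorem isDefinable_eq {w n X D i j : ℕ} (hw : Γ ⊢ isOmega w) (hD : Γ ⊢ isClosed X D)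
    (hn : Γ ⊢ n ∈ᶠ w) (hi : Γ ⊢ i ∈ᶠ n) (hj : Γ ⊢ j ∈ᶠ n) :
    Γ ⊢ isDefinable n X D (relEq i j X) :=
  isDefinable_of_step hw hD hn (isBounded_relEq i j X)
    (fun z hz => step_eq hn.up hi.up hj.up hz) fun s _ => iff_refl

theorem isDefinable_mem {w n X D i j : ℕ} (hw : Γ ⊢ isOmega w) (hD : Γ ⊢ isClosed X D)
    (hn : Γ ⊢ n ∈ᶠ w) (hi : Γ ⊢ i ∈ᶠ n) (hj : Γ ⊢ j ∈ᶠ n) :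
    Γ ⊢ isDefinable n X D (relMem i j X) :=
  isDefinable_of_step hw hD hn (isBounded_relMem i j X)
    (fun z hz => step_mem hn.up hi.up hj.up hz) fun s _ => iff_refl

theorem Derives.isDefinable_and {w n X D : ℕ} (hw : Γ ⊢ isOmega w) (hD : Γ ⊢ isClosed X D)
    (hn : Γ ⊢ n ∈ᶠ w) (hψ : Γ ⊢ isDefinable n X D ψ) (hχ : Γ ⊢ isDefinable n X D χ) :
    Γ ⊢ isDefinable n X D (ψ ∧ᶠ χ) :=
  hψ.isDefinable_elim fun R hR hR' => hχ.up.isDefinable_elim fun S hS hS' =>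
    isDefinable_of_step (ψ := 0 ∈ᶠ (R + 1) ∧ᶠ 0 ∈ᶠ (S + 1)) hw.up hD.up hn.up
      (.and (.mem _ _) (.mem _ _)) (fun z hz => step_and hn.up hR.up hS.up hz) fun s hs => iff_intro
        (fun h => .andI ((hR' s).up.iff_mp (Derives.left h)).right
          ((hS' s).up.iff_mp (Derives.right h)).right)
        fun h => .andI ((hR' s).up.iff_mpr (.andI hs.up (Derives.left h)))
          ((hS' s).up.iff_mpr (.andI hs.up (Derives.right h)))

theorem Derives.isDefinable_or {w n X D : ℕ} (hw : Γ ⊢ isOmega w) (hD : Γ ⊢ isClosed X D)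
    (hn : Γ ⊢ n ∈ᶠ w) (hψ : Γ ⊢ isDefinable n X D ψ) (hχ : Γ ⊢ isDefinable n X D χ) :
    Γ ⊢ isDefinable n X D (ψ ∨ᶠ χ) :=
  hψ.isDefinable_elim fun R hR hR' => hχ.up.isDefinable_elim fun S hS hS' =>
    isDefinable_of_step (ψ := 0 ∈ᶠ (R + 1) ∨ᶠ 0 ∈ᶠ (S + 1)) hw.up hD.up hn.up
      (.or (.mem _ _) (.mem _ _)) (fun z hz => step_or hn.up hR.up hS.up hz) fun s hs => iff_intro
        (fun h => Derives.cases h (fun h => .orI₁ ((hR' s).up.iff_mp h).right)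
          fun h => .orI₂ ((hS' s).up.iff_mp h).right)
        fun h => Derives.cases h (fun h => .orI₁ ((hR' s).up.iff_mpr (.andI hs.up h)))
          fun h => .orI₂ ((hS' s).up.iff_mpr (.andI hs.up h))

theorem Derives.isDefinable_imp {w n X D : ℕ} (hw : Γ ⊢ isOmega w) (hD : Γ ⊢ isClosed X D)
    (hn : Γ ⊢ n ∈ᶠ w) (hψ : Γ ⊢ isDefinable n X D ψ) (hχ : Γ ⊢ isDefinable n X D χ) :
    Γ ⊢ isDefinable n X D (ψ →ᶠ χ) :=
  hψ.isDefinable_elim fun R hR hR' => hχ.up.isDefinable_elim fun S hS hS' =>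
    isDefinable_of_step (ψ := 0 ∈ᶠ (R + 1) →ᶠ 0 ∈ᶠ (S + 1)) hw.up hD.up hn.up
      (.imp (.mem _ _) (.mem _ _)) (fun z hz => step_imp hn.up hR.up hS.up hz) fun s hs => iff_intro
        (fun h => imp_intro fun h' =>
          ((hS' s).up.iff_mp (Derives.mp h.up ((hR' s).up.iff_mpr (.andI hs.up h')))).right)
        fun h => imp_intro fun h' => (hS' s).up.iff_mpr (.andI hs.up
          (Derives.mp h.up ((hR' s).up.iff_mp h').right))

/-- The two hypotheses say that `χ(s)` holds iff `ψ` holds of every extension of `s` by an element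
of `X`. This allows `χ` to be a natural statement about the values of `s`, with the quantifier over
`X` hidden. -/
theorem Derives.isDefinable_all {w n m X D : ℕ} (hw : Γ ⊢ isOmega w) (hD : Γ ⊢ isClosed X D)
    (hn : Γ ⊢ n ∈ᶠ w) (hm : Γ ⊢ isSucc m n) (hψ : Γ ⊢ isDefinable m X D ψ)
    (h₁ : ∀ {Δ} [Step Γ Δ] s a t, (Δ ⊢ isSeq s n X) → (Δ ⊢ a ∈ᶠ X) → (Δ ⊢ isSnoc t s n a) →
      (Δ ⊢ χ.inst s) → (Δ ⊢ ψ.inst t))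
    (h₂ : ∀ {Δ} [Step Γ Δ] s, (Δ ⊢ isSeq s n X) → (∀ {Θ} [Ext Δ Θ] a t, (Θ ⊢ a ∈ᶠ X) →
      (Θ ⊢ isSnoc t s n a) → (Θ ⊢ ψ.inst t)) → (Δ ⊢ χ.inst s)) :
    Γ ⊢ isDefinable n X D χ := by
  refine hψ.isDefinable_elim fun {Δ} st R hR hR' => ?_
  refine isDefinable_of_step hw.up hD.up hn.up (isBounded_relAll n X R)
    (fun z hz => step_all hn.up (hw.up.succ_mem_omega hn.up hm.up) hm.up hR.up hz)
    fun {Θ} st' s hs => ?_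
  have := step_trans st st'
  show Θ ⊢ ball X (bex (R + 1) (isSnoc 0 (s + 2) (n + 2) 1)) ↔ᶠ χ.inst s
  refine iff_intro (fun {Ξ} st'' h => ?_) fun {Ξ} st'' h => ball_intro fun {Ξ'} st₃ a ha => ?_
  · have := step_trans (step_trans st st') st''
    refine h₂ s hs.up fun {Ξ'} _ a t ha ht => ?_
    have hR' : Ξ ⊢ t ∈ᶠ R ↔ᶠ isSeq t m X ∧ᶠ ψ.inst t := (hR' t).up
    refine Derives.obtain_mem (h.up.ball_elim ha) fun {Ξ''} _ t' ht' (h' : Ξ'' ⊢ isSnoc t' s n a) => ?_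
    exact (hR'.up.iff_mp ((h'.snoc_unique ht.up).mem_left ht')).right
  · have := step_trans (step_trans st st') (step_trans st'' st₃)
    show Ξ' ⊢ bex R (isSnoc 0 (s + 1) (n + 1) (a + 1))
    have h₁ : ∀ t, Ξ' ⊢ isSnoc t s n a →ᶠ ψ.inst t := fun t => imp_intro fun {Ω} st₄ ht =>
      have := step_trans this st₄
      h₁ s a t hs.up ha.up ht h.up
    exact exists_snoc s n a fun t ht => bex_intro t ((hR' t).up.iff_mpr
      (.andI (ht.snoc_seq hs.up ha.up hm.up) ((h₁ t).up.mp ht))) ht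

/-! ### Definability of the range of a finite sequence -/

theorem Derives.relMem_elim {i j X s : ℕ} (h : Γ ⊢ (relMem i j X).inst s)
    (k : ∀ {Δ} [Step Γ Δ] a b, (Δ ⊢ pairMem i a s) → (Δ ⊢ pairMem j b s) → (Δ ⊢ a ∈ᶠ b) →
      (Δ ⊢ χ)) : Γ ⊢ χ :=
  Derives.obtain_mem h fun {_} st a ha h => Derives.obtain_mem h fun {Δ} st' b hb
    (h : Δ ⊢ pairMem i a s ∧ᶠ pairMem j b s ∧ᶠ a ∈ᶠ b) =>
      have := step_trans st st'
      k a b h.left h.right.left h.right.right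

theorem relMem_intro {i j X s a b : ℕ} (ha : Γ ⊢ a ∈ᶠ X) (hb : Γ ⊢ b ∈ᶠ X)
    (hi : Γ ⊢ pairMem i a s) (hj : Γ ⊢ pairMem j b s) (h : Γ ⊢ a ∈ᶠ b) :
    Γ ⊢ (relMem i j X).inst s :=
  bex_intro a ha (bex_intro b hb (show Γ ⊢ pairMem i a s ∧ᶠ pairMem j b s ∧ᶠ a ∈ᶠ b from
    .andI hi (.andI hj h)))

theorem Derives.relEq_elim {i j X s : ℕ} (h : Γ ⊢ (relEq i j X).inst s)
    (k : ∀ {Δ} [Step Γ Δ] a, (Δ ⊢ pairMem i a s) → (Δ ⊢ pairMem j a s) → (Δ ⊢ χ)) : Γ ⊢ χ :=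
  Derives.obtain_mem h fun {Δ} st a ha (h : Δ ⊢ pairMem i a s ∧ᶠ pairMem j a s) =>
      k a h.left h.right

theorem relEq_intro {i j X s a : ℕ} (ha : Γ ⊢ a ∈ᶠ X) (hi : Γ ⊢ pairMem i a s)
    (hj : Γ ⊢ pairMem j a s) : Γ ⊢ (relEq i j X).inst s :=
  bex_intro a ha (show Γ ⊢ pairMem i a s ∧ᶠ pairMem j a s from .andI hi hj)

theorem Derives.snoc_val {t s n a i b : ℕ} (h : Γ ⊢ isSnoc t s n a) (hi : Γ ⊢ i ∈ᶠ n)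
    (hb : Γ ⊢ pairMem i b t) : Γ ⊢ pairMem i b s :=
  (h.snoc_pair hb).cases (fun h => h) fun e => not_mem_self n (e.left.mem_left hi.up)

theorem Derives.snoc_last {t s n a b X : ℕ} (h : Γ ⊢ isSnoc t s n a) (hs : Γ ⊢ isSeq s n X)
    (hb : Γ ⊢ pairMem n b t) : Γ ⊢ b ≡ᶠ a :=
  (h.snoc_pair hb).cases (fun h => not_mem_self n (hs.up.seq_dom h).left) fun e => e.right

/-- The relation `s(k) ∈ {s(0), …, s(k-1)}` is the disjunction of the equations `s(i) = s(k)`. As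
`k` is a natural number of the object theory, the disjunction is built by an induction inside CZF,
starting from `⊥`. -/
theorem isDefinable_range {w k m X D : ℕ} (hw : Γ ⊢ isOmega w) (hD : Γ ⊢ isClosed X D)
    (hk : Γ ⊢ k ∈ᶠ w) (hm : Γ ⊢ isSucc m k) :
    Γ ⊢ isDefinable m X D (bex (k + 1) (.ex (pairMem 1 0 2 ∧ᶠ pairMem (k + 3) 0 2))) := by
  have hinst : ∀ j, (sub 0 (k + 1) →ᶠ isDefinable (m + 1) (X + 1) (D + 1) (bex 1
      (.ex (pairMem 1 0 2 ∧ᶠ pairMem (k + 4) 0 2)))).inst j = (sub j k →ᶠ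
        isDefinable m X D (bex (j + 1) (.ex (pairMem 1 0 2 ∧ᶠ pairMem (k + 3) 0 2)))) := by
    intro j
    simp [Fml.inst, Fml.rename]
  -- The induction replaces the bound `k` of the disjunction by `j`, while the last index and the
  -- arity stay fixed; `j ⊆ k` keeps all indices within the arity.
  have key : Γ ⊢ sub k k →ᶠ
      isDefinable m X D (bex (k + 1) (.ex (pairMem 1 0 2 ∧ᶠ pairMem (k + 3) 0 2))) := by
    rw [← hinst]
    refine omega_induction _ hw (fun {Δ} _ e he => ?_) (fun {Δ} _ j j' hj hj' ih => ?_) hk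
    · rw [hinst]
      exact imp_intro fun _ => (isDefinable_bot hw.up hD.up
        (hw.up.succ_mem_omega hk.up hm.up)).isDefinable_congr (fun s _ h => .botE h)
          fun s _ h => Derives.obtain_mem h fun i hi _ => he.up.isEmpty_elim hi
    · rw [hinst] at ih ⊢
      refine imp_intro fun {Δ} _ hs => (Derives.isDefinable_or hw.up hD.up
        (hw.up.succ_mem_omega hk.up hm.up)
        (ih.up.mp (sub_intro fun i hi => hs.up.sub_elim (hj'.up.sub_succ.sub_elim hi)))
        (isDefinable_eq (i := j) (j := k) hw.up hD.up (hw.up.succ_mem_omega hk.up hm.up)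
          (hm.up.sub_succ.sub_elim (hs.sub_elim hj'.up.self_mem_succ)) hm.up.self_mem_succ)
        ).isDefinable_congr (fun {Δ} _ s hs h => Derives.cases h
          (fun {Θ} _ h => Derives.obtain_mem h fun i hi h => bex_intro i
            (hj'.up.sub_succ.sub_elim hi) h)
          fun {Θ} _ h => h.relEq_elim fun {Ω} _ a h h' => bex_intro j hj'.up.self_mem_succ
            (.exI a (show Ω ⊢ pairMem j a s ∧ᶠ pairMem k a s from .andI h h')))
        fun {Δ} _ s hs h => Derives.obtain_mem h fun {Δ} _ i hi h => Derives.obtain h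
          fun {Θ} _ a (h : Θ ⊢ pairMem i a s ∧ᶠ pairMem k a s) => (hj'.up.mem_succ hi.up).cases
            (fun {Ω} _ hi => .orI₁ (bex_intro i hi (.exI a h.up)))
            fun {Ω} _ e => .orI₂ (relEq_intro (hs.up.seq_dom h.up.left).right
              (e.pairMem_fst h.up.left) h.up.right)
  exact key.mp (sub_refl k)

/-- The range of a finite sequence is a definable subset. -/
theorem inDef_range {w k X Y p : ℕ} (hw : Γ ⊢ isOmega w) (hk : Γ ⊢ k ∈ᶠ w)
    (hp : Γ ⊢ isSeq p k X) (h₁ : ∀ {Δ} [Step Γ Δ] i a, (Δ ⊢ pairMem i a p) → (Δ ⊢ a ∈ᶠ Y))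
    (h₂ : ∀ {Δ} [Step Γ Δ] a, (Δ ⊢ a ∈ᶠ Y) → (Δ ⊢ bex k (pairMem 0 (a + 1) (p + 1)))) :
    Γ ⊢ inDef X Y := by
  have h₁ := fun i a => imp_intro (h₁ i a)
  have h₂ := fun a => imp_intro (h₂ a)
  have hYX : Γ ⊢ sub Y X := sub_intro fun {Δ} _ a ha => ((h₂ a).up.mp ha).obtain_mem
    fun {Δ} _ i hi (h : Δ ⊢ pairMem i a p) => (hp.up.seq_dom h).right
  refine exists_succ k fun {Δ} _ m hm => exists_defRels hw.up X fun {Δ} _ D hD _ =>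
    (isDefinable_range hw.up hD.left hk.up hm.up).isDefinable_elim fun {Δ} _ R hR hR' => ?_
  replace hR' : ∀ t, Δ ⊢ t ∈ᶠ R ↔ᶠ isSeq t m X ∧ᶠ bex k (.ex (pairMem 1 0 (t + 2) ∧ᶠ
    pairMem (k + 2) 0 (t + 2))) := hR'
  refine inDef_intro hw.up hD.up hk.up hm.up hR hp.up (isSection_intro
    (fun {Θ} _ a t ha ht h => ?_) (fun a ha => hYX.up.sub_elim ha) fun {Θ} _ a t ha ht => ?_)
  · refine (((hR' t).up.iff_mp ht).right.obtain_mem fun {Θ} _ i hi h' => Derives.obtain h'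
      fun {Θ} _ b (h' : Θ ⊢ pairMem i b t ∧ᶠ pairMem k b t) => ?_)
    exact (h.up.snoc_last hp.up h'.right).mem_left
      ((h₁ i b).up.mp (h.up.snoc_val hi.up h'.left))
  · refine (hR' t).up.iff_mpr (.andI (ht.snoc_seq hp.up (hYX.up.sub_elim ha) hm.up)
      (((h₂ a).up.mp ha).obtain_mem fun {Ω} _ i hi (h : Ω ⊢ pairMem i a p) => bex_intro i hi
        (.exI a (show Ω ⊢ pairMem i a t ∧ᶠ pairMem k a t from
          .andI (ht.up.left.pairMem_mono h) ht.up.right.left))))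

/-! ### Definability of the class of ordinals -/

/-- `s(i)` is transitive. -/
def relTrans (i : ℕ) : Fml := .all (pairMem (i + 2) 0 1 →ᶠ isTrans 0)

/-- `s(j) ∈ s(i)` implies `s(j) ⊆ s(i)`. -/
def relMemSub (i j : ℕ) : Fml :=
  .all (.all (pairMem (i + 3) 1 2 →ᶠ pairMem (j + 3) 0 2 →ᶠ 0 ∈ᶠ 1 →ᶠ sub 0 1))

theorem relTrans_intro {i s : ℕ} (h : ∀ {Δ} [Step Γ Δ] x, (Δ ⊢ pairMem i x s) → (Δ ⊢ isTrans x)) :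
    Γ ⊢ (relTrans i).inst s :=
  .all_intro fun x => show Γ ⊢ pairMem i x s →ᶠ isTrans x from imp_intro fun hx => h x hx

theorem Derives.relTrans_elim {i s x : ℕ} (h : Γ ⊢ (relTrans i).inst s)
    (hx : Γ ⊢ pairMem i x s) : Γ ⊢ isTrans x :=
  Derives.mp (φ := pairMem i x s) (Derives.spec h x) hx

theorem relMemSub_intro {i j s : ℕ} (h : ∀ {Δ} [Step Γ Δ] x y, (Δ ⊢ pairMem i x s) →
    (Δ ⊢ pairMem j y s) → (Δ ⊢ y ∈ᶠ x) → (Δ ⊢ sub y x)) : Γ ⊢ (relMemSub i j).inst s :=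
  .all_intro fun x => .all_intro fun y =>
    show Γ ⊢ pairMem i x s →ᶠ pairMem j y s →ᶠ y ∈ᶠ x →ᶠ sub y x from
      imp_intro₃ fun h₁ h₂ h₃ => h x y h₁ h₂ h₃

theorem Derives.relMemSub_elim {i j s x y : ℕ} (h : Γ ⊢ (relMemSub i j).inst s)
    (hx : Γ ⊢ pairMem i x s) (hy : Γ ⊢ pairMem j y s) (hyx : Γ ⊢ y ∈ᶠ x) : Γ ⊢ sub y x :=
  have h : Γ ⊢ pairMem i x s →ᶠ pairMem j y s →ᶠ y ∈ᶠ x →ᶠ sub y x := Derives.spec (Derives.spec h x) y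
  h.mp₃ hx hy hyx

/-- Expressed over `X` by `∀ z, s(j) ∈ s(i) → z ∈ s(j) → z ∈ s(i)`, with `z` at the new index `m`.
As `X` is transitive, all elements of `s(j)` lie in `X`, so the inclusion in `X` is the true one.
The next definability lemmas use transitivity in the same way. -/
theorem isDefinable_memSub {w m X D i j : ℕ} (hw : Γ ⊢ isOmega w) (hD : Γ ⊢ isClosed X D)
    (hX : Γ ⊢ isTrans X) (hm : Γ ⊢ m ∈ᶠ w) (hi : Γ ⊢ i ∈ᶠ m) (hj : Γ ⊢ j ∈ᶠ m) :
    Γ ⊢ isDefinable m X D (relMemSub i j) := by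
  refine exists_succ m fun {Γ'} _ l hl => ?_
  have hl' : Γ' ⊢ l ∈ᶠ w := hw.up.succ_mem_omega hm.up hl
  have hil : Γ' ⊢ i ∈ᶠ l := hl.sub_succ.sub_elim hi.up
  have hjl : Γ' ⊢ j ∈ᶠ l := hl.sub_succ.sub_elim hj.up
  refine Derives.isDefinable_all (ψ := relMem j i X →ᶠ relMem m j X →ᶠ relMem m i X) hw.up hD.up
    hm.up hl
    (Derives.isDefinable_imp hw.up hD.up hl'
      (isDefinable_mem hw.up hD.up hl' hjl hil) (Derives.isDefinable_imp hw.up hD.up hl'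
        (isDefinable_mem hw.up hD.up hl' hl.self_mem_succ hjl)
        (isDefinable_mem hw.up hD.up hl' hl.self_mem_succ hil)))
    (fun {Δ} _ s z t hs hz ht h => ?_) fun {Δ} _ s hs h => relMemSub_intro fun {Θ} _ x y hx hy hyx =>
      sub_intro fun {Θ} _ z hz => ?_
  · refine imp_intro₂ fun {Δ} _ h₁ h₂ => h₁.relMem_elim fun {Δ} _ y x hy hx hyx =>
      h₂.up.relMem_elim fun {Θ} _ z' y' hz' hy' hzy => ?_
    have hts := ht.up.snoc_seq hs.up hz.up hl.up (Γ := Θ)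
    have hzy : Θ ⊢ z' ∈ᶠ y := (hts.seq_unique hy' hy.up).mem_right hzy
    have hzx := (h.up.relMemSub_elim (ht.up.snoc_val hi.up hx.up)
      (ht.up.snoc_val hj.up hy.up) hyx.up).sub_elim hzy
    exact relMem_intro (hts.seq_dom hz').right (hts.seq_dom hx.up).right hz' hx.up hzx
  · have hyX : Θ ⊢ y ∈ᶠ X := (hs.up.seq_dom hy.up).right
    have hxX : Θ ⊢ x ∈ᶠ X := (hs.up.seq_dom hx.up).right
    have hzX : Θ ⊢ z ∈ᶠ X := hX.up.isTrans_elim hyX hz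
    refine exists_snoc s m z fun {Θ} _ t ht => ?_
    have hts := ht.snoc_seq hs.up hzX.up hl.up (Γ := Θ)
    have h' : Θ ⊢ (relMem j i X).inst t →ᶠ (relMem m j X).inst t →ᶠ (relMem m i X).inst t :=
      h z t hzX.up ht
    have hx' : Θ ⊢ pairMem i x t := ht.left.pairMem_mono hx.up
    have hy' : Θ ⊢ pairMem j y t := ht.left.pairMem_mono hy.up
    refine (h'.mp₂ (relMem_intro hyX.up hxX.up hy' hx' hyx.up)
      (relMem_intro hzX.up hyX.up ht.right.left hy' hz.up)).relMem_elim
      fun {Θ} _ z' x' hz' hx'' hzx => ?_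
    exact (hts.up.seq_unique hx'' hx'.up).mem_right
      ((ht.up.snoc_last hs.up hz').mem_left hzx)

theorem isDefinable_trans {w m X D i : ℕ} (hw : Γ ⊢ isOmega w) (hD : Γ ⊢ isClosed X D)
    (hX : Γ ⊢ isTrans X) (hm : Γ ⊢ m ∈ᶠ w) (hi : Γ ⊢ i ∈ᶠ m) :
    Γ ⊢ isDefinable m X D (relTrans i) := by
  refine exists_succ m fun {Γ'} _ l hl => ?_
  have hl' : Γ' ⊢ l ∈ᶠ w := hw.up.succ_mem_omega hm.up hl
  have hil : Γ' ⊢ i ∈ᶠ l := hl.sub_succ.sub_elim hi.up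
  refine Derives.isDefinable_all hw.up hD.up hm.up hl
    (isDefinable_memSub hw.up hD.up hX.up hl' hil hl.self_mem_succ)
    (fun {Δ} _ s y t hs hy ht h => ?_) fun {Δ} _ s hs h => relTrans_intro fun {Δ} _ x hx =>
      isTrans_intro fun {Θ} _ y z hy hz => ?_
  · exact relMemSub_intro fun x y hx hy hyx => (h.up.relTrans_elim
      (ht.up.snoc_val hi.up hx)).isTrans_sub hyx
  · have hyX : Θ ⊢ y ∈ᶠ X := hX.up.isTrans_elim (hs.up.seq_dom hx.up).right hy
    exact exists_snoc s m y fun t ht => ((h y t hyX.up ht).relMemSub_elim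
      (ht.left.pairMem_mono hx.up) ht.right.left hy.up).sub_elim hz.up

/-- All elements of `s(i)` are transitive. -/
def relElemsTrans (i : ℕ) : Fml := .all (pairMem (i + 2) 0 1 →ᶠ ball 0 (isTrans 0))

theorem relElemsTrans_intro {i s : ℕ} (h : ∀ {Δ} [Step Γ Δ] x y, (Δ ⊢ pairMem i x s) →
    (Δ ⊢ y ∈ᶠ x) → (Δ ⊢ isTrans y)) : Γ ⊢ (relElemsTrans i).inst s :=
  .all_intro fun x => show Γ ⊢ pairMem i x s →ᶠ ball x (isTrans 0) from
    imp_intro fun {_} st hx => ball_intro fun {_} st' y hy =>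
      have := step_trans st st'
      h x y hx.up hy

theorem Derives.relElemsTrans_elim {i s x y : ℕ} (h : Γ ⊢ (relElemsTrans i).inst s)
    (hx : Γ ⊢ pairMem i x s) (hy : Γ ⊢ y ∈ᶠ x) : Γ ⊢ isTrans y :=
  Derives.ball_elim (Derives.mp (φ := pairMem i x s) (ψ := ball x (isTrans 0))
    (Derives.spec h x) hx) hy

theorem isDefinable_elemsTrans {w m X D i : ℕ} (hw : Γ ⊢ isOmega w) (hD : Γ ⊢ isClosed X D)
    (hX : Γ ⊢ isTrans X) (hm : Γ ⊢ m ∈ᶠ w) (hi : Γ ⊢ i ∈ᶠ m) :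
    Γ ⊢ isDefinable m X D (relElemsTrans i) := by
  refine exists_succ m fun {Γ'} _ l hl => ?_
  have hl' : Γ' ⊢ l ∈ᶠ w := hw.up.succ_mem_omega hm.up hl
  have hil : Γ' ⊢ i ∈ᶠ l := hl.sub_succ.sub_elim hi.up
  refine Derives.isDefinable_all (ψ := relMem m i X →ᶠ relTrans m) hw.up hD.up hm.up hl
    (Derives.isDefinable_imp hw.up hD.up hl' (isDefinable_mem hw.up hD.up hl' hl.self_mem_succ hil)
      (isDefinable_trans hw.up hD.up hX.up hl' hl.self_mem_succ))
    (fun {Δ} _ s y t hs hy ht h => ?_) fun {Δ} _ s hs h =>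
      relElemsTrans_intro fun {Θ} _ x y hx hy => ?_
  · refine imp_intro fun {Δ} _ h' => relTrans_intro fun {Δ} _ z hz =>
      h'.up.relMem_elim fun {Θ} _ z' x hz' hx hzx => ?_
    have hts := ht.up.snoc_seq hs.up hy.up hl.up (Γ := Θ)
    exact h.up.relElemsTrans_elim (ht.up.snoc_val hi.up hx)
      ((hts.seq_unique hz' hz.up).mem_left hzx)
  · have hxX : Θ ⊢ x ∈ᶠ X := (hs.up.seq_dom hx).right
    have hyX : Θ ⊢ y ∈ᶠ X := hX.up.isTrans_elim hxX hy
    refine exists_snoc s m y fun {Θ} _ t ht => ?_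
    have h' : Θ ⊢ (relMem m i X).inst t →ᶠ (relTrans m).inst t := h y t hyX.up ht
    exact (h'.mp (relMem_intro hyX.up hxX.up ht.right.left (ht.left.pairMem_mono hx.up)
      hy.up)).relTrans_elim ht.right.left

/-- The ordinals in a transitive set form a definable subset. -/
theorem inDef_ord {w X Y : ℕ} (hw : Γ ⊢ isOmega w) (hX : Γ ⊢ isTrans X)
    (h : ∀ a, Γ ⊢ a ∈ᶠ Y ↔ᶠ a ∈ᶠ X ∧ᶠ isOrd a) : Γ ⊢ inDef X Y := by
  -- No parameters are needed: the parameter sequence is empty, of length `e = ∅`, and the defining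
  -- relation has arity `m = {∅}`.
  refine exists_empty fun {Δ} _ e he => exists_succ e fun {Δ} _ m hm =>
    exists_defRels hw.up X fun {Δ} _ D hD _ => ?_
  have he' : Δ ⊢ e ∈ᶠ w := hw.up.empty_mem_omega he.up
  have hm' : Δ ⊢ m ∈ᶠ w := hw.up.succ_mem_omega he' hm.up
  refine (Derives.isDefinable_and hw.up hD.left hm'
    (isDefinable_trans hw.up hD.left hX.up hm' hm.up.self_mem_succ)
    (isDefinable_elemsTrans hw.up hD.left hX.up hm' hm.up.self_mem_succ)).isDefinable_elim
    fun {Δ} _ R hR hR' => ?_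
  replace hR' : ∀ t, Δ ⊢ t ∈ᶠ R ↔ᶠ isSeq t m X ∧ᶠ (relTrans e).inst t ∧ᶠ
    (relElemsTrans e).inst t := hR'
  have hseq : Δ ⊢ isSeq e e X := he.up.empty_seq he.up
  refine inDef_intro hw.up hD.up he'.up hm.up hR hseq (isSection_intro
    (fun {Θ} _ a t ha ht hs => ?_) (fun a ha => ((h a).up.iff_mp ha).left) fun {Θ} _ a t ha ht => ?_)
  · have ht' := (hR' t).up.iff_mp ht
    exact (h a).up.iff_mpr (.andI ha (isOrd_intro (ht'.right.left.relTrans_elim hs.right.left)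
      fun y hy => ht'.up.right.right.relElemsTrans_elim hs.up.right.left hy))
  · have ha' : Θ ⊢ a ∈ᶠ X ∧ᶠ isOrd a := (h a).up.iff_mp ha
    have hts : Θ ⊢ isSeq t m X := ht.snoc_seq hseq.up ha'.left hm.up
    exact (hR' t).up.iff_mpr (.andI hts (.andI
      (relTrans_intro fun x hx =>
        (hts.up.seq_unique ht.up.right.left hx).subst (isTrans 0) ha'.up.right.left)
      (relElemsTrans_intro fun x y hx hy => ha'.up.right.right.ball_elim
        ((hts.up.seq_unique hx ht.up.right.left).mem_right hy))))

/-! ### Decidable formulas -/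

/-- `φ` is decided. -/
def dec (φ : Fml) : Fml := φ ∨ᶠ (φ →ᶠ .bot)

@[simp] theorem rename_dec (φ : Fml) (f : ℕ → ℕ) : (dec φ).rename f = dec (φ.rename f) := rfl

theorem dec_bot : Γ ⊢ dec .bot := .orI₂ (imp_intro fun h => h)

theorem Derives.dec_congr (h : Γ ⊢ dec φ) (h₁ : ∀ {Δ} [Step Γ Δ], (Δ ⊢ φ) → (Δ ⊢ ψ))
    (h₂ : ∀ {Δ} [Step Γ Δ], (Δ ⊢ ψ) → (Δ ⊢ φ)) : Γ ⊢ dec ψ :=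
  have h₂ := imp_intro h₂
  h.cases (fun h => .orI₁ (h₁ h)) fun h => .orI₂ (imp_intro fun h' => h.up.mp (h₂.up.mp h'))

theorem Derives.dec_and (h : Γ ⊢ dec φ) (h' : Γ ⊢ dec ψ) : Γ ⊢ dec (φ ∧ᶠ ψ) :=
  h.cases (fun h => h'.up.cases (fun h' => .orI₁ (.andI h.up h'))
    fun h' => .orI₂ (imp_intro fun h => h'.up.mp h.right))
    fun h => .orI₂ (imp_intro fun h' => h.up.mp h'.left)

theorem Derives.dec_or (h : Γ ⊢ dec φ) (h' : Γ ⊢ dec ψ) : Γ ⊢ dec (φ ∨ᶠ ψ) :=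
  h.cases (fun h => .orI₁ (.orI₁ h)) fun h => h'.up.cases (fun h' => .orI₁ (.orI₂ h'))
    fun h' => .orI₂ (imp_intro fun h'' => h''.cases (fun h'' => h.up.mp h'') fun h'' => h'.up.mp h'')

theorem Derives.dec_imp (h : Γ ⊢ dec φ) (h' : Γ ⊢ dec ψ) : Γ ⊢ dec (φ →ᶠ ψ) :=
  h'.cases (fun h' => .orI₁ (imp_intro fun _ => h'.up)) fun h' => h.up.cases
    (fun h => .orI₂ (imp_intro fun h'' => h'.up.mp (h''.mp h.up)))
    fun h => .orI₁ (imp_intro fun h'' => (h.up.mp h'').absurd)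

/-! ### Finite sets -/

/-- `Z = Y ∪ {b}`. -/
def isInsert (Z Y b : ℕ) : Fml := sub Y Z ∧ᶠ b ∈ᶠ Z ∧ᶠ ball Z (0 ∈ᶠ (Y + 1) ∨ᶠ 0 ≡ᶠ (b + 1))

theorem Derives.insert_cases {Z Y b z : ℕ} (h : Γ ⊢ isInsert Z Y b) (hz : Γ ⊢ z ∈ᶠ Z) :
    Γ ⊢ z ∈ᶠ Y ∨ᶠ z ≡ᶠ b := h.right.right.ball_elim hz

theorem isInsert_intro {Z Y b : ℕ} (h : ∀ z, Γ ⊢ z ∈ᶠ Z ↔ᶠ z ∈ᶠ Y ∨ᶠ z ≡ᶠ b) :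
    Γ ⊢ isInsert Z Y b :=
  .andI (sub_intro fun z hz => (h z).up.iff_mpr (.orI₁ hz))
    (.andI ((h b).iff_mpr (.orI₂ (.eqI b))) (ball_intro fun z hz => (h z).up.iff_mp hz))

theorem exists_isInsert (Y b : ℕ) (k : ∀ {Δ} [Step Γ Δ] Z, (Δ ⊢ isInsert Z Y b) → (Δ ⊢ χ)) :
    Γ ⊢ χ := exists_insert Y b fun Z hZ => k Z (isInsert_intro hZ)

theorem Derives.insert_sub {Z Y b X : ℕ} (h : Γ ⊢ isInsert Z Y b) (hY : Γ ⊢ sub Y X)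
    (hb : Γ ⊢ b ∈ᶠ X) : Γ ⊢ sub Z X :=
  sub_intro fun _ hz => (h.up.insert_cases hz).cases (fun hz => hY.up.sub_elim hz)
    fun e => e.symm.mem_left hb.up

theorem Derives.insert_unique {Z Z' Y b : ℕ} (h : Γ ⊢ isInsert Z Y b) (h' : Γ ⊢ isInsert Z' Y b) :
    Γ ⊢ Z ≡ᶠ Z' :=
  (h.insert_sub h'.left h'.right.left).antisymm (h'.insert_sub h.left h.right.left)

/-- `Y` is finite, where `w = ω`. -/
def isFin (w Y : ℕ) : Fml :=
  bex w (.ex (isSeq 0 1 (Y + 2) ∧ᶠ ball (Y + 2) (bex 2 (pairMem 0 1 2))))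

/-- Enumerations may repeat elements, so this finiteness does not entail decidable equality; where
equality must be decided, that is a separate hypothesis. -/
theorem isFin_intro {w Y n p : ℕ} (hn : Γ ⊢ n ∈ᶠ w) (hp : Γ ⊢ isSeq p n Y)
    (h : ∀ {Δ} [Step Γ Δ] y, (Δ ⊢ y ∈ᶠ Y) → (Δ ⊢ bex n (pairMem 0 (y + 1) (p + 1)))) :
    Γ ⊢ isFin w Y :=
  bex_intro n hn (.exI p (show Γ ⊢ isSeq p n Y ∧ᶠ ball Y (bex (n + 1) (pairMem 0 1 (p + 2))) from
    .andI hp (ball_intro h)))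

theorem Derives.isFin_elim {w Y : ℕ} (h : Γ ⊢ isFin w Y)
    (k : ∀ {Δ} [Step Γ Δ] n p, (Δ ⊢ n ∈ᶠ w) → (Δ ⊢ isSeq p n Y) →
      (Δ ⊢ ball Y (bex (n + 1) (pairMem 0 1 (p + 2)))) → (Δ ⊢ χ)) : Γ ⊢ χ :=
  Derives.obtain_mem h fun {_} st n hn h => Derives.obtain h fun {Δ} st' p
    (h : Δ ⊢ isSeq p n Y ∧ᶠ ball Y (bex (n + 1) (pairMem 0 1 (p + 2)))) =>
      have := step_trans st st'
      k n p hn.up h.left h.right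

theorem empty_fin {w e : ℕ} (hw : Γ ⊢ isOmega w) (he : Γ ⊢ isEmpty e) : Γ ⊢ isFin w e :=
  isFin_intro (hw.empty_mem_omega he) (he.empty_seq he) fun y hy => he.up.isEmpty_elim hy

theorem Derives.insert_fin {w Z Y b : ℕ} (hw : Γ ⊢ isOmega w) (h : Γ ⊢ isInsert Z Y b)
    (hY : Γ ⊢ isFin w Y) : Γ ⊢ isFin w Z :=
  hY.isFin_elim fun n p hn hp hs => exists_succ n fun m hm => exists_snoc p n b fun {Δ} _ t ht =>
    isFin_intro (hw.up.succ_mem_omega hn.up hm.up) (ht.snoc_seq (hp.up.seq_mono h.up.left)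
      h.up.right.left hm.up) fun {Δ} _ z hz => (h.up.insert_cases hz).cases
        (fun hz => (hs.up.ball_elim hz).obtain_mem fun {Θ} _ i hi (h : Θ ⊢ pairMem i z p) =>
          bex_intro i (hm.up.sub_succ.sub_elim hi) (ht.up.left.pairMem_mono h))
        fun e => bex_intro n hm.up.self_mem_succ (e.symm.pairMem_snd ht.up.right.left)

/-- Induction on finite sets, for arbitrary formulas. -/
theorem fin_induction (φ : Fml) {w Y : ℕ} (hw : Γ ⊢ isOmega w)
    (h₀ : ∀ {Δ} [Step Γ Δ] e, (Δ ⊢ isEmpty e) → (Δ ⊢ φ.inst e))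
    (hs : ∀ {Δ} [Step Γ Δ] Y Z b, (Δ ⊢ isFin w Y) → (Δ ⊢ isInsert Z Y b) → (Δ ⊢ φ.inst Y) →
      (Δ ⊢ φ.inst Z)) (hY : Γ ⊢ isFin w Y) : Γ ⊢ φ.inst Y := by
  have h₀ := fun e => imp_intro (h₀ e)
  have hs := fun Y Z b => imp_intro₃ (hs Y Z b)
  have hinst : ∀ n Y p, (((isSeq 0 2 1 →ᶠ ball 1 (bex 3 (pairMem 0 1 2)) →ᶠ
      φ.rename (cons 1 (· + 3))).rename (lift (lift (cons n fun n => n)))).rename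
        (lift (cons Y fun n => n))).inst p =
      (isSeq p n Y →ᶠ ball Y (bex (n + 1) (pairMem 0 1 (p + 2))) →ᶠ φ.inst Y) := by
    intro n Y p
    simp only [Fml.inst, Fml.rename, Fml.rename_rename]
    rw [Fml.rename_ext φ (g := cons Y fun n => n) (by rintro (_ | n) <;> rfl)]
    rfl
  refine hY.isFin_elim fun {Δ} _ n p hn hp hpY => ?_
  -- Induction on the length of an enumeration, for all sets and enumerations simultaneously.
  have key := omega_induction (.all (.all (isSeq 0 2 1 →ᶠ ball 1 (bex 3 (pairMem 0 1 2)) →ᶠ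
    φ.rename (cons 1 (· + 3))))) (hw.up (Δ := Δ)) (fun {Δ} _ e he => .all_intro fun Y =>
      .all_intro fun p => ?_) (fun {Δ} _ n m hn hm ih => .all_intro fun Y =>
        .all_intro fun p => ?_) hn
  · exact ((Derives.spec (Derives.spec key Y) p).of_eq (hinst n Y p)).mp₂ hp hpY
  · refine Derives.of_eq (imp_intro₂ fun {Δ} _ hp hpY => (h₀ Y).up.mp
      (isEmpty_intro fun y hy => (hpY.up.ball_elim hy).obtain_mem fun i hi _ =>
        he.up.isEmpty_elim hi)) (hinst e Y p).symm
  -- Drop the last term `a`: with `Y'` the range of the rest, `Y = Y' ∪ {a}`. It is not asked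
  -- whether `a` already lies in `Y'`.
  · refine Derives.of_eq (imp_intro₂ fun {Δ} _ hp hpY => hp.seq_restrict hm.up
      fun {Δ} _ s a hs' ha hsp => (isSet_separation (φ := bex (n + 1) (pairMem 0 1 (s + 2))) Y
        (.bex _ (isBounded_pairMem _ _ _))).isSet_elim fun {Δ} _ Y' hY' => ?_) (hinst m Y p).symm
    replace hY' : ∀ y, Δ ⊢ y ∈ᶠ Y' ↔ᶠ y ∈ᶠ Y ∧ᶠ bex n (pairMem 0 (y + 1) (s + 1)) := hY'
    have hi : ∀ {Θ} [Ext Δ Θ] i y, (Θ ⊢ pairMem i y s) → (Θ ⊢ y ∈ᶠ Y') := fun {Θ} _ i y h =>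
      have hd := hs'.up.up (Γ := Δ).seq_dom h
      (hY' y).up.iff_mpr (.andI hd.right (bex_intro i hd.left h))
    have hsY' : Δ ⊢ isSeq s n Y' := isSeq_intro
      (fun q hq => hs'.up.seq_mem hq fun i y h h' hq' => bex_intro i h (bex_intro y
        (hi i y (pairMem_intro q hq.up hq')) hq'))
      (fun i h => hs'.up.seq_val h fun y _ h' => bex_intro y (hi i y h') h')
      fun i y z h h' => hs'.up.seq_unique h h'
    have hfin : Δ ⊢ ball Y' (bex (n + 1) (pairMem 0 1 (s + 2))) :=
      ball_intro fun y hy => ((hY' y).up.iff_mp hy).right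
    refine (hs Y' Y a).up.mp₃ (isFin_intro hn.up hsY' fun y hy => hfin.up.ball_elim hy)
      (.andI (sub_intro fun y hy => ((hY' y).up.iff_mp hy).left) (.andI ha.up
        (ball_intro fun {Θ} _ y hy => ?_)))
      (((Derives.spec (Derives.spec ih.up Y') s).of_eq (hinst n Y' s)).mp₂ hsY' hfin)
    exact (hpY.up.ball_elim hy).obtain_mem fun {Θ} _ i _ (h : Θ ⊢ pairMem i y p) =>
      (hsp.up.snoc_pair h).cases (fun h => .orI₁ (hi i y h)) fun e => .orI₂ e.right

theorem ball_inst (θ : Fml) (Y : ℕ) : (ball 0 (θ.rename (cons 0 (· + 2)))).inst Y = ball Y θ := by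
  simp only [ball, Fml.inst, Fml.rename, Fml.rename_rename]
  rw [Fml.rename_ext θ (g := fun n => n) (by rintro (_ | n) <;> rfl), Fml.rename_id]
  rfl

theorem bex_inst (θ : Fml) (Y : ℕ) : (bex 0 (θ.rename (cons 0 (· + 2)))).inst Y = bex Y θ := by
  simp only [bex, Fml.inst, Fml.rename, Fml.rename_rename]
  rw [Fml.rename_ext θ (g := fun n => n) (by rintro (_ | n) <;> rfl), Fml.rename_id]
  rfl

/-- A decidable property of the elements of a finite set either holds for some element or for
none. -/
theorem Derives.dec_bex {w Y : ℕ} (hw : Γ ⊢ isOmega w) (hY : Γ ⊢ isFin w Y)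
    (h : ∀ {Δ} [Step Γ Δ] y, (Δ ⊢ y ∈ᶠ Y) → (Δ ⊢ dec (θ.inst y))) : Γ ⊢ dec (bex Y θ) := by
  have hinst : ∀ Y, (ball 0 ((dec θ).rename (cons 0 (· + 2))) →ᶠ
      dec (bex 0 (θ.rename (cons 0 (· + 2))))).inst Y = (ball Y (dec θ) →ᶠ dec (bex Y θ)) :=
    fun Y => congrArg₂ Fml.imp (ball_inst _ Y) (congrArg dec (bex_inst _ Y))
  have key : Γ ⊢ ball Y (dec θ) →ᶠ dec (bex Y θ) := by
    rw [← hinst]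
    refine fin_induction _ hw (fun {Δ} _ e he => ?_) (fun {Δ} _ Y Z b hY hZ ih => ?_) hY
    · rw [hinst]
      exact imp_intro fun _ => .orI₂ (imp_intro fun h => h.obtain_mem fun y hy _ =>
        he.up.isEmpty_elim hy)
    · rw [hinst] at ih ⊢
      refine imp_intro fun {Δ} _ h => (ih.up.mp (ball_intro fun y hy =>
        h.up.ball_elim (hZ.up.left.sub_elim hy))).cases
          (fun h' => .orI₁ (h'.obtain_mem fun y hy h => bex_intro y (hZ.up.left.sub_elim hy) h))
          fun {Δ} _ h' => Derives.cases (h.up.ball_elim hZ.up.right.left)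
            (fun h => .orI₁ (bex_intro b hZ.up.right.left h))
            fun h => .orI₂ (imp_intro fun h'' => h''.obtain_mem fun z hz hθ =>
              (hZ.up.insert_cases hz).cases (fun hz => h'.up.mp (bex_intro z hz hθ.up))
                fun e => Derives.mp h.up (e.subst θ hθ.up))
  exact key.mp (ball_intro h)

/-- Look for a counterexample, which is decidable by `Derives.dec_bex`. If there is none, each
instance of `θ`, being decided, must hold. -/
theorem Derives.dec_ball {w Y : ℕ} (hw : Γ ⊢ isOmega w) (hY : Γ ⊢ isFin w Y)
    (h : ∀ {Δ} [Step Γ Δ] y, (Δ ⊢ y ∈ᶠ Y) → (Δ ⊢ dec (θ.inst y))) : Γ ⊢ dec (ball Y θ) :=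
  have h := fun y => imp_intro (h y)
  have h' : Γ ⊢ dec (bex Y (θ →ᶠ .bot)) := Derives.dec_bex hw hY fun y hy =>
    ((h y).up.mp hy).dec_imp dec_bot
  h'.cases (fun h' => h'.obtain_mem fun y hy h' => .orI₂ (imp_intro fun h =>
      Derives.mp h'.up (h.ball_elim hy.up)))
    fun h' => .orI₁ (ball_intro fun y hy => ((h y).up.mp hy).cases (fun h => h)
      fun h => (h'.up.mp (bex_intro y hy.up h)).absurd)

/-- A decidable subset of a finite set is finite. -/
theorem Derives.fin_of_dec {w Y Z : ℕ} (hw : Γ ⊢ isOmega w) (hY : Γ ⊢ isFin w Y)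
    (hs : Γ ⊢ sub Z Y) (h : ∀ {Δ} [Step Γ Δ] y, (Δ ⊢ y ∈ᶠ Y) → (Δ ⊢ dec (y ∈ᶠ Z))) :
    Γ ⊢ isFin w Z := by
  have key : Γ ⊢ .all (sub 0 (Y + 1) →ᶠ ball (Y + 1) (dec (0 ∈ᶠ 1)) →ᶠ isFin (w + 1) 0) := by
    refine fin_induction (.all (sub 0 1 →ᶠ ball 1 (dec (0 ∈ᶠ 1)) →ᶠ isFin (w + 2) 0)) hw
      (fun {Δ} _ e he => .all_intro fun Z => ?_)
      (fun {Δ} _ Y Y' b hY hY' ih => .all_intro fun Z => ?_) hY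
    · show Δ ⊢ sub Z e →ᶠ ball e (dec (0 ∈ᶠ (Z + 1))) →ᶠ isFin w Z
      exact imp_intro₂ fun hZ _ => empty_fin hw.up
        (isEmpty_intro fun z hz => he.up.isEmpty_elim (hZ.up.sub_elim hz))
    · show Δ ⊢ sub Z Y' →ᶠ ball Y' (dec (0 ∈ᶠ (Z + 1))) →ᶠ isFin w Z
      -- The part `Z₀ = Z ∩ Y` is finite by induction; deciding `b ∈ Z` shows that `Z` is `Z₀ ∪ {b}`
      -- or `Z₀`.
      refine imp_intro₂ fun {Δ} _ hZ hd => (isSet_separation (φ := 0 ∈ᶠ (Y + 1)) Z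
        (.mem _ _)).isSet_elim fun {Δ} _ Z₀ hZ₀ => ?_
      replace hZ₀ : ∀ z, Δ ⊢ z ∈ᶠ Z₀ ↔ᶠ z ∈ᶠ Z ∧ᶠ z ∈ᶠ Y := hZ₀
      have ih : Δ ⊢ sub Z₀ Y →ᶠ ball Y (dec (0 ∈ᶠ (Z₀ + 1))) →ᶠ isFin w Z₀ :=
        Derives.spec ih.up Z₀
      have hfin : Δ ⊢ isFin w Z₀ := ih.mp₂ (sub_intro fun z hz => ((hZ₀ z).up.iff_mp hz).right)
        (ball_intro fun {Θ} _ y hy =>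
          have hd : Θ ⊢ dec (y ∈ᶠ Z) := hd.up.ball_elim (hY'.up.left.sub_elim hy)
          hd.dec_congr (fun h => (hZ₀ y).up.iff_mpr (.andI h hy.up))
            fun h => ((hZ₀ y).up.iff_mp h).left)
      have hb : Δ ⊢ dec (b ∈ᶠ Z) := hd.up.ball_elim hY'.up.right.left
      refine hb.cases (fun {Θ} _ hb => Derives.insert_fin (Y := Z₀) (b := b) hw.up (.andI
        (sub_intro fun z hz => ((hZ₀ z).up.iff_mp hz).left) (.andI hb (ball_intro fun z hz =>
          (hY'.up.insert_cases (hZ.up.sub_elim hz)).cases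
            (fun h => .orI₁ ((hZ₀ z).up.iff_mpr (.andI hz.up h))) fun e => .orI₂ e))) hfin.up)
        fun {Θ} _ hb => ?_
      have e : Θ ⊢ Z₀ ≡ᶠ Z := Derives.antisymm (sub_intro fun z hz => ((hZ₀ z).up.iff_mp hz).left)
        (sub_intro fun z hz => (hY'.up.insert_cases (hZ.up.sub_elim hz)).cases
          (fun h => (hZ₀ z).up.iff_mpr (.andI hz.up h)) fun e =>
            (hb.up.mp (e.mem_left hz.up)).absurd)
      exact e.subst (isFin (w + 1) 0) hfin.up
  have key : Γ ⊢ sub Z Y →ᶠ ball Y (dec (0 ∈ᶠ (Z + 1))) →ᶠ isFin w Z := key.spec Z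
  exact key.mp₂ hs (ball_intro h)

theorem Derives.fin_union {w Y Z U : ℕ} (hw : Γ ⊢ isOmega w) (hY : Γ ⊢ isFin w Y)
    (hZ : Γ ⊢ isFin w Z) (hU : ∀ z, Γ ⊢ z ∈ᶠ U ↔ᶠ z ∈ᶠ Y ∨ᶠ z ∈ᶠ Z) : Γ ⊢ isFin w U := by
  have key : Γ ⊢ .all (.all (0 ∈ᶠ 1 ↔ᶠ 0 ∈ᶠ (Y + 2) ∨ᶠ 0 ∈ᶠ (Z + 2)) →ᶠ isFin (w + 1) 0) := by
    refine fin_induction (.all (.all (0 ∈ᶠ 1 ↔ᶠ 0 ∈ᶠ (Y + 3) ∨ᶠ 0 ∈ᶠ 2) →ᶠ isFin (w + 2) 0)) hw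
      (fun {Δ} _ e he => .all_intro fun U => ?_)
      (fun {Δ} _ Z Z' b hZ hZ' ih => .all_intro fun U => ?_) hZ
    · show Δ ⊢ .all (0 ∈ᶠ (U + 1) ↔ᶠ 0 ∈ᶠ (Y + 1) ∨ᶠ 0 ∈ᶠ (e + 1)) →ᶠ isFin w U
      refine imp_intro fun {Δ} _ hU => ?_
      have hU : ∀ z, Δ ⊢ z ∈ᶠ U ↔ᶠ z ∈ᶠ Y ∨ᶠ z ∈ᶠ e := fun z => Derives.spec hU z
      have e : Δ ⊢ Y ≡ᶠ U := Derives.antisymm (sub_intro fun z hz => (hU z).up.iff_mpr (.orI₁ hz))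
        (sub_intro fun z hz => ((hU z).up.iff_mp hz).cases (fun h => h)
          fun h => he.up.isEmpty_elim h)
      exact e.subst (isFin (w + 1) 0) hY.up
    · show Δ ⊢ .all (0 ∈ᶠ (U + 1) ↔ᶠ 0 ∈ᶠ (Y + 1) ∨ᶠ 0 ∈ᶠ (Z' + 1)) →ᶠ isFin w U
      refine imp_intro fun {Δ} _ hU => ?_
      have hU : ∀ z, Δ ⊢ z ∈ᶠ U ↔ᶠ z ∈ᶠ Y ∨ᶠ z ∈ᶠ Z' := fun z => Derives.spec hU z
      refine ((isSet_mem Y).isSet_or (isSet_mem Z) : Δ ⊢ _).isSet_elim fun {Θ} _ V hV => ?_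
      replace hV : ∀ z, Θ ⊢ z ∈ᶠ V ↔ᶠ z ∈ᶠ Y ∨ᶠ z ∈ᶠ Z := hV
      have ih : Θ ⊢ .all (0 ∈ᶠ (V + 1) ↔ᶠ 0 ∈ᶠ (Y + 1) ∨ᶠ 0 ∈ᶠ (Z + 1)) →ᶠ isFin w V :=
        Derives.spec ih.up V
      exact Derives.insert_fin (Y := V) (b := b) hw.up (isInsert_intro fun z => iff_intro
        (fun hz => ((hU z).up.iff_mp hz).cases (fun hz => .orI₁ ((hV z).up.iff_mpr (.orI₁ hz)))
          fun hz => (hZ'.up.insert_cases hz).cases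
            (fun hz => .orI₁ ((hV z).up.iff_mpr (.orI₂ hz))) fun e => .orI₂ e)
        fun hz => hz.cases (fun hz => ((hV z).up.iff_mp hz).cases
            (fun hz => (hU z).up.iff_mpr (.orI₁ hz))
            fun hz => (hU z).up.iff_mpr (.orI₂ (hZ'.up.left.sub_elim hz)))
          fun e => (hU z).up.iff_mpr (.orI₂ (e.symm.mem_left hZ'.up.right.left)))
        (ih.mp (.all_intro fun z => hV z))
  have key : Γ ⊢ .all (0 ∈ᶠ (U + 1) ↔ᶠ 0 ∈ᶠ (Y + 1) ∨ᶠ 0 ∈ᶠ (Z + 1)) →ᶠ isFin w U := key.spec U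
  exact key.mp (.all_intro fun z => hU z)

/-- The sets obtained from the elements of a finite set by adjoining `b` form a finite set. -/
theorem Derives.exists_image_insert {w F : ℕ} (hw : Γ ⊢ isOmega w) (hF : Γ ⊢ isFin w F) (b : ℕ)
    (k : ∀ {Δ} [Step Γ Δ] G, (Δ ⊢ isFin w G) →
      (∀ Z, Δ ⊢ Z ∈ᶠ G ↔ᶠ bex F (isInsert (Z + 1) 0 (b + 1))) → (Δ ⊢ χ)) : Γ ⊢ χ := by
  have key : Γ ⊢ .ex (isFin (w + 1) 0 ∧ᶠ
      .all (0 ∈ᶠ 1 ↔ᶠ bex (F + 2) (isInsert 1 0 (b + 3)))) := by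
    refine fin_induction (.ex (isFin (w + 2) 0 ∧ᶠ
      .all (0 ∈ᶠ 1 ↔ᶠ bex 2 (isInsert 1 0 (b + 4))))) hw (fun {Δ} _ e he => ?_)
      (fun {Δ} _ F F' c hF hF' ih => ?_) hF
    · exact .exI e (.andI (empty_fin hw.up he) (.all_intro fun Z => iff_intro
        (fun h => he.up.isEmpty_elim h) fun h => Derives.obtain_mem h fun Y hY _ =>
          he.up.isEmpty_elim hY))
    · refine Derives.obtain ih fun {Δ} _ G hG => exists_isInsert c b fun {Δ} _ d hd =>
        exists_isInsert G d fun {Δ} _ G' hG' => .exI G' ?_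
      have h : ∀ Z, Δ ⊢ Z ∈ᶠ G ↔ᶠ bex F (isInsert (Z + 1) 0 (b + 1)) := fun Z =>
        Derives.spec (Derives.right hG.up) Z
      refine .andI (Derives.insert_fin hw.up hG' (Derives.left hG.up)) (.all_intro fun Z => ?_)
      show Δ ⊢ Z ∈ᶠ G' ↔ᶠ bex F' (isInsert (Z + 1) 0 (b + 1))
      refine iff_intro (fun {Θ} _ hZ => (hG'.up.insert_cases hZ).cases
        (fun hZ => ((h Z).up.iff_mp hZ).obtain_mem fun Y hY h' =>
          bex_intro Y (hF'.up.left.sub_elim hY) h')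
        fun e => bex_intro c hF'.up.right.left
          (e.symm.subst (isInsert 0 (c + 1) (b + 1)) hd.up))
        fun {Θ} _ hZ => hZ.obtain_mem fun {Θ} _ Y hY (h' : Θ ⊢ isInsert Z Y b) =>
          (hF'.up.insert_cases hY).cases
            (fun hY => hG'.up.left.sub_elim ((h Z).up.iff_mpr (bex_intro Y hY h'.up)))
            fun {Θ} _ e => ?_
      have h' : Θ ⊢ isInsert Z c b := e.subst (isInsert (Z + 1) 0 (b + 1)) h'.up
      exact (hd.up.insert_unique h').mem_left hG'.up.right.left
  exact key.obtain fun G hG => k G (Derives.left hG) fun Z => Derives.spec (Derives.right hG) Z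

/-- The finite subsets of a finite set form a finite set. -/
theorem Derives.exists_fin_subsets {w X : ℕ} (hw : Γ ⊢ isOmega w) (hX : Γ ⊢ isFin w X)
    (k : ∀ {Δ} [Step Γ Δ] F, (Δ ⊢ isFin w F) →
      (∀ Z, Δ ⊢ Z ∈ᶠ F ↔ᶠ isFin w Z ∧ᶠ sub Z X) → (Δ ⊢ χ)) : Γ ⊢ χ := by
  have key : Γ ⊢ .ex (isFin (w + 1) 0 ∧ᶠ .all (0 ∈ᶠ 1 ↔ᶠ isFin (w + 2) 0 ∧ᶠ sub 0 (X + 2))) := by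
    refine fin_induction (.ex (isFin (w + 2) 0 ∧ᶠ .all (0 ∈ᶠ 1 ↔ᶠ isFin (w + 3) 0 ∧ᶠ sub 0 2))) hw
      (fun {Δ} _ e he => ?_) (fun {Δ} _ X X' b hX hX' ih => ?_) hX
    · refine exists_isInsert e e fun {Δ} _ F hF => .exI F (.andI
        (Derives.insert_fin hw.up hF (empty_fin hw.up he.up)) (.all_intro fun Z => ?_))
      show Δ ⊢ Z ∈ᶠ F ↔ᶠ isFin w Z ∧ᶠ sub Z e
      have hZ : ∀ {Θ} [Ext Δ Θ], (Θ ⊢ Z ∈ᶠ F) → (Θ ⊢ Z ≡ᶠ e) := fun {Θ} _ h =>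
        (hF.up.insert_cases h).cases (fun h => (he.up (Δ := Δ)).up.isEmpty_elim h) fun h => h
      exact iff_intro (fun h => .andI ((hZ h).symm.subst (isFin (w + 1) 0) (empty_fin hw.up he.up))
          (hZ h).sub_of_eq)
        fun h => (Derives.antisymm he.up.empty_sub h.right).mem_left hF.up.right.left
    -- If `F` collects the finite subsets of `X`, those of `X ∪ {b}` are collected by `F ∪ {Y ∪ {b}
    -- | Y ∈ F}`.
    · refine Derives.obtain ih fun {Δ} _ F hF => Derives.exists_image_insert hw.up
        (Derives.left hF) b fun {Δ} _ G hG hG' =>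
          ((isSet_mem F).isSet_or (isSet_mem G) : Δ ⊢ _).isSet_elim fun {Δ} _ U hU => .exI U ?_
      have hF' : ∀ Z, Δ ⊢ Z ∈ᶠ F ↔ᶠ isFin w Z ∧ᶠ sub Z X := fun Z =>
        Derives.spec (Derives.right hF.up) Z
      replace hU : ∀ z, Δ ⊢ z ∈ᶠ U ↔ᶠ z ∈ᶠ F ∨ᶠ z ∈ᶠ G := hU
      replace hG' : ∀ Z, Δ ⊢ Z ∈ᶠ G ↔ᶠ bex F (isInsert (Z + 1) 0 (b + 1)) := fun Z => (hG' Z).up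
      have hUF : ∀ {Θ} [Ext Δ Θ] Z, (Θ ⊢ isFin w Z) → (Θ ⊢ sub Z X) → (Θ ⊢ Z ∈ᶠ U) :=
        fun {Θ} _ Z h h' => (hU Z).up.iff_mpr (.orI₁ ((hF' Z).up.iff_mpr (.andI h h')))
      have hUG : ∀ {Θ} [Ext Δ Θ] Y Z, (Θ ⊢ isFin w Y) → (Θ ⊢ sub Y X) → (Θ ⊢ isInsert Z Y b) →
          (Θ ⊢ Z ∈ᶠ U) := fun {Θ} _ Y Z h h' h'' => (hU Z).up.iff_mpr (.orI₂ ((hG' Z).up.iff_mpr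
            (bex_intro Y ((hF' Y).up.iff_mpr (.andI h h')) h'')))
      have hU' : ∀ {Θ} [Ext Δ Θ] Z χ, (Θ ⊢ Z ∈ᶠ U) → (∀ {Θ'} [Step Θ Θ'], (Θ' ⊢ isFin w Z) →
          (Θ' ⊢ sub Z X) → (Θ' ⊢ χ)) → (∀ {Θ'} [Step Θ Θ'] Y, (Θ' ⊢ isFin w Y) →
            (Θ' ⊢ sub Y X) → (Θ' ⊢ isInsert Z Y b) → (Θ' ⊢ χ)) → (Θ ⊢ χ) := by
        intro Θ _ Z χ hZ h₁ h₂
        refine ((hU Z).up.iff_mp hZ).cases (fun {Θ'} _ hZ => ?_) fun {Θ'} st hZ => ?_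
        · have := (hF' Z).up.iff_mp hZ
          exact h₁ this.left this.right
        · refine ((hG' Z).up.iff_mp hZ).obtain_mem fun {Θ''} st' Y hY h => ?_
          have hY := (hF' Y).up.iff_mp hY
          have := step_trans st st'
          exact h₂ Y hY.left hY.right h
      refine .andI (Derives.fin_union hw.up (Derives.left hF.up) hG.up hU) (.all_intro fun Z => ?_)
      show Δ ⊢ Z ∈ᶠ U ↔ᶠ isFin w Z ∧ᶠ sub Z X'
      have hw' : Δ ⊢ isOmega w := hw.up
      have hX'' : Δ ⊢ isInsert X' X b := hX'.up
      refine iff_intro (fun {Θ} _ hZ => hU' Z _ hZ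
        (fun h h' => .andI h (sub_intro fun z hz => hX''.up.left.sub_elim (h'.up.sub_elim hz)))
        fun Y h h' h'' => .andI (Derives.insert_fin hw'.up h'' h) (h''.insert_sub
          (sub_intro fun z hz => hX''.up.left.sub_elim (h'.up.sub_elim hz)) hX''.up.right.left))
        fun {Θ} _ hZ => ?_
      -- Induction on the finite set `Z` replaces the question whether `b ∈ Z`: a new element is in
      -- `X` or is `b`, and both kinds of members of `U` remain in `U` when it is adjoined.
      have key : Θ ⊢ sub Z X' →ᶠ Z ∈ᶠ U := by
        refine fin_induction (sub 0 (X' + 1) →ᶠ 0 ∈ᶠ (U + 1)) hw'.up (fun {Ξ} _ e he => ?_)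
          (fun {Ξ} _ Z Z' c hZ hZ' ih => ?_) hZ.left
        · exact imp_intro fun _ => hUF e (empty_fin hw'.up he.up) he.up.empty_sub
        · replace ih : Ξ ⊢ sub Z X' →ᶠ Z ∈ᶠ U := ih
          show Ξ ⊢ sub Z' X' →ᶠ Z' ∈ᶠ U
          refine imp_intro fun {Ξ} _ hs => ?_
          refine hU' Z _ (ih.up.mp (sub_intro fun z hz => hs.up.sub_elim
            (hZ'.up.left.sub_elim hz))) (fun {Ω} _ h h' => ?_) fun {Ω} _ Y h h' h'' => ?_
          · exact (hX''.up.insert_cases (hs.up.sub_elim hZ'.up.right.left)).cases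
              (fun hc => hUF Z' (Derives.insert_fin hw'.up hZ'.up h.up)
                (hZ'.up.insert_sub h'.up hc))
              fun e => hUG Z Z' h.up h'.up (e.subst (isInsert (Z' + 1) (Z + 1) 0) hZ'.up)
          · refine (hX''.up.insert_cases (hs.up.sub_elim hZ'.up.right.left)).cases
              (fun {Ω} _ hc => exists_isInsert Y c fun {Ω} _ Y' hY' => ?_) fun {Ω} _ e => ?_
            · exact hUG Y' Z' (Derives.insert_fin hw'.up hY' h.up) (hY'.insert_sub h'.up hc.up)
                (isInsert_intro fun z => iff_intro
                  (fun hz => (hZ'.up.insert_cases hz).cases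
                    (fun hz => (h''.up.insert_cases hz).cases
                      (fun hz => .orI₁ (hY'.up.left.sub_elim hz)) fun e => .orI₂ e)
                    fun e => .orI₁ (e.symm.mem_left hY'.up.right.left))
                  fun hz => hz.cases
                    (fun hz => (hY'.up.insert_cases hz).cases
                      (fun hz => hZ'.up.left.sub_elim (h''.up.left.sub_elim hz))
                      fun e => e.symm.mem_left hZ'.up.right.left)
                    fun e => e.symm.mem_left (hZ'.up.left.sub_elim h''.up.right.left))
            · exact hUG Y Z' h.up h'.up (isInsert_intro fun z => iff_intro
                (fun hz => (hZ'.up.insert_cases hz).cases (fun hz => h''.up.insert_cases hz)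
                  fun e' => .orI₂ (e'.trans e.up))
                fun hz => hz.cases
                  (fun hz => hZ'.up.left.sub_elim (h''.up.left.sub_elim hz))
                  fun e' => (e'.trans e.up.symm).symm.mem_left hZ'.up.right.left)
      exact key.mp hZ.right
  exact key.obtain fun F hF => k F (Derives.left hF) fun Z => Derives.spec (Derives.right hF) Z

/-! ### Definable relations on a finite set with decidable equality and membership -/

/-- `z = ⟨n, R⟩` for a decidable relation `R ⊆ Xⁿ`. -/
def isDecRel (X z : ℕ) : Fml :=
  .all (.all (isOPair (z + 2) 1 0 →ᶠ .all (isSeq 0 2 (X + 3) →ᶠ dec (0 ∈ᶠ 1))))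

theorem Derives.isDecRel_elim {X z n R s : ℕ} (h : Γ ⊢ isDecRel X z) (hz : Γ ⊢ isOPair z n R)
    (hs : Γ ⊢ isSeq s n X) : Γ ⊢ dec (s ∈ᶠ R) := by
  have h : Γ ⊢ isOPair z n R →ᶠ .all (isSeq 0 (n + 1) (X + 1) →ᶠ dec (0 ∈ᶠ (R + 1))) :=
    Derives.spec (Derives.spec h n) R
  have h' : Γ ⊢ isSeq s n X →ᶠ dec (s ∈ᶠ R) := (h.mp hz).spec s
  exact h'.mp hs

theorem Derives.isDecRel_of_isRel {X z n : ℕ} (hz : Γ ⊢ isRel z n X ψ)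
    (h : ∀ {Δ} [Step Γ Δ] s, (Δ ⊢ isSeq s n X) → (Δ ⊢ dec (ψ.inst s))) : Γ ⊢ isDecRel X z := by
  have h := fun s => imp_intro (h s)
  refine .all_intro fun m => .all_intro fun R => ?_
  show Γ ⊢ isOPair z m R →ᶠ .all (isSeq 0 (m + 1) (X + 1) →ᶠ dec (0 ∈ᶠ (R + 1)))
  refine imp_intro fun {Δ} _ hR => .all_intro fun s => ?_
  show Δ ⊢ isSeq s m X →ᶠ dec (s ∈ᶠ R)
  refine imp_intro fun {Θ} _ hs => hz.up.rel_obtain fun {Θ} _ R' hR' hR'' => ?_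
  have hs' : Θ ⊢ isSeq s n X :=
    (hR.up.opair_fst hR').subst (isSeq (s + 1) 0 (X + 1)) hs.up
  have e : Θ ⊢ R' ≡ᶠ R := hR'.opair_snd hR.up
  exact ((h s).up.mp hs').dec_congr
    (fun h => e.up.mem_right ((hR'' s).up.iff_mpr (.andI hs'.up h)))
    fun h => ((hR'' s).up.iff_mp (e.up.symm.mem_right h)).right

/-- Induction on the generation of definable relations. The atomic cases are the hypotheses on `X`,
the connectives preserve decidability, and finiteness of `X` takes care of the quantifiers. -/
theorem Derives.dec_defRels {w X D z : ℕ} (hw : Γ ⊢ isOmega w) (hX : Γ ⊢ isFin w X)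
    (heq : Γ ⊢ ball X (ball (X + 1) (dec (1 ≡ᶠ 0))))
    (hmem : Γ ⊢ ball X (ball (X + 1) (dec (1 ∈ᶠ 0)))) (hD : Γ ⊢ isDefRels X D)
    (hz : Γ ⊢ z ∈ᶠ D) : Γ ⊢ isDecRel X z := by
  refine defRels_induction (isDecRel (X + 1) 0) hw hD (fun {Δ} _ E z hE hz => ?_) hz
  show Δ ⊢ isDecRel X z
  have hdec : ∀ {Θ} [Ext Δ Θ] n R s, (Θ ⊢ pairMem n R E) → (Θ ⊢ isSeq s n X) →
      (Θ ⊢ dec (s ∈ᶠ R)) := fun {Θ} _ n R s hR hs => hR.obtain_pair fun {Ξ} _ p hp hp' =>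
    have h : Ξ ⊢ isDecRel X p := Derives.ball_elim (hE.up (Δ := Θ)).up hp
    h.isDecRel_elim hp' hs.up
  replace heq : ∀ {Θ} [Ext Δ Θ] a b, (Θ ⊢ a ∈ᶠ X) → (Θ ⊢ b ∈ᶠ X) → (Θ ⊢ dec (a ≡ᶠ b)) :=
    fun {Θ} _ a b ha hb => ((heq.up (Δ := Δ)).up.ball_elim ha).ball_elim hb
  replace hmem : ∀ {Θ} [Ext Δ Θ] a b, (Θ ⊢ a ∈ᶠ X) → (Θ ⊢ b ∈ᶠ X) → (Θ ⊢ dec (a ∈ᶠ b)) :=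
    fun {Θ} _ a b ha hb => ((hmem.up (Δ := Δ)).up.ball_elim ha).ball_elim hb
  -- The extension of `s` by `a` is unique, so asking for one in `R` amounts to a single membership
  -- question.
  have hsnoc : ∀ {Θ} [Ext Δ Θ] n m R s a, (Θ ⊢ isSucc m n) → (Θ ⊢ pairMem m R E) →
      (Θ ⊢ isSeq s n X) → (Θ ⊢ a ∈ᶠ X) →
      (Θ ⊢ dec (bex R (isSnoc 0 (s + 1) (n + 1) (a + 1)))) := fun {Θ} _ n m R s a hm hR hs ha =>
    exists_snoc s n a fun t ht => (hdec m R t hR.up (ht.snoc_seq hs.up ha.up hm.up)).dec_congr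
      (fun h => bex_intro t h ht.up) fun h => h.obtain_mem fun t' ht' h =>
        (Derives.snoc_unique h ht.up).mem_left ht'
  have hw : Δ ⊢ isOmega w := hw.up
  have hX : Δ ⊢ isFin w X := hX.up
  refine hz.step_elim (fun h => h.stepAtomic_elim
    (fun n hn hz => hz.isDecRel_of_isRel fun _ _ => dec_bot)
    (fun n i j hn hi hj hz => hz.isDecRel_of_isRel fun {Θ} _ s hs => hs.seq_val hi.up
      fun {Θ} _ a ha hia => hs.up.seq_val hj.up fun {Θ} _ b hb hjb => ?_)
    fun n i j hn hi hj hz => hz.isDecRel_of_isRel fun {Θ} _ s hs => hs.seq_val hi.up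
      fun {Θ} _ a ha hia => hs.up.seq_val hj.up fun {Θ} _ b hb hjb => ?_)
    fun {Θ} _ n R S hn hR hS h => h.cases (fun h => h.stepConnective_elim
      (fun hz => hz.isDecRel_of_isRel fun s hs => (hdec n R s hR.up hs).dec_and
        (hdec n S s hS.up hs))
      (fun hz => hz.isDecRel_of_isRel fun s hs => (hdec n R s hR.up hs).dec_or
        (hdec n S s hS.up hs))
      (fun hz => hz.isDecRel_of_isRel fun s hs => (hdec n R s hR.up hs).dec_imp
        (hdec n S s hS.up hs)))
    fun h => h.stepQuantifier_elim
      (fun m hm hnm hz => hz.isDecRel_of_isRel fun s hs => Derives.dec_ball hw.up hX.up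
        fun a ha => hsnoc m n R s a hnm.up hR.up hs.up ha)
      fun m hm hnm hz => hz.isDecRel_of_isRel fun s hs => Derives.dec_bex hw.up hX.up
        fun a ha => hsnoc m n R s a hnm.up hR.up hs.up ha
  · exact (heq a b ha.up hb).dec_congr
      (fun e => relEq_intro ha.up hia.up (e.symm.pairMem_snd hjb.up))
      fun h => h.relEq_elim fun c hic hjc => (hs.up.seq_unique hia.up hic).trans
        (hs.up.seq_unique hjc hjb.up)
  · exact (hmem a b ha.up hb).dec_congr
      (fun e => relMem_intro ha.up hb.up hia.up hjb.up e)
      fun h => h.relMem_elim fun c d hic hjd hcd => (hs.up.seq_unique hjd hjb.up).mem_right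
        ((hs.up.seq_unique hic hia.up).mem_left hcd)

/-- Over a finite set with decidable equality and membership, the definable subsets are finite. -/
theorem Derives.inDef_fin {w X Y : ℕ} (hw : Γ ⊢ isOmega w) (hX : Γ ⊢ isFin w X)
    (heq : Γ ⊢ ball X (ball (X + 1) (dec (1 ≡ᶠ 0))))
    (hmem : Γ ⊢ ball X (ball (X + 1) (dec (1 ∈ᶠ 0)))) (hY : Γ ⊢ inDef X Y) : Γ ⊢ isFin w Y :=
  Derives.inDef_elim hw hY fun D n m R p hD hn hm hR hp hs => Derives.fin_of_dec hw.up hX.up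
    hs.section_sub fun {Δ} _ a ha => hR.up.obtain_pair fun {Δ} _ z hz hz' =>
      exists_snoc p n a fun {Δ} _ t ht =>
        ((Derives.dec_defRels hw.up hX.up heq.up hmem.up hD.up hz.up).isDecRel_elim hz'.up
          (ht.snoc_seq hp.up ha.up hm.up)).dec_congr
          (fun h => hs.up.section_mem ha.up h ht.up) fun h => hs.up.section_snoc h ht.up

/-- An enumeration of `Y` serves as the parameter sequence. -/
theorem inDef_of_fin {w X Y : ℕ} (hw : Γ ⊢ isOmega w) (hY : Γ ⊢ isFin w Y) (hs : Γ ⊢ sub Y X) :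
    Γ ⊢ inDef X Y :=
  hY.isFin_elim fun n p hn hp h => inDef_range hw.up hn (hp.seq_mono hs.up)
    (fun i a ha => (hp.up.seq_dom ha).right) fun a ha => h.up.ball_elim ha

/-! ### Hereditarily finite levels -/

/-- `y` is a finite set with decidable equality, whose elements are finite subsets of `y`. -/
def isDiscrete (w y : ℕ) : Fml :=
  isFin w y ∧ᶠ ball y (ball (y + 1) (dec (1 ≡ᶠ 0))) ∧ᶠ ball y (isFin (w + 1) 0 ∧ᶠ sub 0 (y + 1))

theorem isDiscrete_intro {w y : ℕ} (hy : Γ ⊢ isFin w y)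
    (heq : ∀ {Δ} [Step Γ Δ] a b, (Δ ⊢ a ∈ᶠ y) → (Δ ⊢ b ∈ᶠ y) → (Δ ⊢ dec (a ≡ᶠ b)))
    (h : ∀ {Δ} [Step Γ Δ] a, (Δ ⊢ a ∈ᶠ y) → (Δ ⊢ isFin w a ∧ᶠ sub a y)) : Γ ⊢ isDiscrete w y :=
  .andI hy (.andI (ball_intro fun {_} st a ha => ball_intro fun {Δ} st' b hb =>
    have := step_trans st st'
    (show Δ ⊢ dec (a ≡ᶠ b) from heq a b ha.up hb)) (ball_intro h))

theorem Derives.discrete_eq {w y a b : ℕ} (h : Γ ⊢ isDiscrete w y) (ha : Γ ⊢ a ∈ᶠ y)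
    (hb : Γ ⊢ b ∈ᶠ y) : Γ ⊢ dec (a ≡ᶠ b) := (h.right.left.ball_elim ha).ball_elim hb

theorem Derives.discrete_mem {w y a : ℕ} (h : Γ ⊢ isDiscrete w y) (ha : Γ ⊢ a ∈ᶠ y) :
    Γ ⊢ isFin w a ∧ᶠ sub a y := h.right.right.ball_elim ha

/-- Membership in a finite subset of a set with decidable equality is decidable. -/
theorem Derives.discrete_dec_mem {w y a b : ℕ} (hw : Γ ⊢ isOmega w) (h : Γ ⊢ isDiscrete w y)
    (ha : Γ ⊢ a ∈ᶠ y) (hb : Γ ⊢ isFin w b) (hs : Γ ⊢ sub b y) : Γ ⊢ dec (a ∈ᶠ b) :=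
  (Derives.dec_bex (θ := 0 ≡ᶠ (a + 1)) hw hb fun c hc =>
    h.up.discrete_eq (hs.up.sub_elim hc) ha.up).dec_congr
      (fun h => h.obtain_mem fun {Δ} _ c hc (e : Δ ⊢ c ≡ᶠ a) => e.mem_left hc)
      fun h => bex_intro a h (.eqI a)

/-- Membership between elements of `y` is decidable because each element is a finite subset of `y`.
-/
theorem Derives.discrete_inDef {w y x : ℕ} (hw : Γ ⊢ isOmega w) (h : Γ ⊢ isDiscrete w y)
    (hx : Γ ⊢ inDef y x) : Γ ⊢ isFin w x :=
  Derives.inDef_fin hw h.left h.right.left (ball_intro fun {_} _ a ha => ball_intro fun {Δ} _ b hb =>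
    show Δ ⊢ dec (a ∈ᶠ b) from
      have hb' := h.up.discrete_mem hb
      Derives.discrete_dec_mem hw.up h.up ha.up hb'.left hb'.right) hx

/-- The elements of `z` are exactly the finite subsets of `y`, and these form a finite set. Two of
them are equal iff each includes the other, and inclusion between finite subsets of a discrete set
is decidable. -/
theorem Derives.discrete_succ {w y z : ℕ} (hw : Γ ⊢ isOmega w) (h : Γ ⊢ isDiscrete w y)
    (hz : ∀ x, Γ ⊢ x ∈ᶠ z ↔ᶠ x ∈ᶠ y ∨ᶠ inDef y x) : Γ ⊢ isDiscrete w z := by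
  have hmem : ∀ {Δ} [Ext Γ Δ] x, (Δ ⊢ x ∈ᶠ z) → (Δ ⊢ isFin w x ∧ᶠ sub x y) := fun {Δ} _ x hx =>
    ((hz x).up.iff_mp hx).cases (fun hx => h.up.discrete_mem hx) fun hx =>
      .andI (Derives.discrete_inDef hw.up h.up hx) (Derives.inDef_sub hw.up hx)
  refine isDiscrete_intro (Derives.exists_fin_subsets hw h.left fun {Δ} _ F hF hF' => ?_)
    (fun {Δ} _ a b ha hb => ?_) fun a ha => .andI (hmem a ha).left (sub_intro fun c hc =>
      (hz c).up.iff_mpr (.orI₁ ((hmem a ha).right.up.sub_elim hc)))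
  · have e : Δ ⊢ F ≡ᶠ z := eq_of_forall_mem_iff fun x => iff_intro
      (fun {Θ} _ hx =>
        have hx : Θ ⊢ isFin w x ∧ᶠ sub x y := (hF' x).up.iff_mp hx
        (hz x).up.iff_mpr (.orI₂ (inDef_of_fin hw.up hx.left hx.right)))
      fun hx => (hF' x).up.iff_mpr (hmem x hx)
    exact e.subst (isFin (w + 1) 0) hF
  · have hsub : ∀ {a b}, (Δ ⊢ isFin w a ∧ᶠ sub a y) → (Δ ⊢ isFin w b ∧ᶠ sub b y) →
        (Δ ⊢ dec (sub a b)) := fun {a b} ha hb => Derives.dec_ball hw.up ha.left fun c hc =>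
      Derives.discrete_dec_mem hw.up h.up (ha.up.right.sub_elim hc) hb.up.left hb.up.right
    exact ((hsub (hmem a ha) (hmem b hb)).dec_and (hsub (hmem b hb) (hmem a ha))).dec_congr
      (fun h => h.left.antisymm h.right) fun e => .andI e.sub_of_eq e.symm.sub_of_eq

/-- A decidable transitive subset of a natural number is a natural number. -/
theorem Derives.mem_succ_of_trans {w k x : ℕ} (hw : Γ ⊢ isOmega w) (hk : Γ ⊢ k ∈ᶠ w)
    (hx : Γ ⊢ isTrans x) (hs : Γ ⊢ sub x k)
    (hd : ∀ {Δ} [Step Γ Δ] j, (Δ ⊢ j ∈ᶠ k) → (Δ ⊢ dec (j ∈ᶠ x))) :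
    Γ ⊢ x ∈ᶠ k ∨ᶠ x ≡ᶠ k := by
  have key : Γ ⊢ sub x k →ᶠ ball k (dec (0 ∈ᶠ (x + 1))) →ᶠ x ∈ᶠ k ∨ᶠ x ≡ᶠ k := by
    refine omega_induction (sub (x + 1) 0 →ᶠ ball 0 (dec (0 ∈ᶠ (x + 2))) →ᶠ
      (x + 1) ∈ᶠ 0 ∨ᶠ (x + 1) ≡ᶠ 0) hw (fun {Δ} _ e he => ?_) (fun {Δ} _ n m hn hm ih => ?_) hk
    · show Δ ⊢ sub x e →ᶠ ball e (dec (0 ∈ᶠ (x + 1))) →ᶠ x ∈ᶠ e ∨ᶠ x ≡ᶠ e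
      exact imp_intro₂ fun h _ => .orI₂ (h.antisymm he.up.empty_sub)
    · replace ih : Δ ⊢ sub x n →ᶠ ball n (dec (0 ∈ᶠ (x + 1))) →ᶠ x ∈ᶠ n ∨ᶠ x ≡ᶠ n := ih
      show Δ ⊢ sub x m →ᶠ ball m (dec (0 ∈ᶠ (x + 1))) →ᶠ x ∈ᶠ m ∨ᶠ x ≡ᶠ m
      refine imp_intro₂ fun {Θ} _ hs hd => ?_
      -- If `n ∈ x`, transitivity gives `n ∪ {n} ⊆ x`, hence `x = m`. Otherwise `x ⊆ n` and the
      -- induction hypothesis applies.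
      have hnx : Θ ⊢ dec (n ∈ᶠ x) := hd.ball_elim hm.up.self_mem_succ
      refine hnx.cases (fun hnx => .orI₂ (hs.up.antisymm (hm.up.succ_sub
        (hx.up.isTrans_sub hnx) hnx))) fun hnx => .orI₁ ?_
      refine (ih.up.mp₂ (sub_intro fun j hj => (hm.up.mem_succ (hs.up.sub_elim hj)).cases
        (fun h => h) fun e => (hnx.up.mp (e.mem_left hj.up)).absurd)
        (ball_intro fun j hj => hd.up.ball_elim (hm.up.sub_succ.sub_elim hj))).cases
        (fun h => hm.up.sub_succ.sub_elim h) fun e => e.symm.mem_left hm.up.self_mem_succ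
  exact key.mp₂ hs (ball_intro hd)

/-! ### The levels of the constructible hierarchy -/

theorem exists_level {w α : ℕ} (hw : Γ ⊢ isOmega w) (hα : Γ ⊢ isOrd α)
    (k : ∀ {Δ} [Step Γ Δ] y, (Δ ⊢ isLevel α y) → (Δ ⊢ χ)) : Γ ⊢ χ :=
  exists_rec (ρ := inDef 0 1) hα (fun z => (isSet_inDef hw z).of_eq (by simp))
    fun y hy => k y (hy.of_eq (isRec_inDef α y))

theorem inDef_inst₂ (z x : ℕ) : (inDef 0 1).inst₂ z x = inDef z x := by simp [Fml.inst₂]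

theorem Derives.level_mem {α y β z x : ℕ} (hy : Γ ⊢ isLevel α y) (hβ : Γ ⊢ β ∈ᶠ α)
    (hz : Γ ⊢ isLevel β z) (hx : Γ ⊢ inDef z x) : Γ ⊢ x ∈ᶠ y := by
  rw [← isRec_inDef] at hy hz
  rw [← inDef_inst₂] at hx
  exact hy.rec_mem hβ hz hx

theorem Derives.level_mem_obtain {α y x : ℕ} (hy : Γ ⊢ isLevel α y) (hx : Γ ⊢ x ∈ᶠ y)
    (k : ∀ {Δ} [Step Γ Δ] β z, (Δ ⊢ β ∈ᶠ α) → (Δ ⊢ isLevel β z) → (Δ ⊢ inDef z x) →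
      (Δ ⊢ χ)) : Γ ⊢ χ := by
  rw [← isRec_inDef] at hy
  exact hy.rec_mem_obtain hx fun β z hβ hz hx => k β z hβ (hz.of_eq (isRec_inDef β z))
    (hx.of_eq (inDef_inst₂ z x))

theorem Derives.level_unique {α y z : ℕ} (hy : Γ ⊢ isLevel α y) (hz : Γ ⊢ isLevel α z) :
    Γ ⊢ y ≡ᶠ z := by
  rw [← isRec_inDef] at hy hz
  exact hy.rec_unique hz

@[simp] theorem rename_isLevel (f : ℕ → ℕ) (α y : ℕ) :
    (isLevel α y).rename f = isLevel (f α) (f y) := by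
  rw [← isRec_inDef, rename_isRec, ← isRec_inDef, rename_inDef]
  rfl

theorem Derives.level_congr {α β y : ℕ} (hy : Γ ⊢ isLevel α y) (e : Γ ⊢ α ≡ᶠ β) :
    Γ ⊢ isLevel β y :=
  Derives.of_eq (e.subst (isLevel 0 (y + 1)) (hy.of_eq (by simp [Fml.inst]))) (by simp [Fml.inst])

theorem Derives.inDef_congr {X X' Y : ℕ} (e : Γ ⊢ X ≡ᶠ X') (h : Γ ⊢ inDef X Y) :
    Γ ⊢ inDef X' Y :=
  Derives.of_eq (e.subst (inDef 0 (Y + 1)) (h.of_eq (by simp [Fml.inst]))) (by simp [Fml.inst])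

theorem Derives.level_mono {α β y z : ℕ} (hy : Γ ⊢ isLevel α y) (hz : Γ ⊢ isLevel β z)
    (hs : Γ ⊢ sub α β) : Γ ⊢ sub y z :=
  sub_intro fun x hx => hy.up.level_mem_obtain hx fun γ u hγ hu hx =>
    hz.up.level_mem (hs.up.sub_elim hγ) hu hx

/-- An element of `L_α` is a subset of some `L_β` with `β ∈ α`, and `L_β ⊆ L_α` by monotonicity. -/
theorem Derives.level_trans {w α y : ℕ} (hw : Γ ⊢ isOmega w) (hα : Γ ⊢ isTrans α)
    (hy : Γ ⊢ isLevel α y) : Γ ⊢ isTrans y :=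
  isTrans_intro fun x z hx hz => hy.up.level_mem_obtain hx fun β u hβ hu hx =>
    (hu.level_mono hy.up (hα.up.isTrans_sub hβ)).sub_elim
      ((Derives.inDef_sub hw.up hx).sub_elim hz.up)

/-- Stated with the union because `L_α ⊆ Def(L_α)` is not assumed; in this form it follows directly
from the recursion. -/
theorem Derives.level_succ {α β y z : ℕ} (hy : Γ ⊢ isLevel α y) (hβ : Γ ⊢ isSucc β α)
    (hz : Γ ⊢ isLevel β z) (x : ℕ) : Γ ⊢ x ∈ᶠ z ↔ᶠ x ∈ᶠ y ∨ᶠ inDef y x :=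
  iff_intro
    (fun {Δ} _ hx => hz.up.level_mem_obtain hx fun {Δ} _ γ u hγ hu hx =>
      (hβ.up.mem_succ hγ).cases (fun h => .orI₁ (hy.up.level_mem h hu.up hx.up))
        fun e => .orI₂ (((hu.up.level_congr e).level_unique hy.up).inDef_congr hx.up))
    fun hx => hx.cases (fun hx => (hy.up.level_mono hz.up hβ.up.sub_succ).sub_elim hx)
      fun hx => hz.up.level_mem hβ.up.self_mem_succ hy.up hx

@[simp] theorem rename_isOrd (f : ℕ → ℕ) (x : ℕ) : (isOrd x).rename f = isOrd (f x) := rfl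

@[simp] theorem rename_isOmega (f : ℕ → ℕ) (w : ℕ) : (isOmega w).rename f = isOmega (f w) := rfl

@[simp] theorem rename_isDiscrete (f : ℕ → ℕ) (w y : ℕ) :
    (isDiscrete w y).rename f = isDiscrete (f w) (f y) := rfl

/-- The finite levels are discrete, and the ordinals in `L_m` are the elements of `m`. -/
theorem Derives.level_nat {w m y : ℕ} (hw : Γ ⊢ isOmega w) (hm : Γ ⊢ m ∈ᶠ w)
    (hy : Γ ⊢ isLevel m y) :
    Γ ⊢ isDiscrete w y ∧ᶠ .all (0 ∈ᶠ (m + 1) ↔ᶠ 0 ∈ᶠ (y + 1) ∧ᶠ isOrd 0) := by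
  have hinst : ∀ m, (Fml.all (isLevel 1 0 →ᶠ isDiscrete (w + 2) 0 ∧ᶠ
      .all (0 ∈ᶠ 2 ↔ᶠ 0 ∈ᶠ 1 ∧ᶠ isOrd 0))).inst m = .all (isLevel (m + 1) 0 →ᶠ
        isDiscrete (w + 1) 0 ∧ᶠ .all (0 ∈ᶠ (m + 2) ↔ᶠ 0 ∈ᶠ 1 ∧ᶠ isOrd 0)) := by
    intro m
    simp [Fml.inst, Fml.rename, Fml.iff]
  have hinst' : ∀ m y, (isLevel (m + 1) 0 →ᶠ
        isDiscrete (w + 1) 0 ∧ᶠ .all (0 ∈ᶠ (m + 2) ↔ᶠ 0 ∈ᶠ 1 ∧ᶠ isOrd 0)).inst y =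
      (isLevel m y →ᶠ isDiscrete w y ∧ᶠ .all (0 ∈ᶠ (m + 1) ↔ᶠ 0 ∈ᶠ (y + 1) ∧ᶠ isOrd 0)) := by
    intro m y
    simp [Fml.inst, Fml.rename, Fml.iff]
  have key : Γ ⊢ .all (isLevel (m + 1) 0 →ᶠ
      isDiscrete (w + 1) 0 ∧ᶠ .all (0 ∈ᶠ (m + 2) ↔ᶠ 0 ∈ᶠ 1 ∧ᶠ isOrd 0)) := by
    rw [← hinst]
    refine omega_induction _ hw (fun {Δ} _ e he => ?_) (fun {Δ} _ n m hn hm ih => ?_) hm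
    · rw [hinst]
      refine .all_intro fun y => Derives.of_eq (imp_intro fun {Δ} _ hy => ?_) (hinst' e y).symm
      have h : Δ ⊢ isEmpty y := isEmpty_intro fun x hx => hy.up.level_mem_obtain hx
        fun β z hβ _ _ => he.up.isEmpty_elim hβ
      exact .andI (isDiscrete_intro (empty_fin hw.up h) (fun a b ha _ => h.up.isEmpty_elim ha)
        fun a ha => h.up.isEmpty_elim ha) (.all_intro fun x => iff_intro
          (fun hx => he.up.isEmpty_elim hx) fun hx => h.up.isEmpty_elim (Derives.left hx))
    · rw [hinst] at ih ⊢
      refine .all_intro fun z => Derives.of_eq (imp_intro fun {Δ} _ hz => ?_) (hinst' m z).symm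
      refine exists_level hw.up (hw.up.nat_ord hn.up) fun {Δ} _ y hy => ?_
      have hw : Δ ⊢ isOmega w := hw.up
      have ihy := ((Derives.spec ih.up y).of_eq (hinst' n y)).mp hy
      have hdisc := ihy.left
      have hord : ∀ x, Δ ⊢ x ∈ᶠ n ↔ᶠ x ∈ᶠ y ∧ᶠ isOrd x := fun x => ihy.right.spec x
      have hzy := hy.level_succ hm.up hz.up
      have hn' : Δ ⊢ isOrd n := hw.nat_ord hn.up
      have htrans : Δ ⊢ isTrans y := hw.level_trans hn'.ord_trans hy
      refine .andI (Derives.discrete_succ hw hdisc hzy) (.all_intro fun x => ?_)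
      show Δ ⊢ x ∈ᶠ m ↔ᶠ x ∈ᶠ z ∧ᶠ isOrd x
      refine iff_intro (fun {Θ} _ hx => (hm.up.mem_succ hx).cases (fun {Θ} _ hx => ?_)
        fun {Θ} _ e => ?_) fun {Θ} _ hx => ((hzy x).up.iff_mp hx.left).cases (fun {Θ} _ h => ?_)
        fun {Θ} _ h => ?_
      · have hx' : Θ ⊢ x ∈ᶠ y ∧ᶠ isOrd x := (hord x).up.iff_mp hx
        exact .andI ((hzy x).up.iff_mpr (.orI₁ hx'.left)) hx'.right
      -- The new ordinal: `n = L_n ∩ Ord` is definable over the transitive set `L_n`.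
      · have h : Θ ⊢ n ∈ᶠ z ∧ᶠ isOrd n := .andI ((hzy n).up.iff_mpr (.orI₂ (inDef_ord hw.up
          htrans.up fun a => (hord a).up))) hn'.up
        exact e.symm.subst (0 ∈ᶠ (z + 1) ∧ᶠ isOrd 0) h
      · exact hm.up.sub_succ.sub_elim ((hord x).up.iff_mpr (.andI h hx.up.right))
      -- No other ordinal is new: `x` is a finite subset of the discrete set `L_n`, hence a
      -- decidable transitive subset of `n`, so `x ∈ n` or `x = n`.
      · have hxy : Θ ⊢ sub x y := Derives.inDef_sub hw.up h
        have hfin : Θ ⊢ isFin w x := Derives.discrete_inDef hw.up hdisc.up h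
        refine (Derives.mem_succ_of_trans hw.up hn.up hx.up.right.ord_trans (sub_intro fun a ha =>
          (hord a).up.iff_mpr (.andI (hxy.up.sub_elim ha) (hx.up.right.ord_mem ha)))
          fun {Ξ} _ j hj => ?_).cases (fun h => hm.up.sub_succ.sub_elim h)
            fun e => e.symm.mem_left hm.up.self_mem_succ
        have hj : Ξ ⊢ j ∈ᶠ y ∧ᶠ isOrd j := (hord j).up.iff_mp hj
        exact Derives.discrete_dec_mem hw.up hdisc.up hj.left hfin.up hxy.up
  exact ((key.spec y).of_eq (hinst' m y)).mp hy

/-- The ordinals in `L_α` are the elements of `α`, for every ordinal `α ⊆ ω`. -/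
theorem Derives.mem_level_iff {w α y : ℕ} (hw : Γ ⊢ isOmega w) (hα : Γ ⊢ isOrd α)
    (hs : Γ ⊢ sub α w) (hy : Γ ⊢ isLevel α y) (x : ℕ) : Γ ⊢ x ∈ᶠ α ↔ᶠ x ∈ᶠ y ∧ᶠ isOrd x := by
  have hnat : ∀ {Δ} [Ext Γ Δ] m z x, (Δ ⊢ m ∈ᶠ α) → (Δ ⊢ isLevel m z) →
      (Δ ⊢ x ∈ᶠ m ↔ᶠ x ∈ᶠ z ∧ᶠ isOrd x) := fun {Δ} _ m z x hm hz =>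
    (Derives.level_nat hw.up (hs.up.sub_elim hm) hz).right.spec x
  refine iff_intro (fun {Δ} _ hx => .andI (exists_level hw.up (hα.up.ord_mem hx) fun {Δ} _ z hz => ?_)
    (hα.up.ord_mem hx)) fun {Δ} _ hx => hy.up.level_mem_obtain hx.left fun {Δ} _ m z hm hz hxz => ?_
  -- Here `x` is itself a natural number, so `x = L_x ∩ Ord` belongs to `Def(L_x) ⊆ L_α`.
  · exact hy.up.level_mem hx.up hz (inDef_ord hw.up (hw.up.level_trans
      (hα.up.ord_mem hx.up).ord_trans hz) fun a => hnat x z a hx.up hz)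
  -- The ordinal `x` appears in `Def(L_m)` with `m ∈ α`. As in the finite case `x ∈ m` or `x = m`;
  -- both give `x ∈ α`, without deciding membership in `α`.
  · have hdisc := (Derives.level_nat hw.up (hs.up.sub_elim hm) hz).left
    have hxs : Δ ⊢ sub x z := Derives.inDef_sub hw.up hxz
    have hfin : Δ ⊢ isFin w x := Derives.discrete_inDef hw.up hdisc hxz
    refine (Derives.mem_succ_of_trans hw.up (hs.up.sub_elim hm) hx.up.right.ord_trans
      (sub_intro fun a ha => (hnat m z a hm.up hz.up).iff_mpr (.andI (hxs.up.sub_elim ha)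
        (hx.up.right.ord_mem ha))) fun {Θ} _ j hj => ?_).cases
      (fun h => hα.up.ord_trans.isTrans_elim hm.up h) fun e => e.symm.mem_left hm.up
    have hj : Θ ⊢ j ∈ᶠ z ∧ᶠ isOrd j := (hnat m z j hm.up hz.up).iff_mp hj
    exact Derives.discrete_dec_mem hw.up hdisc.up hj.left hfin.up hxs.up

theorem inL_intro {α y x : ℕ} (hα : Γ ⊢ isOrd α) (hy : Γ ⊢ isLevel α y) (hx : Γ ⊢ x ∈ᶠ y) :
    Γ ⊢ inL x := by
  refine .exI α (.exI y (Derives.of_eq (.andI hα (.andI hy hx)) ?_))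
  simp [Fml.inst, Fml.rename]

@[simp] theorem rename_inL (f : ℕ → ℕ) (x : ℕ) : (inL x).rename f = inL (f x) := by
  simp [inL, Fml.rename]

end ConstructiveSetTheory

/-- CZF proves: for `w = ω` and every ordinal `α ⊆ w`, we have `α ∈ L`, and there is `y = L_α`
with `α = y ∩ Ord`. -/
theorem mainTheorem5 :
    Provable CZF
      (.all (isOmega 0 →ᶠ .all (isOrd 0 ∧ᶠ sub 0 1 →ᶠ
        inL 0 ∧ᶠ .ex (isLevel 1 0 ∧ᶠ .all (0 ∈ᶠ 2 ↔ᶠ 0 ∈ᶠ 1 ∧ᶠ isOrd 0))))) := by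
  refine Derives.all_intro fun w => Derives.of_eq (φ := isOmega w →ᶠ .all (isOrd 0 ∧ᶠ
    sub 0 (w + 1) →ᶠ inL 0 ∧ᶠ .ex (isLevel 1 0 ∧ᶠ .all (0 ∈ᶠ 2 ↔ᶠ 0 ∈ᶠ 1 ∧ᶠ isOrd 0))))
    (imp_intro fun hw => .all_intro fun α => Derives.of_eq (φ := isOrd α ∧ᶠ sub α w →ᶠ
      inL α ∧ᶠ .ex (isLevel (α + 1) 0 ∧ᶠ .all (0 ∈ᶠ (α + 2) ↔ᶠ 0 ∈ᶠ 1 ∧ᶠ isOrd 0)))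
      (imp_intro fun {Γ} _ hα => exists_level hw.up hα.left fun {Γ} _ y hy => ?_)
      (by simp [Fml.inst, Fml.rename, Fml.iff])) (by simp [Fml.inst, Fml.rename, Fml.iff])
  have h := Derives.mem_level_iff hw.up hα.up.left hα.up.right hy
  -- Since `L_α` is transitive, `α = L_α ∩ Ord` is definable over it and appears in `L_{α⁺}`.
  refine .andI (exists_succ α fun {Γ} _ β hβ => exists_level hw.up
    (hα.up.left.ord_succ hβ) fun {Γ} _ z hz => inL_intro (hα.up.left.ord_succ hβ.up) hz
      (hz.level_mem hβ.up.self_mem_succ hy.up (inDef_ord hw.up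
        (hw.up.level_trans hα.up.left.ord_trans hy.up) fun a => (h a).up)))
    (.exI y (Derives.of_eq (φ := isLevel α y ∧ᶠ .all (0 ∈ᶠ (α + 1) ↔ᶠ 0 ∈ᶠ (y + 1) ∧ᶠ isOrd 0))
      (.andI hy (.all_intro h)) (by simp [Fml.inst, Fml.rename, Fml.iff])))
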